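/- For $s\in\mathbb Z_{>0}$ and complex $|z|<1$ let $\mathrm{Li}_s(z)=\sum_{n\ge 1} z^n/n^s$, and put $\mathcal G=\operatorname{Im}\mathrm{Li}_3\bigl(\frac{1+i}{2}\bigr)$. For $k,N\in\mathbb Z_{>0}$ let $\mathfrak Z_k(N)\subseteq\mathbb C$ be the $\mathbb Q$-linear span of all values $$\mathrm{Li}_{s_1,\dots,s_m}(z_1,\dots,z_m)=\sum_{n_1>\cdots>n_m\ge 1}\frac{z_1^{n_1}\cdots z_m^{n_m}}{n_1^{s_1}\cdots n_m^{s_m}}=\lim_{M\to\infty}\ \sum_{M\ge n_1>\cdots>n_m\ge 1}\frac{z_1^{n_1}\cdots z_m^{n_m}}{n_1^{s_1}\cdots n_m^{s_m}},$$ where $m\ge 1$, $s_1,\dots,s_m\in\mathbb Z_{>0}$, $s_1+\dots+s_m=k$, $z_1^N=\dots=z_m^N=1$ and $(s_1,z_1)\ne(1,1)$. Then $$\sum_{n=0}^{\infty}\frac{1}{(2n+1)^3\binom{2n}{n}}=\frac{32\,\mathcal G}{3}-\frac{4\pi\,\mathrm{Li}_2\bigl(2-\sqrt3\bigr)}{3}-\frac{\pi^3}{9}-\frac{\pi\bigl(\log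 2-\log(2+\sqrt3)\bigr)^2}{3},$$ and this number belongs to the $\mathbb Q$-vector space $i\,\mathfrak Z_3(12)=\{\,iz: z\in\mathfrak Z_3(12)\,\}$. -/

import Mathlib

open Filter Topology
open scoped Pointwise

noncomputable section

/-- The polylogarithm `Li_s(z) = ∑_{n ≥ 1} z^n / n^s`, as a function on the region of absolute
convergence of the series (for instance `|z| < 1`, or `|z| ≤ 1` and `s ≥ 2`). -/
def polylog (s : ℕ) (z : ℂ) : ℂ :=
  ∑' n : ℕ, z ^ (n + 1) / ((n + 1 : ℕ) : ℂ) ^ s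

/-- The Catalan-like constant `𝒢 = Im Li₃((i + 1) / 2)`. -/
def catalanLike : ℝ :=
  (polylog 3 ((Complex.I + 1) / 2)).im

/-- Truncated multiple polylogarithm. For the list `[(s₁, z₁), …, (s_m, z_m)]` and a bound `M`, this
is the finite sum
`∑_{M ≥ n₁ > ⋯ > n_m ≥ 1} z₁^{n₁} ⋯ z_m^{n_m} / (n₁^{s₁} ⋯ n_m^{s_m})`
(the outermost index is `n₁ = n + 1` with `n < M`, and then `n₂ ≤ n`). -/
def mplTrunc : List (ℕ × ℂ) → ℕ → ℂ
  | [], _ => 1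
  | p :: l, M => ∑ n ∈ Finset.range M,
      p.2 ^ (n + 1) / ((n + 1 : ℕ) : ℂ) ^ p.1 * mplTrunc l n

/-- `IsMPLValue [(s₁, z₁), …, (s_m, z_m)] v` says that the (possibly only conditionally convergent)
series `Li_{s₁,…,s_m}(z₁,…,z_m) = ∑_{n₁ > ⋯ > n_m ≥ 1} z₁^{n₁} ⋯ z_m^{n_m} / (n₁^{s₁} ⋯ n_m^{s_m})`,
summed in the order of increasing outermost index `n₁`, converges to `v`. -/
def IsMPLValue (l : List (ℕ × ℂ)) (v : ℂ) : Prop :=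
  Tendsto (mplTrunc l) atTop (𝓝 v)

/-- The list `[(s₁, z₁), …, (s_m, z_m)]` is an admissible index of weight `k` and level `N`: the `s_j`
are positive integers with sum `k`, the `z_j` are `N`-th roots of unity, and `(s₁, z₁) ≠ (1, 1)`.
The empty list has weight `0`, and it is the only one of weight `0`. -/
def IsCMZVIndex (k N : ℕ) (l : List (ℕ × ℂ)) : Prop :=
  (∀ p ∈ l, 0 < p.1 ∧ p.2 ^ N = 1) ∧ l.head? ≠ some (1, 1) ∧ (l.map Prod.fst).sum = k

/-- The `ℚ`-vector space `ℨ_k(N)` spanned by the cyclotomic multiple zeta values of weight `k` and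
level `N`. For `k = 0` it is `ℚ` (the span of the empty product `1`). -/
def cmzvSpan (k N : ℕ) : Submodule ℚ ℂ :=
  Submodule.span ℚ {v : ℂ | ∃ l : List (ℕ × ℂ), IsCMZVIndex k N l ∧ IsMPLValue l v}

end

/-! The function g(x) = arcsin x / √(1 - x²) has the coefficient 4^n / ((2n+1) C(2n,n)) at x^(2n+1).
Integrating it twice against dx/x and putting x = 1/2 therefore gives half of the series
(`hasSum_inv_centralBinom`). Under x = 2t/(1+t²) one has g(x) √(1-x²) = 2 arctan t and dx/x = (1/t -
2t/(1+t²)) dt. The point x = 1/2 becomes t = T = 2 - √3, and the sum becomes a combination of Li_3,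
S_{1,2} and log · Li_2 at ±iT (`polySeries_two_arcsinCoeff`). Functional equations are proved
uniformly: the derivative of the difference vanishes on a convex open set, and the constant is a
limit, usually at a boundary point (`Convex.eq_of_hasDerivAt_zero_of_tendsto`).

Closed form. Write iT = v² with v = `baseRoot`. A polarisation identity expresses S_{1,2}(v²)
through S_{1,2}(±v) and polylogarithms at ±(1-v)/(1+v) (`nielsenS12_sq`); at this v the Cayley image
is the conjugate of v. Hence the imaginary parts of Li_3(±v) and Li_2(±v) cancel against those that
duplication produces from Li_3(v²) and Li_2(v²). Landen-type formulas turn S_{1,2}(v) and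
S_{1,2}(-v) into Li_3(v/(v-1)) and Li_3(1/(1+v)). The difference of the imaginary parts of these two
is governed by a relation between four trilogarithms on curves e^{i(mφ+δ)}/(2 cos φ)
(`im_polylog_three_secCurve`), which at φ = π/4 produces Im Li_3((1+i)/2). The real parts of
Li_2(±v) that remain are found from the five-term relation at v and its conjugate
(`polylog_two_baseRoot_re`) and from the reflection formula (`polylog_two_odd_baseRoot_re`).

Membership. The point -iT is the Cayley image of ζ = e^{πi/6}. After M = (1-w)/(1+w) the combination
`arcsinPrimitive` has a derivative in w built from log w, log(1-w²) and 1/(1-w²), so it equals, up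
to a constant, an explicit weight-three combination of double and single polylogarithms at ±w with
coefficients in powers of log w and πi (`mplPrimitive`). By Abel's theorem its radial limits at w =
1 and w = ζ are made of multiple polylogarithm values at twelfth roots of unity, multiplied by
powers of πi. Multiplication by πi = 2 Li_1(i) - 2 Li_1(-i) raises the weight by one and stays in
the spans, by the stuffle product (`pi_mul_I_mul_mem_cmzvSpan`). -/

noncomputable section

/-! ### Power series with coefficients of at most linear growth -/

/-- The power series `∑_{n ≥ 1} c_{n-1} z^n / n^s`. -/
def polySeries (s : ℕ) (c : ℕ → ℂ) (z : ℂ) : ℂ :=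
  ∑' n : ℕ, z ^ (n + 1) / ((n + 1 : ℕ) : ℂ) ^ s * c n

theorem polylog_eq_polySeries (s : ℕ) : polylog s = polySeries s (fun _ => 1) := by
  funext z; simp [polylog, polySeries]

/-- The bound n + 1 on the coefficients covers constants, depth-one truncated sums and the arcsine
coefficients (even multiplied by n + 1) at once. -/
theorem norm_coeff_div_le (s : ℕ) {c : ℕ → ℂ} (hc : ∀ n, ‖c n‖ ≤ n + 1) (z : ℂ) (n k : ℕ) :
    ‖z ^ k / ((n + 1 : ℕ) : ℂ) ^ s * c n‖ ≤ ‖z‖ ^ k * (n + 1) := by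
  rw [norm_mul, norm_div, norm_pow, norm_pow, Complex.norm_natCast]
  have h1 : (1 : ℝ) ≤ ((n + 1 : ℕ) : ℝ) ^ s := one_le_pow₀ (by push_cast; linarith [n.cast_nonneg (α := ℝ)])
  gcongr
  · exact div_le_self (by positivity) h1
  · exact hc n

theorem summable_polySeries (s : ℕ) {c : ℕ → ℂ} (hc : ∀ n, ‖c n‖ ≤ n + 1) {z : ℂ} (hz : ‖z‖ < 1) :
    Summable (fun n : ℕ => z ^ (n + 1) / ((n + 1 : ℕ) : ℂ) ^ s * c n) := by
  have h : Summable (fun n : ℕ => ‖z‖ ^ (n + 1) * ((n : ℝ) + 1)) := by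
    have := summable_pow_mul_geometric_of_norm_lt_one 1 (r := ‖z‖) (by simpa using hz)
    have := (summable_nat_add_iff 1).mpr this
    refine this.congr fun n => ?_
    push_cast; ring
  exact .of_norm_bounded h fun n => norm_coeff_div_le s hc z n _

/-- Termwise differentiation on a ball of radius r with |z| < r < 1. The derivative is written
without dividing by z, so that it also gives continuity at the origin, where constants of
integration are determined. -/
theorem hasDerivAt_polySeries (s : ℕ) {c : ℕ → ℂ} (hc : ∀ n, ‖c n‖ ≤ n + 1) {z : ℂ}
    (hz : ‖z‖ < 1) :
    HasDerivAt (polySeries (s + 1) c) (∑' n : ℕ, z ^ n / ((n + 1 : ℕ) : ℂ) ^ s * c n) z := by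
  obtain ⟨r, hzr, hr⟩ := exists_between hz
  have hr0 : 0 ≤ r := (norm_nonneg z).trans hzr.le
  have h : Summable (fun n : ℕ => r ^ n * ((n : ℝ) + 1)) := by
    have h1 := summable_pow_mul_geometric_of_norm_lt_one 1 (r := r)
      (by rwa [Real.norm_of_nonneg hr0])
    have h0 := summable_pow_mul_geometric_of_norm_lt_one 0 (r := r)
      (by rwa [Real.norm_of_nonneg hr0])
    refine (h1.add h0).congr fun n => ?_
    simp; ring
  have hzr' : z ∈ Metric.ball (0 : ℂ) r := by simpa using hzr
  unfold polySeries
  refine hasDerivAt_tsum_of_isPreconnected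
    (g := fun n z => z ^ (n + 1) / ((n + 1 : ℕ) : ℂ) ^ (s + 1) * c n)
    (g' := fun n z => z ^ n / ((n + 1 : ℕ) : ℂ) ^ s * c n) h Metric.isOpen_ball
    (convex_ball _ _).isPreconnected ?_ ?_ hzr' (summable_polySeries (s + 1) hc hz) hzr'
  · intro n y _
    have h1 := (((hasDerivAt_pow (n + 1) y).div_const (((n + 1 : ℕ) : ℂ) ^ (s + 1))).mul_const (c n))
    refine h1.congr_deriv ?_
    have : ((n + 1 : ℕ) : ℂ) ≠ 0 := Nat.cast_ne_zero.mpr n.succ_ne_zero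
    rw [Nat.add_sub_cancel]
    field_simp
    ring
  · intro n y hy
    refine (norm_coeff_div_le s hc y n n).trans ?_
    have : ‖y‖ ≤ r := by simpa using (Metric.mem_ball.mp hy).le
    gcongr

theorem mul_tsum_eq_polySeries (s : ℕ) (c : ℕ → ℂ) (z : ℂ) :
    z * ∑' n : ℕ, z ^ n / ((n + 1 : ℕ) : ℂ) ^ s * c n = polySeries s c z := by
  rw [polySeries, ← tsum_mul_left]
  exact tsum_congr fun n => by ring

theorem hasDerivAt_polySeries_succ (s : ℕ) {c : ℕ → ℂ} (hc : ∀ n, ‖c n‖ ≤ n + 1) {z : ℂ}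
    (hz : ‖z‖ < 1) (h0 : z ≠ 0) :
    HasDerivAt (polySeries (s + 1) c) (polySeries s c z / z) z := by
  rw [← mul_tsum_eq_polySeries, mul_div_cancel_left₀ _ h0]
  exact hasDerivAt_polySeries s hc hz

theorem polySeries_zero (s : ℕ) (c : ℕ → ℂ) : polySeries s c 0 = 0 := by
  simp [polySeries]

theorem polylog_zero (s : ℕ) : polylog s 0 = 0 := by
  rw [polylog_eq_polySeries, polySeries_zero]

theorem continuousAt_polySeries (s : ℕ) {c : ℕ → ℂ} (hc : ∀ n, ‖c n‖ ≤ n + 1) {z : ℂ}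
    (hz : ‖z‖ < 1) : ContinuousAt (polySeries (s + 1) c) z :=
  (hasDerivAt_polySeries s hc hz).continuousAt

theorem norm_one_le_succ (n : ℕ) : ‖(1 : ℂ)‖ ≤ n + 1 := by
  rw [norm_one]; linarith [n.cast_nonneg (α := ℝ)]

theorem continuousAt_polylog (s : ℕ) {z : ℂ} (hz : ‖z‖ < 1) : ContinuousAt (polylog (s + 1)) z := by
  rw [polylog_eq_polySeries]
  exact continuousAt_polySeries s norm_one_le_succ hz

theorem polylog_one {z : ℂ} (hz : ‖z‖ < 1) : polylog 1 z = -Complex.log (1 - z) := by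
  have h := (Complex.hasSum_taylorSeries_neg_log hz)
  rw [← hasSum_nat_add_iff' 1] at h
  have := h.tsum_eq
  simp only [Finset.range_one, Finset.sum_singleton, pow_zero, Nat.cast_zero, div_zero, sub_zero] at this
  rw [← this, polylog]
  simp

theorem HasDerivAt.polySeries_succ {𝕜 : Type*} [NontriviallyNormedField 𝕜] [NormedAlgebra 𝕜 ℂ]
    {f : 𝕜 → ℂ} {f' : ℂ} {x : 𝕜} (hf : HasDerivAt f f' x) (s : ℕ) {c : ℕ → ℂ}
    (hc : ∀ n, ‖c n‖ ≤ n + 1) (h1 : ‖f x‖ < 1) (h0 : f x ≠ 0) :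
    HasDerivAt (fun x => polySeries (s + 1) c (f x)) (polySeries s c (f x) * (f' / f x)) x := by
  have := HasDerivAt.scomp x (hasDerivAt_polySeries_succ s hc h1 h0) hf
  exact this.congr_deriv (by rw [smul_eq_mul]; ring)

theorem HasDerivAt.polylog_succ {𝕜 : Type*} [NontriviallyNormedField 𝕜] [NormedAlgebra 𝕜 ℂ]
    {f : 𝕜 → ℂ} {f' : ℂ} {x : 𝕜} (hf : HasDerivAt f f' x) (s : ℕ) (h1 : ‖f x‖ < 1) (h0 : f x ≠ 0) :
    HasDerivAt (fun x => polylog (s + 1) (f x)) (polylog s (f x) * (f' / f x)) x := by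
  simp only [polylog_eq_polySeries]
  exact hf.polySeries_succ s norm_one_le_succ h1 h0

/-- The dilogarithm: chain rule with the logarithm written out. -/
theorem HasDerivAt.polylog_two {𝕜 : Type*} [NontriviallyNormedField 𝕜] [NormedAlgebra 𝕜 ℂ]
    {f : 𝕜 → ℂ} {f' : ℂ} {x : 𝕜} (hf : HasDerivAt f f' x) (h1 : ‖f x‖ < 1) (h0 : f x ≠ 0) :
    HasDerivAt (fun x => polylog 2 (f x)) (-Complex.log (1 - f x) * (f' / f x)) x := by
  have := hf.polylog_succ 1 h1 h0
  rwa [polylog_one h1] at this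

/-- In weight at least two the terms are dominated by 1/n² uniformly up to the unit circle. Limits
at boundary points of the disc rest on this. -/
theorem continuousOn_polylog (s : ℕ) : ContinuousOn (polylog (s + 2)) (Metric.closedBall 0 1) := by
  have hs : Summable (fun n : ℕ => 1 / ((n + 1 : ℕ) : ℝ) ^ 2) :=
    (summable_nat_add_iff (f := fun n : ℕ => 1 / (n : ℝ) ^ 2) 1).mpr
      (Real.summable_one_div_nat_pow.mpr one_lt_two)
  refine continuousOn_tsum (fun n => ?_) hs fun n z hz => ?_
  · fun_prop
  · rw [norm_div, norm_pow, norm_pow, Complex.norm_natCast]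
    have hz : ‖z‖ ≤ 1 := by simpa using hz
    have h1 : (1 : ℝ) ≤ ((n + 1 : ℕ) : ℝ) := by push_cast; linarith [n.cast_nonneg (α := ℝ)]
    have h2 : ((n + 1 : ℕ) : ℝ) ^ 2 ≤ ((n + 1 : ℕ) : ℝ) ^ (s + 2) := pow_le_pow_right₀ h1 (by omega)
    exact div_le_div₀ zero_le_one (pow_le_one₀ (norm_nonneg _) hz) (by positivity) h2

theorem norm_mplTrunc_singleton_le (s : ℕ) {q : ℂ} (hq : ‖q‖ ≤ 1) (n : ℕ) :
    ‖mplTrunc [(s, q)] n‖ ≤ n + 1 := by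
  have h : ∀ i ∈ Finset.range n, ‖q ^ (i + 1) / ((i + 1 : ℕ) : ℂ) ^ s * mplTrunc [] i‖ ≤ 1 := by
    intro i _
    rw [mplTrunc, mul_one, norm_div, norm_pow, norm_pow, Complex.norm_natCast]
    have h1 : (1 : ℝ) ≤ ((i + 1 : ℕ) : ℝ) ^ s :=
      one_le_pow₀ (by push_cast; linarith [i.cast_nonneg (α := ℝ)])
    exact div_le_one_of_le₀ ((pow_le_one₀ (norm_nonneg _) hq).trans h1) (by positivity)
  have := (norm_sum_le _ _).trans (Finset.sum_le_sum h)
  rw [mplTrunc]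
  refine this.trans ?_
  simp

/-- `d/dz ∑_{n > m} z^n q^m / (n m^s) = Li_s(q z) / (1 - z)`. -/
theorem hasDerivAt_polySeries_mplTrunc (s : ℕ) {q : ℂ} (hq : ‖q‖ ≤ 1) {z : ℂ} (hz : ‖z‖ < 1) :
    HasDerivAt (polySeries 1 (mplTrunc [(s, q)])) (polylog s (q * z) / (1 - z)) z := by
  have hc := norm_mplTrunc_singleton_le s hq
  have h := hasDerivAt_polySeries 0 hc hz
  convert h using 1
  have hz1 : 1 - z ≠ 0 := by
    intro h
    have : z = 1 := (sub_eq_zero.mp h).symm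
    simp [this] at hz
  rw [div_eq_iff hz1]
  have hs : Summable (fun n : ℕ => z ^ n * mplTrunc [(s, q)] n) := by
    have h1 : Summable (fun n : ℕ => ‖z‖ ^ n * ((n : ℝ) + 1)) := by
      have h1 := summable_pow_mul_geometric_of_norm_lt_one 1 (r := ‖z‖) (by simpa using hz)
      have h0 := summable_pow_mul_geometric_of_norm_lt_one 0 (r := ‖z‖) (by simpa using hz)
      refine (h1.add h0).congr fun n => ?_
      simp; ring
    refine .of_norm_bounded h1 fun n => ?_
    have := norm_coeff_div_le 0 hc z n n
    simpa using this
  have hs' := hs.hasSum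
  -- Multiplying by 1 - z replaces the coefficients by their first differences, which are the terms
  -- of Li_s; the zeroth coefficient vanishes, so no boundary term is left.
  have h1 := (hasSum_nat_add_iff' 1).mpr hs'
  have h2 := hs'.mul_left z
  have h3 := (h1.sub h2).tsum_eq
  simp only [pow_zero, div_one]
  have h0 : mplTrunc [(s, q)] 0 = 0 := by simp [mplTrunc]
  simp only [Finset.range_one, Finset.sum_singleton, h0, mul_zero, sub_zero] at h3
  rw [show ∀ A : ℂ, A * (1 - z) = A - z * A from fun A => by ring, ← h3, polylog]
  refine tsum_congr fun n => ?_
  have : mplTrunc [(s, q)] (n + 1) = mplTrunc [(s, q)] n + q ^ (n + 1) / ((n + 1 : ℕ) : ℂ) ^ s := by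
    simp [mplTrunc, Finset.sum_range_succ]
  rw [this, mul_pow]; ring

/-- A function with vanishing derivative on an open convex set equals its limit at a boundary
point. -/
theorem Convex.eq_of_hasDerivAt_zero_of_tendsto {𝕜 E : Type*} [RCLike 𝕜]
    [NormedAddCommGroup E] [NormedSpace 𝕜 E]
    {U : Set 𝕜} (hU : Convex ℝ U) (hUo : IsOpen U) {f : 𝕜 → E} (hf : ∀ z ∈ U, HasDerivAt f 0 z)
    {l : Filter 𝕜} [l.NeBot] (hl : ∀ᶠ z in l, z ∈ U) {c : E} (ht : Tendsto f l (𝓝 c)) {z : 𝕜}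
    (hz : z ∈ U) : f z = c := by
  refine tendsto_nhds_unique (tendsto_const_nhds.congr' ?_) ht
  filter_upwards [hl] with x hx
  exact hUo.is_const_of_deriv_eq_zero hU.isPreconnected
    (fun y hy => (hf y hy).differentiableAt.differentiableWithinAt) (fun y hy => (hf y hy).deriv)
    hz hx

/-! ### Nielsen's S_{1,2} and its derivative -/

/-- Nielsen's polylogarithm `S_{1,2}(z) = ∑_{n > m ≥ 1} z^n / (n² m)`. -/
def nielsenS12 : ℂ → ℂ := polySeries 2 (mplTrunc [(1, 1)])

theorem one_sub_mem_slitPlane {z : ℂ} (hz : ‖z‖ < 1) : 1 - z ∈ Complex.slitPlane := by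
  left
  have := (Complex.abs_re_le_norm z).trans_lt hz
  have := (abs_lt.mp this).2
  simp; linarith

theorem one_add_mem_slitPlane {z : ℂ} (hz : ‖z‖ < 1) : 1 + z ∈ Complex.slitPlane := by
  simpa using one_sub_mem_slitPlane (z := -z) (by simpa using hz)

theorem hasDerivAt_log_one_sub {z : ℂ} (hz : ‖z‖ < 1) :
    HasDerivAt (fun z => Complex.log (1 - z)) (-1 / (1 - z)) z :=
  ((hasDerivAt_id z).const_sub 1).clog (one_sub_mem_slitPlane hz)

theorem hasDerivAt_log_one_add {z : ℂ} (hz : ‖z‖ < 1) :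
    HasDerivAt (fun z => Complex.log (1 + z)) (1 / (1 + z)) z :=
  ((hasDerivAt_id z).const_add 1).clog (one_add_mem_slitPlane hz)

theorem norm_mplTrunc_one_one_le (n : ℕ) : ‖mplTrunc [(1, 1)] n‖ ≤ n + 1 :=
  norm_mplTrunc_singleton_le 1 (by simp) n

/-- Both sides have derivative -log(1-z)/(1-z) and vanish at 0. Consequently z · d/dz of S_{1,2} is
log²(1-z)/2. -/
theorem polySeries_one_harmonic {z : ℂ} (hz : ‖z‖ < 1) :
    polySeries 1 (mplTrunc [(1, 1)]) z = Complex.log (1 - z) ^ 2 / 2 := by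
  rw [← sub_eq_zero]
  have hd : ∀ z ∈ Metric.ball (0 : ℂ) 1, HasDerivAt
      (fun z => polySeries 1 (mplTrunc [(1, 1)]) z - Complex.log (1 - z) ^ 2 / 2) 0 z := by
    intro z hz
    have hz : ‖z‖ < 1 := by simpa using hz
    have h1 := hasDerivAt_polySeries_mplTrunc 1 (q := 1) (by simp) hz
    have h2 := ((hasDerivAt_log_one_sub hz).pow 2).div_const 2
    refine (h1.sub h2).congr_deriv ?_
    rw [one_mul, polylog_one hz]
    simp; ring
  refine Convex.eq_of_hasDerivAt_zero_of_tendsto (convex_ball _ _) Metric.isOpen_ball hd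
    (l := 𝓝 0) (Metric.isOpen_ball.mem_nhds (by simp)) ?_ (by simpa using hz)
  have := (hd 0 (by simp)).continuousAt.tendsto
  simpa [polySeries_zero] using this

theorem HasDerivAt.nielsenS12 {𝕜 : Type*} [NontriviallyNormedField 𝕜] [NormedAlgebra 𝕜 ℂ]
    {f : 𝕜 → ℂ} {f' : ℂ} {x : 𝕜} (hf : HasDerivAt f f' x) (h1 : ‖f x‖ < 1) (h0 : f x ≠ 0) :
    HasDerivAt (fun x => nielsenS12 (f x)) (Complex.log (1 - f x) ^ 2 / 2 * (f' / f x)) x := by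
  have := hf.polySeries_succ 1 norm_mplTrunc_one_one_le h1 h0
  rwa [polySeries_one_harmonic h1] at this

theorem continuousAt_nielsenS12 {z : ℂ} (hz : ‖z‖ < 1) : ContinuousAt nielsenS12 z :=
  continuousAt_polySeries 1 norm_mplTrunc_one_one_le hz

theorem nielsenS12_zero : nielsenS12 0 = 0 := polySeries_zero _ _

/-! ### Duplication, special values and conjugation -/

/-- The duplication formula on the closed unit disc. -/
theorem polylog_sq (s : ℕ) {z : ℂ} (hz : ‖z‖ ≤ 1) :
    polylog (s + 2) (z ^ 2) = 2 ^ (s + 1) * (polylog (s + 2) z + polylog (s + 2) (-z)) := by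
  have hsum : ∀ {z : ℂ}, ‖z‖ ≤ 1 →
      Summable (fun n : ℕ => z ^ (n + 1) / ((n + 1 : ℕ) : ℂ) ^ (s + 2)) := by
    intro z hz
    have hs : Summable (fun n : ℕ => 1 / ((n + 1 : ℕ) : ℝ) ^ (s + 2)) :=
      (summable_nat_add_iff (f := fun n : ℕ => 1 / (n : ℝ) ^ (s + 2)) 1).mpr
        (Real.summable_one_div_nat_pow.mpr (by omega))
    refine .of_norm_bounded hs fun n => ?_
    rw [norm_div, norm_pow, norm_pow, Complex.norm_natCast]
    have := pow_le_one₀ (n := n + 1) (norm_nonneg z) hz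
    gcongr
  have h1 := (hsum hz).hasSum.add (hsum (z := -z) (by simpa using hz)).hasSum
  have h2 := (hsum (z := z ^ 2) (by rw [norm_pow]; exact pow_le_one₀ (norm_nonneg _) hz)).hasSum
  have h2' := h2.mul_left ((2 ^ (s + 1) : ℂ)⁻¹)
  -- The index n belongs to the exponent n + 1, so the terms with even n carry odd powers and
  -- cancel.
  have he : HasSum (fun k : ℕ => (fun n : ℕ => z ^ (n + 1) / ((n + 1 : ℕ) : ℂ) ^ (s + 2)
      + (-z) ^ (n + 1) / ((n + 1 : ℕ) : ℂ) ^ (s + 2)) (2 * k)) 0 := by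
    refine hasSum_zero.congr_fun fun k => ?_
    have : Odd (2 * k + 1) := ⟨k, rfl⟩
    simp only [this.neg_pow]
    ring
  have ho := HasSum.even_add_odd he (f := fun n : ℕ => z ^ (n + 1) / ((n + 1 : ℕ) : ℂ) ^ (s + 2)
      + (-z) ^ (n + 1) / ((n + 1 : ℕ) : ℂ) ^ (s + 2)) (m' := (2 ^ (s + 1) : ℂ)⁻¹ * polylog (s + 2) (z ^ 2)) (by
    refine h2'.congr_fun fun k => ?_
    have : Even (2 * k + 1 + 1) := ⟨k + 1, by ring⟩
    rw [this.neg_pow]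
    have h0 : ((k + 1 : ℕ) : ℂ) ≠ 0 := Nat.cast_ne_zero.mpr k.succ_ne_zero
    have h3 : ((2 * k + 1 + 1 : ℕ) : ℂ) = 2 * ((k + 1 : ℕ) : ℂ) := by push_cast; ring
    rw [h3, mul_pow, ← pow_mul, show 2 * (k + 1) = 2 * k + 1 + 1 by ring]
    field_simp
    ring)
  have := ho.unique h1
  rw [zero_add, inv_mul_eq_iff_eq_mul₀ (pow_ne_zero _ two_ne_zero)] at this
  exact this

theorem polylog_two_one : polylog 2 1 = (Real.pi : ℂ) ^ 2 / 6 := by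
  have h := (hasSum_nat_add_iff' (f := fun n : ℕ => 1 / (n : ℝ) ^ 2) 1).mpr hasSum_zeta_two
  have h := (Complex.hasSum_ofReal.mpr h).tsum_eq
  simp only [Finset.range_one, Finset.sum_singleton] at h
  rw [polylog]
  simp only [one_pow]
  push_cast at h ⊢
  rw [h]; simp

theorem polylog_two_neg_one : polylog 2 (-1) = -(Real.pi : ℂ) ^ 2 / 12 := by
  have := polylog_sq 0 (z := 1) (by simp)
  rw [one_pow, zero_add, polylog_two_one] at this
  linear_combination -this / 2

theorem polylog_conj (s : ℕ) (z : ℂ) :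
    polylog s (starRingEnd ℂ z) = starRingEnd ℂ (polylog s z) := by
  rw [polylog, polylog, Complex.conj_tsum]
  simp

theorem polylog_ofReal_im (s : ℕ) (x : ℝ) : (polylog s x).im = 0 := by
  rw [← Complex.conj_eq_iff_im, ← polylog_conj, Complex.conj_ofReal]

/-- Differentiability gives f(v) = O(v), and |v log v| ≤ |v| (|log|v|| + π) tends to 0. Since the
argument is bounded, the approach to 0 is unrestricted. -/
theorem tendsto_log_mul {f : ℂ → ℂ} {f' : ℂ} (hf : HasDerivAt f f' 0) (h0 : f 0 = 0) :
    Tendsto (fun v => Complex.log v * f v) (𝓝 0) (𝓝 0) := by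
  have h1 := hf.isBigO_sub
  simp only [h0, sub_zero] at h1
  have h2 := (Asymptotics.isBigO_refl Complex.log (𝓝 (0 : ℂ))).mul h1
  refine h2.trans_tendsto ?_
  rw [tendsto_zero_iff_norm_tendsto_zero]
  have h3 : Tendsto (fun v : ℂ => |‖v‖ * Real.log ‖v‖| + Real.pi * ‖v‖) (𝓝 0) (𝓝 0) := by
    have : Continuous (fun v : ℂ => |‖v‖ * Real.log ‖v‖| + Real.pi * ‖v‖) :=
      (Real.continuous_mul_log.comp continuous_norm).abs.add (by fun_prop)
    simpa using this.tendsto 0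
  refine squeeze_zero (fun _ => norm_nonneg _) (fun v => ?_) h3
  rw [norm_mul, abs_mul, abs_norm]
  have : ‖Complex.log v‖ ≤ |Real.log ‖v‖| + Real.pi := by
    refine (Complex.norm_le_abs_re_add_abs_im _).trans ?_
    rw [Complex.log_re, Complex.log_im]
    have := Complex.abs_arg_le_pi v
    gcongr
  nlinarith [norm_nonneg v]

/-! ### Logarithms in the right half-plane and the Cayley involution -/

theorem log_mul_of_re_pos {x y : ℂ} (hx : 0 < x.re) (hy : 0 < y.re) :
    Complex.log (x * y) = Complex.log x + Complex.log y := by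
  have h1 := abs_lt.mp (Complex.abs_arg_lt_pi_div_two_iff.mpr (Or.inl hx))
  have h2 := abs_lt.mp (Complex.abs_arg_lt_pi_div_two_iff.mpr (Or.inl hy))
  refine Complex.log_mul ?_ ?_ ⟨by linarith, by linarith⟩
  · rintro rfl; simp at hx
  · rintro rfl; simp at hy

theorem log_inv_of_re_pos {x : ℂ} (hx : 0 < x.re) : Complex.log x⁻¹ = -Complex.log x := by
  have h1 := abs_lt.mp (Complex.abs_arg_lt_pi_div_two_iff.mpr (Or.inl hx))
  exact Complex.log_inv _ (by linarith [Real.pi_pos])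

theorem inv_re_pos {x : ℂ} (hx : 0 < x.re) : 0 < (x⁻¹).re := by
  have : x ≠ 0 := by rintro rfl; simp at hx
  rw [Complex.inv_re]
  exact div_pos hx (Complex.normSq_pos.mpr this)

theorem log_div_of_re_pos {x y : ℂ} (hx : 0 < x.re) (hy : 0 < y.re) :
    Complex.log (x / y) = Complex.log x - Complex.log y := by
  rw [div_eq_mul_inv, log_mul_of_re_pos hx (inv_re_pos hy), log_inv_of_re_pos hy, sub_eq_add_neg]

/-- The right half of the open unit disc. -/
def halfDisc : Set ℂ := {z | ‖z‖ < 1 ∧ 0 < z.re}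

theorem convex_halfDisc : Convex ℝ halfDisc := by
  have : halfDisc = Metric.ball 0 1 ∩ {z | 0 < z.re} := by ext; simp [halfDisc]
  rw [this]
  exact (convex_ball _ _).inter (convex_halfSpace_re_gt 0)

theorem isOpen_halfDisc : IsOpen halfDisc :=
  (isOpen_lt continuous_norm continuous_const).inter (isOpen_lt continuous_const Complex.continuous_re)

theorem zero_mem_closure_halfDisc_inter {r : ℝ} (hr : 0 < r) :
    (𝓝[halfDisc ∩ {z | z.re < r}] (0 : ℂ)).NeBot := by
  rw [← mem_closure_iff_nhdsWithin_neBot, Metric.mem_closure_iff]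
  intro ε hε
  set t := min (min (ε / 2) (1 / 2)) (r / 2) with ht
  have h0 : 0 < t := by positivity
  have h1 : t ≤ ε / 2 := (min_le_left _ _).trans (min_le_left _ _)
  have h2 : t ≤ 1 / 2 := (min_le_left _ _).trans (min_le_right _ _)
  have h3 : t ≤ r / 2 := min_le_right _ _
  refine ⟨(t : ℂ), ⟨⟨?_, by simpa using h0⟩, ?_⟩, ?_⟩
  · rw [Complex.norm_real, Real.norm_of_nonneg h0.le]; linarith
  · simp; linarith
  · rw [dist_zero_left, Complex.norm_real, Real.norm_of_nonneg h0.le]; linarith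

instance : (𝓝[halfDisc] (0 : ℂ)).NeBot :=
  (zero_mem_closure_halfDisc_inter one_pos).mono (nhdsWithin_mono _ Set.inter_subset_left)

theorem ne_zero_of_re_pos {z : ℂ} (hz : 0 < z.re) : z ≠ 0 := by rintro rfl; simp at hz

theorem one_sub_re_pos {z : ℂ} (hz : ‖z‖ < 1) : 0 < (1 - z).re := by
  have := (abs_lt.mp ((Complex.abs_re_le_norm z).trans_lt hz)).2
  simp; linarith

theorem one_add_re_pos {z : ℂ} (hz : ‖z‖ < 1) : 0 < (1 + z).re := by
  have := (abs_lt.mp ((Complex.abs_re_le_norm z).trans_lt hz)).1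
  simp; linarith

theorem one_sub_ne_zero {z : ℂ} (hz : ‖z‖ < 1) : 1 - z ≠ 0 := ne_zero_of_re_pos (one_sub_re_pos hz)

theorem one_add_ne_zero {z : ℂ} (hz : ‖z‖ < 1) : 1 + z ≠ 0 := ne_zero_of_re_pos (one_add_re_pos hz)

theorem log_one_sub_sq {z : ℂ} (hz : ‖z‖ < 1) :
    Complex.log (1 - z ^ 2) = Complex.log (1 - z) + Complex.log (1 + z) := by
  rw [← log_mul_of_re_pos (one_sub_re_pos hz) (one_add_re_pos hz)]; ring_nf

/-- The involution `z ↦ (1 - z) / (1 + z)`. -/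
def cayley (z : ℂ) : ℂ := (1 - z) / (1 + z)

theorem one_sub_cayley {z : ℂ} (hz : 1 + z ≠ 0) : 1 - cayley z = 2 * z / (1 + z) := by
  rw [cayley]; field_simp; ring

theorem one_add_cayley {z : ℂ} (hz : 1 + z ≠ 0) : 1 + cayley z = 2 / (1 + z) := by
  rw [cayley]; field_simp; ring

/-- The reason is |1+z|² - |1-z|² = 4 Re z. Together with `cayley_re_pos` this shows that the
involution exchanges the two conditions defining `halfDisc`. -/
theorem norm_cayley_lt_one {z : ℂ} (hz : 0 < z.re) : ‖cayley z‖ < 1 := by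
  have h1 : 1 + z ≠ 0 := ne_zero_of_re_pos (by simp; linarith)
  rw [cayley, norm_div, div_lt_one (norm_pos_iff.mpr h1)]
  refine lt_of_pow_lt_pow_left₀ 2 (norm_nonneg _) ?_
  rw [Complex.sq_norm, Complex.sq_norm, Complex.normSq_apply, Complex.normSq_apply]
  simp
  nlinarith

theorem cayley_cayley {z : ℂ} (hz : 1 + z ≠ 0) : cayley (cayley z) = z := by
  rw [cayley, one_sub_cayley hz, one_add_cayley hz]; field_simp

theorem cayley_re_pos {z : ℂ} (hz : ‖z‖ < 1) : 0 < (cayley z).re := by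
  rw [cayley, Complex.div_re, ← add_div]
  have h2 : Complex.normSq z < 1 := by
    rw [Complex.normSq_eq_norm_sq]
    exact pow_lt_one₀ (norm_nonneg _) hz two_ne_zero
  rw [Complex.normSq_apply] at h2
  refine div_pos ?_ (Complex.normSq_pos.mpr (one_add_ne_zero hz))
  simp
  nlinarith

theorem cayley_mem_halfDisc {z : ℂ} (hz : z ∈ halfDisc) : cayley z ∈ halfDisc :=
  ⟨norm_cayley_lt_one hz.2, cayley_re_pos hz.1⟩

theorem log_cayley {z : ℂ} (hz : ‖z‖ < 1) :
    Complex.log (cayley z) = Complex.log (1 - z) - Complex.log (1 + z) :=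
  log_div_of_re_pos (one_sub_re_pos hz) (one_add_re_pos hz)

theorem log_two_mul {z : ℂ} (hz : z ≠ 0) : Complex.log (2 * z) = Real.log 2 + Complex.log z := by
  have := Complex.log_ofReal_mul (r := 2) (by norm_num) hz
  simpa using this

theorem log_one_add_cayley {z : ℂ} (hz : z ∈ halfDisc) :
    Complex.log (1 + cayley z) = Real.log 2 - Complex.log (1 + z) := by
  rw [one_add_cayley (one_add_ne_zero hz.1), div_eq_mul_inv,
    log_two_mul (inv_ne_zero (one_add_ne_zero hz.1)), log_inv_of_re_pos (one_add_re_pos hz.1)]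
  ring

theorem log_one_sub_cayley {z : ℂ} (hz : z ∈ halfDisc) :
    Complex.log (1 - cayley z) = Real.log 2 + Complex.log z - Complex.log (1 + z) := by
  rw [one_sub_cayley (one_add_ne_zero hz.1), mul_div_assoc,
    log_two_mul (div_ne_zero (ne_zero_of_re_pos hz.2) (one_add_ne_zero hz.1)),
    log_div_of_re_pos hz.2 (one_add_re_pos hz.1)]
  ring

theorem hasDerivAt_cayley {z : ℂ} (hz : ‖z‖ < 1) : HasDerivAt cayley (-2 / (1 + z) ^ 2) z := by
  have h := ((hasDerivAt_id z).const_sub 1).div ((hasDerivAt_id z).const_add 1) (one_add_ne_zero hz)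
  refine h.congr_deriv ?_
  simp only [id]
  ring

theorem tendsto_cayley : Tendsto cayley (𝓝[halfDisc] 0) (𝓝[Metric.closedBall 0 1] 1) := by
  refine tendsto_nhdsWithin_iff.mpr ⟨?_, ?_⟩
  · have := (hasDerivAt_cayley (z := 0) (by simp)).continuousAt.tendsto
    rw [show cayley 0 = 1 by simp [cayley]] at this
    exact this.mono_left nhdsWithin_le_nhds
  · filter_upwards [self_mem_nhdsWithin] with z hz
    simpa using (norm_cayley_lt_one hz.2).le

theorem tendsto_polylog_cayley (s : ℕ) :
    Tendsto (fun v => polylog (s + 2) (cayley v)) (𝓝[halfDisc] 0) (𝓝 (polylog (s + 2) 1)) :=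
  ((continuousOn_polylog s).continuousWithinAt (by simp)).tendsto.comp tendsto_cayley

theorem tendsto_polylog_neg_cayley (s : ℕ) :
    Tendsto (fun v => polylog (s + 2) (-cayley v)) (𝓝[halfDisc] 0) (𝓝 (polylog (s + 2) (-1))) := by
  refine ((continuousOn_polylog s).continuousWithinAt (x := -1) (by simp)).tendsto.comp ?_
  have := tendsto_nhdsWithin_iff.mp tendsto_cayley
  refine tendsto_nhdsWithin_iff.mpr ⟨this.1.neg, ?_⟩
  filter_upwards [this.2] with z hz
  simpa using hz

theorem tendsto_polylog_zero (s : ℕ) : Tendsto (polylog (s + 1)) (𝓝[halfDisc] 0) (𝓝 0) := by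
  have := (continuousAt_polylog s (z := 0) (by simp)).tendsto
  rw [polylog_zero] at this
  exact this.mono_left nhdsWithin_le_nhds

theorem tendsto_polylog_neg_zero (s : ℕ) :
    Tendsto (fun v => polylog (s + 1) (-v)) (𝓝[halfDisc] 0) (𝓝 0) := by
  have := (continuousAt_polylog s (z := 0) (by simp)).tendsto
  rw [polylog_zero] at this
  refine Tendsto.mono_left (this.comp ?_) nhdsWithin_le_nhds
  simpa using (continuous_neg (G := ℂ)).tendsto 0

theorem hasDerivAt_log {v : ℂ} (hv : 0 < v.re) : HasDerivAt Complex.log v⁻¹ v :=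
  Complex.hasDerivAt_log (Or.inl hv)

theorem hasDerivAt_log_ratio {v : ℂ} (hv : ‖v‖ < 1) :
    HasDerivAt (fun v => Complex.log (1 - v) - Complex.log (1 + v))
      (-2 / ((1 - v) * (1 + v))) v := by
  refine ((hasDerivAt_log_one_sub hv).sub (hasDerivAt_log_one_add hv)).congr_deriv ?_
  have h1 := one_sub_ne_zero hv
  have h2 := one_add_ne_zero hv
  field_simp; ring

theorem hasDerivAt_polylog_cayley (s : ℕ) {v : ℂ} (hv : v ∈ halfDisc) :
    HasDerivAt (fun v => polylog (s + 1) (cayley v))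
      (polylog s (cayley v) * (-2 / ((1 - v) * (1 + v)))) v := by
  have h := (hasDerivAt_cayley hv.1).polylog_succ s (norm_cayley_lt_one hv.2)
    (ne_zero_of_re_pos (cayley_re_pos hv.1))
  refine h.congr_deriv ?_
  have h1 := one_sub_ne_zero hv.1
  have h2 := one_add_ne_zero hv.1
  rw [cayley]; field_simp

theorem hasDerivAt_polylog_neg_cayley (s : ℕ) {v : ℂ} (hv : v ∈ halfDisc) :
    HasDerivAt (fun v => polylog (s + 1) (-cayley v))
      (polylog s (-cayley v) * (-2 / ((1 - v) * (1 + v)))) v := by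
  have h := (hasDerivAt_cayley hv.1).fun_neg.polylog_succ s (by simpa using norm_cayley_lt_one hv.2)
    (by simpa using ne_zero_of_re_pos (cayley_re_pos hv.1))
  refine h.congr_deriv ?_
  have h1 := one_sub_ne_zero hv.1
  have h2 := one_add_ne_zero hv.1
  rw [cayley]; field_simp

theorem hasDerivAt_polylog (s : ℕ) {v : ℂ} (hv : ‖v‖ < 1) (h0 : v ≠ 0) :
    HasDerivAt (polylog (s + 1)) (polylog s v / v) v := by
  simpa [div_eq_mul_inv] using (hasDerivAt_id v).polylog_succ s hv h0

theorem hasDerivAt_polylog_neg (s : ℕ) {v : ℂ} (hv : ‖v‖ < 1) (h0 : v ≠ 0) :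
    HasDerivAt (fun v => polylog (s + 1) (-v)) (polylog s (-v) / v) v := by
  have := (hasDerivAt_id v).neg.polylog_succ s (by simpa using hv) (by simpa using h0)
  refine this.congr_deriv ?_
  simp [div_eq_mul_inv]

theorem polylog_one_neg {v : ℂ} (hv : ‖v‖ < 1) : polylog 1 (-v) = -Complex.log (1 + v) := by
  rw [polylog_one (by simpa using hv), sub_neg_eq_add]

theorem polylog_one_cayley {v : ℂ} (hv : v ∈ halfDisc) :
    polylog 1 (cayley v) = -(Real.log 2 + Complex.log v - Complex.log (1 + v)) := by
  rw [polylog_one (norm_cayley_lt_one hv.2), log_one_sub_cayley hv]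

theorem polylog_one_neg_cayley {v : ℂ} (hv : v ∈ halfDisc) :
    polylog 1 (-cayley v) = -(Real.log 2 - Complex.log (1 + v)) := by
  rw [polylog_one_neg (norm_cayley_lt_one hv.2), log_one_add_cayley hv]

theorem tendsto_log_mul_log_ratio :
    Tendsto (fun v => Complex.log v * (Complex.log (1 - v) - Complex.log (1 + v)))
      (𝓝[halfDisc] 0) (𝓝 0) :=
  (tendsto_log_mul (hasDerivAt_log_ratio (v := 0) (by simp)) (by simp)).mono_left nhdsWithin_le_nhds

theorem tendsto_log_ratio :
    Tendsto (fun v => Complex.log (1 - v) - Complex.log (1 + v)) (𝓝[halfDisc] 0) (𝓝 0) := by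
  have := (hasDerivAt_log_ratio (v := 0) (by simp)).continuousAt.tendsto
  simp only [sub_zero, add_zero, sub_self] at this
  exact this.mono_left nhdsWithin_le_nhds

/-- Landen's reflection formula for the odd part of the dilogarithm. -/
theorem polylog_two_odd_add_cayley {v : ℂ} (hv : v ∈ halfDisc) :
    (polylog 2 v - polylog 2 (-v)) + (polylog 2 (cayley v) - polylog 2 (-cayley v))
      + Complex.log v * (Complex.log (1 - v) - Complex.log (1 + v)) = (Real.pi : ℂ) ^ 2 / 4 := by
  refine convex_halfDisc.eq_of_hasDerivAt_zero_of_tendsto isOpen_halfDisc (l := 𝓝[halfDisc] 0)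
    (f := fun v => (polylog 2 v - polylog 2 (-v)) + (polylog 2 (cayley v) - polylog 2 (-cayley v))
      + Complex.log v * (Complex.log (1 - v) - Complex.log (1 + v))) ?_ self_mem_nhdsWithin ?_ hv
  · intro v hv
    have h0 := ne_zero_of_re_pos hv.2
    refine (((hasDerivAt_polylog 1 hv.1 h0).sub (hasDerivAt_polylog_neg 1 hv.1 h0)).add
      ((hasDerivAt_polylog_cayley 1 hv).sub (hasDerivAt_polylog_neg_cayley 1 hv))).add
      ((hasDerivAt_log hv.2).mul (hasDerivAt_log_ratio hv.1)) |>.congr_deriv ?_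
    rw [polylog_one hv.1, polylog_one_neg hv.1, polylog_one_cayley hv, polylog_one_neg_cayley hv]
    have h1 := one_sub_ne_zero hv.1
    have h2 := one_add_ne_zero hv.1
    field_simp; ring
  -- As v → 0 the Cayley image tends to 1, so the constant is Li_2(1) - Li_2(-1) = π²/6 + π²/12.
  · have := (((tendsto_polylog_zero 1).sub (tendsto_polylog_neg_zero 1)).add
      ((tendsto_polylog_cayley 0).sub (tendsto_polylog_neg_cayley 0))).add tendsto_log_mul_log_ratio
    convert this using 2
    rw [zero_add, polylog_two_one, polylog_two_neg_one]; ring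

theorem hasDerivAt_nielsenS12_sq {v : ℂ} (hv : v ∈ halfDisc) :
    HasDerivAt (fun v => nielsenS12 (v ^ 2))
      ((Complex.log (1 - v) + Complex.log (1 + v)) ^ 2 / v) v := by
  have h0 := ne_zero_of_re_pos hv.2
  have h := (hasDerivAt_pow 2 v).nielsenS12
    (by rw [norm_pow]; exact pow_lt_one₀ (norm_nonneg _) hv.1 two_ne_zero) (pow_ne_zero 2 h0)
  refine h.congr_deriv ?_
  rw [log_one_sub_sq hv.1]
  push_cast
  field_simp

theorem hasDerivAt_nielsenS12 {v : ℂ} (hv : ‖v‖ < 1) (h0 : v ≠ 0) :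
    HasDerivAt nielsenS12 (Complex.log (1 - v) ^ 2 / 2 / v) v := by
  simpa [div_eq_mul_inv] using (hasDerivAt_id v).nielsenS12 hv h0

theorem hasDerivAt_nielsenS12_neg {v : ℂ} (hv : ‖v‖ < 1) (h0 : v ≠ 0) :
    HasDerivAt (fun v => nielsenS12 (-v)) (Complex.log (1 + v) ^ 2 / 2 / v) v := by
  have := (hasDerivAt_id v).neg.nielsenS12 (by simpa using hv) (by simpa using h0)
  refine this.congr_deriv ?_
  simp [div_eq_mul_inv]

theorem tendsto_nielsenS12_comp {f : ℂ → ℂ} (hf : Continuous f) (h0 : f 0 = 0) :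
    Tendsto (fun v => nielsenS12 (f v)) (𝓝[halfDisc] 0) (𝓝 0) := by
  have h1 : Tendsto f (𝓝[halfDisc] 0) (𝓝 0) := by
    simpa [h0] using (hf.tendsto 0).mono_left nhdsWithin_le_nhds
  have := (continuousAt_nielsenS12 (z := 0) (by simp)).tendsto.comp h1
  rwa [nielsenS12_zero] at this

/-- `S_{1,2}(v²)` from the polarisation
`log²(1 - v²) + log²((1 - v) / (1 + v)) = 2 log²(1 - v) + 2 log²(1 + v)`. -/
theorem nielsenS12_sq {v : ℂ} (hv : v ∈ halfDisc) :
    nielsenS12 (v ^ 2) =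
      4 * nielsenS12 v + 4 * nielsenS12 (-v)
      - Complex.log v * (Complex.log (1 - v) - Complex.log (1 + v)) ^ 2
      - 2 * (Complex.log (1 - v) - Complex.log (1 + v))
        * (polylog 2 (cayley v) - polylog 2 (-cayley v))
      + 2 * (polylog 3 (cayley v) - polylog 3 (-cayley v))
      - 2 * (polylog 3 1 - polylog 3 (-1)) := by
  rw [← sub_eq_zero]
  -- Let L = log((1-v)/(1+v)) and let X, Y be the odd parts of Li_2, Li_3 at the Cayley image. Then
  -- dX = -log v dL and dY = X dL, so two integrations by parts give ∫ L² dv/v = L² log v + 2LX -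
  -- 2Y.
  have key := convex_halfDisc.eq_of_hasDerivAt_zero_of_tendsto isOpen_halfDisc (l := 𝓝[halfDisc] 0)
    (f := fun v => nielsenS12 (v ^ 2) - 4 * nielsenS12 v - 4 * nielsenS12 (-v)
      + Complex.log v * (Complex.log (1 - v) - Complex.log (1 + v)) ^ 2
      + 2 * ((Complex.log (1 - v) - Complex.log (1 + v))
        * (polylog 2 (cayley v) - polylog 2 (-cayley v)))
      - 2 * (polylog 3 (cayley v) - polylog 3 (-cayley v)))
      (c := - 2 * (polylog 3 1 - polylog 3 (-1))) ?_ self_mem_nhdsWithin ?_ hv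
  · linear_combination key
  · intro v hv
    have h0 := ne_zero_of_re_pos hv.2
    have hx := (hasDerivAt_polylog_cayley 1 hv).sub (hasDerivAt_polylog_neg_cayley 1 hv)
    have hy := (hasDerivAt_polylog_cayley 2 hv).sub (hasDerivAt_polylog_neg_cayley 2 hv)
    have hb := hasDerivAt_log_ratio hv.1
    refine (((((hasDerivAt_nielsenS12_sq hv).sub ((hasDerivAt_nielsenS12 hv.1 h0).const_mul 4)).sub
      ((hasDerivAt_nielsenS12_neg hv.1 h0).const_mul 4)).add
      ((hasDerivAt_log hv.2).mul (hb.pow 2))).add ((hb.mul hx).const_mul 2)).sub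
      (hy.const_mul 2) |>.congr_deriv ?_
    rw [polylog_one_cayley hv, polylog_one_neg_cayley hv]
    have h1 := one_sub_ne_zero hv.1
    have h2 := one_add_ne_zero hv.1
    simp only [Pi.sub_apply, Pi.pow_apply]
    field_simp; ring
  · have hb := tendsto_log_ratio
    have hx := (tendsto_polylog_cayley 0).sub (tendsto_polylog_neg_cayley 0)
    have hy := (tendsto_polylog_cayley 1).sub (tendsto_polylog_neg_cayley 1)
    have h := (((((tendsto_nielsenS12_comp (continuous_pow 2) (by simp)).sub
      ((tendsto_nielsenS12_comp continuous_id rfl).const_mul 4)).sub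
      ((tendsto_nielsenS12_comp continuous_neg neg_zero).const_mul 4)).add
      (tendsto_log_mul_log_ratio.mul hb)).add ((hb.mul hx).const_mul 2)).sub (hy.const_mul 2)
    convert h using 2
    · simp only [id]; ring
    · ring

/-! ### Landen's transformation v ↦ v/(v-1) -/

/-- The quarter of the disc on which `v / (v - 1)` stays in the open unit disc. -/
def quarterDisc : Set ℂ := halfDisc ∩ {z | z.re < 1 / 2}

theorem convex_quarterDisc : Convex ℝ quarterDisc :=
  convex_halfDisc.inter (convex_halfSpace_re_lt _)

theorem isOpen_quarterDisc : IsOpen quarterDisc :=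
  isOpen_halfDisc.inter (isOpen_lt Complex.continuous_re continuous_const)

instance : (𝓝[quarterDisc] (0 : ℂ)).NeBot :=
  zero_mem_closure_halfDisc_inter (by norm_num)

theorem nhdsWithin_quarterDisc_le : 𝓝[quarterDisc] (0 : ℂ) ≤ 𝓝[halfDisc] 0 :=
  nhdsWithin_mono _ Set.inter_subset_left

theorem norm_div_sub_one_lt_one {v : ℂ} (hv : v ∈ quarterDisc) : ‖v / (v - 1)‖ < 1 := by
  have h1 : v - 1 ≠ 0 := by rw [← neg_sub]; exact neg_ne_zero.mpr (one_sub_ne_zero hv.1.1)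
  rw [norm_div, div_lt_one (norm_pos_iff.mpr h1)]
  refine lt_of_pow_lt_pow_left₀ 2 (norm_nonneg _) ?_
  rw [Complex.sq_norm, Complex.sq_norm, Complex.normSq_apply, Complex.normSq_apply]
  have : v.re < 1 / 2 := hv.2
  simp
  nlinarith

theorem hasDerivAt_div_sub_one {v : ℂ} (hv : ‖v‖ < 1) :
    HasDerivAt (fun v => v / (v - 1)) (-1 / (1 - v) ^ 2) v := by
  have h1 := one_sub_ne_zero hv
  have h1' : v - 1 ≠ 0 := by rw [← neg_sub]; exact neg_ne_zero.mpr h1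
  refine ((hasDerivAt_id v).div ((hasDerivAt_id v).sub_const 1) h1').congr_deriv ?_
  simp only [id]
  rw [← neg_sub 1 v, neg_sq]
  congr 1; ring

theorem log_one_sub_div_sub_one {v : ℂ} (hv : ‖v‖ < 1) :
    Complex.log (1 - v / (v - 1)) = -Complex.log (1 - v) := by
  rw [← log_inv_of_re_pos (one_sub_re_pos hv)]
  congr 1
  have h1 := one_sub_ne_zero hv
  have h1' : v - 1 ≠ 0 := by rw [← neg_sub]; exact neg_ne_zero.mpr h1
  refine eq_inv_of_mul_eq_one_left ?_
  field_simp; ring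

theorem hasDerivAt_polylog_div_sub_one (s : ℕ) {v : ℂ} (hv : v ∈ quarterDisc) :
    HasDerivAt (fun v => polylog (s + 1) (v / (v - 1)))
      (polylog s (v / (v - 1)) * (1 / (v * (1 - v)))) v := by
  have h0 := ne_zero_of_re_pos hv.1.2
  have h1 := one_sub_ne_zero hv.1.1
  have h1' : v - 1 ≠ 0 := by rw [← neg_sub]; exact neg_ne_zero.mpr h1
  refine ((hasDerivAt_div_sub_one hv.1.1).polylog_succ s (norm_div_sub_one_lt_one hv)
    (div_ne_zero h0 h1')).congr_deriv ?_
  congr 1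
  field_simp; ring

theorem tendsto_polylog_div_sub_one (s : ℕ) :
    Tendsto (fun v => polylog (s + 1) (v / (v - 1))) (𝓝[quarterDisc] 0) (𝓝 0) := by
  have h := (continuousAt_polylog s (z := 0) (by simp)).tendsto
  rw [polylog_zero] at h
  have h1 := (hasDerivAt_div_sub_one (v := 0) (by simp)).continuousAt.tendsto
  rw [zero_div] at h1
  exact h.comp (h1.mono_left nhdsWithin_le_nhds)

theorem tendsto_log_one_sub : Tendsto (fun v => Complex.log (1 - v)) (𝓝[halfDisc] 0) (𝓝 0) := by
  have := (hasDerivAt_log_one_sub (z := 0) (by simp)).continuousAt.tendsto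
  simp only [sub_zero, Complex.log_one] at this
  exact this.mono_left nhdsWithin_le_nhds

theorem tendsto_log_one_add : Tendsto (fun v => Complex.log (1 + v)) (𝓝[halfDisc] 0) (𝓝 0) := by
  have := (hasDerivAt_log_one_add (z := 0) (by simp)).continuousAt.tendsto
  simp only [add_zero, Complex.log_one] at this
  exact this.mono_left nhdsWithin_le_nhds

/-- Landen's formula for the dilogarithm. -/
theorem polylog_two_div_sub_one {v : ℂ} (hv : v ∈ quarterDisc) :
    polylog 2 (v / (v - 1)) = -polylog 2 v - Complex.log (1 - v) ^ 2 / 2 := by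
  rw [← sub_eq_zero]
  refine convex_quarterDisc.eq_of_hasDerivAt_zero_of_tendsto isOpen_quarterDisc
    (l := 𝓝[quarterDisc] 0)
    (f := fun v => polylog 2 (v / (v - 1)) - (-polylog 2 v - Complex.log (1 - v) ^ 2 / 2))
    ?_ self_mem_nhdsWithin ?_ hv
  · intro v hv
    have h0 := ne_zero_of_re_pos hv.1.2
    refine (hasDerivAt_polylog_div_sub_one 1 hv).sub ((hasDerivAt_polylog 1 hv.1.1 h0).neg.sub
      (((hasDerivAt_log_one_sub hv.1.1).pow 2).div_const 2)) |>.congr_deriv ?_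
    rw [polylog_one (norm_div_sub_one_lt_one hv), polylog_one hv.1.1,
      log_one_sub_div_sub_one hv.1.1]
    have h1 := one_sub_ne_zero hv.1.1
    push_cast
    field_simp; ring
  · have h := (tendsto_polylog_div_sub_one 1).sub
      (((tendsto_polylog_zero 1).mono_left nhdsWithin_quarterDisc_le).neg.sub
      (((tendsto_log_one_sub.mono_left nhdsWithin_quarterDisc_le).pow 2).div_const 2))
    simpa using h

/-- `S_{1,2}` through Landen's transformation `v ↦ v / (v - 1)`. -/
theorem nielsenS12_eq_polylog_div_sub_one {v : ℂ} (hv : v ∈ quarterDisc) :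
    nielsenS12 v = polylog 3 (v / (v - 1)) + polylog 3 v - Complex.log (1 - v) * polylog 2 v
      - Complex.log (1 - v) ^ 3 / 6 := by
  rw [← sub_eq_zero]
  refine convex_quarterDisc.eq_of_hasDerivAt_zero_of_tendsto isOpen_quarterDisc
    (l := 𝓝[quarterDisc] 0)
    (f := fun v => nielsenS12 v - (polylog 3 (v / (v - 1)) + polylog 3 v
      - Complex.log (1 - v) * polylog 2 v - Complex.log (1 - v) ^ 3 / 6))
    ?_ self_mem_nhdsWithin ?_ hv
  · intro v hv
    have h0 := ne_zero_of_re_pos hv.1.2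
    have hl := hasDerivAt_log_one_sub hv.1.1
    refine (hasDerivAt_nielsenS12 hv.1.1 h0).sub ((((hasDerivAt_polylog_div_sub_one 2 hv).add
      (hasDerivAt_polylog 2 hv.1.1 h0)).sub (hl.mul (hasDerivAt_polylog 1 hv.1.1 h0))).sub
      ((hl.pow 3).div_const 6)) |>.congr_deriv ?_
    rw [polylog_two_div_sub_one hv, polylog_one hv.1.1]
    have h1 := one_sub_ne_zero hv.1.1
    push_cast
    field_simp; ring
  · have hl := tendsto_log_one_sub.mono_left nhdsWithin_quarterDisc_le
    have h := ((tendsto_nielsenS12_comp continuous_id rfl).mono_left nhdsWithin_quarterDisc_le).sub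
      ((((tendsto_polylog_div_sub_one 2).add
      ((tendsto_polylog_zero 2).mono_left nhdsWithin_quarterDisc_le)).sub
      (hl.mul ((tendsto_polylog_zero 1).mono_left nhdsWithin_quarterDisc_le))).sub
      ((hl.pow 3).div_const 6))
    simpa using h

/-! ### The transformation v ↦ 1/(1+v) -/

theorem norm_inv_one_add_lt_one {v : ℂ} (hv : 0 < v.re) : ‖(1 + v)⁻¹‖ < 1 := by
  rw [norm_inv]
  refine inv_lt_one_of_one_lt₀ ?_
  have := Complex.re_le_norm (1 + v)
  simp at this
  linarith

theorem one_sub_inv_one_add {v : ℂ} (hv : 1 + v ≠ 0) : 1 - (1 + v)⁻¹ = v / (1 + v) := by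
  field_simp; ring

theorem hasDerivAt_polylog_inv_one_add (s : ℕ) {v : ℂ} (hv : v ∈ halfDisc) :
    HasDerivAt (fun v => polylog (s + 1) (1 + v)⁻¹)
      (polylog s (1 + v)⁻¹ * (-1 / (1 + v))) v := by
  have h1 := one_add_ne_zero hv.1
  have := ((hasDerivAt_id v).const_add 1).fun_inv h1
  refine (this.polylog_succ s (norm_inv_one_add_lt_one hv.2) (inv_ne_zero h1)).congr_deriv ?_
  simp only [id]
  field_simp

theorem polylog_one_inv_one_add {v : ℂ} (hv : v ∈ halfDisc) :
    polylog 1 (1 + v)⁻¹ = Complex.log (1 + v) - Complex.log v := by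
  rw [polylog_one (norm_inv_one_add_lt_one hv.2), one_sub_inv_one_add (one_add_ne_zero hv.1),
    log_div_of_re_pos hv.2 (one_add_re_pos hv.1)]
  ring

theorem tendsto_polylog_inv_one_add (s : ℕ) :
    Tendsto (fun v => polylog (s + 2) (1 + v)⁻¹) (𝓝[halfDisc] 0) (𝓝 (polylog (s + 2) 1)) := by
  refine ((continuousOn_polylog s).continuousWithinAt (x := 1) (by simp)).tendsto.comp ?_
  refine tendsto_nhdsWithin_iff.mpr ⟨?_, ?_⟩
  · have : ContinuousAt (fun v : ℂ => (1 + v)⁻¹) 0 :=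
      (continuousAt_const.add continuousAt_id).inv₀ (by simp)
    simpa using this.tendsto.mono_left nhdsWithin_le_nhds
  · filter_upwards [self_mem_nhdsWithin] with z hz
    simpa using (norm_inv_one_add_lt_one hz.2).le

theorem tendsto_log_mul_log_one_add :
    Tendsto (fun v => Complex.log v * Complex.log (1 + v)) (𝓝[halfDisc] 0) (𝓝 0) :=
  (tendsto_log_mul (hasDerivAt_log_one_add (z := 0) (by simp)) (by simp)).mono_left nhdsWithin_le_nhds

/-- The derivatives agree by the logarithm rules; π²/6 is the value Li_2(1) approached as v → 0. At
`baseRoot` this removes Li_2(1/(1+v)) in favour of Li_2(-v). -/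
theorem polylog_two_inv_one_add {v : ℂ} (hv : v ∈ halfDisc) :
    polylog 2 (1 + v)⁻¹ = polylog 2 (-v) + Complex.log v * Complex.log (1 + v)
      - Complex.log (1 + v) ^ 2 / 2 + (Real.pi : ℂ) ^ 2 / 6 := by
  have key := convex_halfDisc.eq_of_hasDerivAt_zero_of_tendsto isOpen_halfDisc
    (l := 𝓝[halfDisc] 0) (c := (Real.pi : ℂ) ^ 2 / 6)
    (f := fun v => polylog 2 (1 + v)⁻¹ - (polylog 2 (-v) + Complex.log v * Complex.log (1 + v)
      - Complex.log (1 + v) ^ 2 / 2))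
    ?_ self_mem_nhdsWithin ?_ hv
  · linear_combination key
  · intro v hv
    have h0 := ne_zero_of_re_pos hv.2
    have hl := hasDerivAt_log_one_add hv.1
    refine (hasDerivAt_polylog_inv_one_add 1 hv).sub (((hasDerivAt_polylog_neg 1 hv.1 h0).add
      ((hasDerivAt_log hv.2).mul hl)).sub ((hl.pow 2).div_const 2)) |>.congr_deriv ?_
    rw [polylog_one_inv_one_add hv, polylog_one_neg hv.1]
    have h1 := one_add_ne_zero hv.1
    push_cast
    field_simp; ring
  · have h := (tendsto_polylog_inv_one_add 0).sub (((tendsto_polylog_neg_zero 1).add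
      tendsto_log_mul_log_one_add).sub ((tendsto_log_one_add.pow 2).div_const 2))
    rw [polylog_two_one] at h
    simpa using h

/-- `S_{1,2}` through the transformation `v ↦ 1 / (1 + v)`. -/
theorem nielsenS12_neg {v : ℂ} (hv : v ∈ halfDisc) :
    nielsenS12 (-v) = Complex.log (1 + v) ^ 2 * Complex.log v / 2
      - Complex.log (1 + v) * polylog 2 (1 + v)⁻¹ - polylog 3 (1 + v)⁻¹
      - Complex.log (1 + v) ^ 3 / 3 + polylog 3 1 := by
  have key := convex_halfDisc.eq_of_hasDerivAt_zero_of_tendsto isOpen_halfDisc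
    (l := 𝓝[halfDisc] 0) (c := polylog 3 1)
    (f := fun v => nielsenS12 (-v) - (Complex.log v * Complex.log (1 + v) ^ 2 / 2
      - Complex.log (1 + v) * polylog 2 (1 + v)⁻¹ - polylog 3 (1 + v)⁻¹
      - Complex.log (1 + v) ^ 3 / 3))
    ?_ self_mem_nhdsWithin ?_ hv
  · linear_combination key
  · intro v hv
    have h0 := ne_zero_of_re_pos hv.2
    have hl := hasDerivAt_log_one_add hv.1
    refine (hasDerivAt_nielsenS12_neg hv.1 h0).sub ((((((hasDerivAt_log hv.2).mul (hl.pow 2)).div_const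
      2).sub (hl.mul (hasDerivAt_polylog_inv_one_add 1 hv))).sub
      (hasDerivAt_polylog_inv_one_add 2 hv)).sub ((hl.pow 3).div_const 3)) |>.congr_deriv ?_
    rw [polylog_one_inv_one_add hv]
    have h1 := one_add_ne_zero hv.1
    simp only [Pi.pow_apply]
    push_cast
    field_simp; ring
  · have hl := tendsto_log_one_add
    have h := (tendsto_nielsenS12_comp continuous_neg neg_zero).sub
      (((((tendsto_log_mul_log_one_add.mul hl).div_const 2).sub
        (hl.mul (tendsto_polylog_inv_one_add 0))).sub (tendsto_polylog_inv_one_add 1)).sub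
        ((hl.pow 3).div_const 3))
    convert h using 2
    · ring
    · simp

theorem HasDerivAt.complex_re {f : ℝ → ℂ} {f' : ℂ} {x : ℝ} (h : HasDerivAt f f' x) :
    HasDerivAt (fun t => (f t).re) f'.re x :=
  Complex.reCLM.hasFDerivAt.comp_hasDerivAt x h

theorem HasDerivAt.complex_im {f : ℝ → ℂ} {f' : ℂ} {x : ℝ} (h : HasDerivAt f f' x) :
    HasDerivAt (fun t => (f t).im) f'.im x :=
  Complex.imCLM.hasFDerivAt.comp_hasDerivAt x h

theorem log_real_mul_exp {r θ : ℝ} (hr : 0 < r) (h1 : -Real.pi < θ) (h2 : θ ≤ Real.pi) :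
    Complex.log (r * Complex.exp (θ * Complex.I)) = Real.log r + θ * Complex.I := by
  rw [Complex.log_ofReal_mul hr (Complex.exp_ne_zero _), Complex.log_exp (by simpa) (by simpa)]

/-! ### The dilogarithm on the circle `|1 - z| = 1` -/

/-- The squared norm is 2 - 2 cos θ, and π/3 is where it reaches 1. -/
theorem norm_one_sub_exp_lt_one {θ : ℝ} (h0 : 0 < θ) (h1 : θ < Real.pi / 3) :
    ‖1 - Complex.exp (-(θ * Complex.I))‖ < 1 := by
  refine lt_of_pow_lt_pow_left₀ 2 (by norm_num) ?_
  rw [Complex.sq_norm, Complex.normSq_apply, ← neg_mul, ← Complex.ofReal_neg]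
  have hc : 1 / 2 < Real.cos θ := by
    rw [← Real.cos_pi_div_three]
    exact Real.cos_lt_cos_of_nonneg_of_le_pi h0.le (by linarith [Real.pi_pos]) h1
  simp only [Complex.sub_re, Complex.one_re, Complex.exp_ofReal_mul_I_re, Complex.sub_im,
    Complex.one_im, Complex.exp_ofReal_mul_I_im, Real.cos_neg, Real.sin_neg]
  nlinarith [Real.sin_sq_add_cos_sq θ]

/-- With z = 1 - e^{-iθ} one has log(1-z) = -iθ, purely imaginary, while e^{-iθ}/z has constant real
part -1/2. Hence the real part of the dilogarithm has derivative θ/2. -/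
theorem polylog_two_one_sub_exp_re {θ : ℝ} (h0 : 0 < θ) (h1 : θ < Real.pi / 3) :
    (polylog 2 (1 - Complex.exp (-(θ * Complex.I)))).re = θ ^ 2 / 4 := by
  rw [← sub_eq_zero]
  refine (convex_Ioo (0 : ℝ) (Real.pi / 3)).eq_of_hasDerivAt_zero_of_tendsto isOpen_Ioo
    (f := fun θ : ℝ => (polylog 2 (1 - Complex.exp (-(θ * Complex.I)))).re - θ ^ 2 / 4)
    ?_ (l := 𝓝[>] 0) (Ioo_mem_nhdsGT (by positivity)) ?_ ⟨h0, h1⟩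
  · rintro θ ⟨h0, h1⟩
    have hn := norm_one_sub_exp_lt_one h0 h1
    have hz : 1 - Complex.exp (-(θ * Complex.I)) ≠ 0 := by
      intro h
      have := congrArg Complex.im h
      rw [← neg_mul, ← Complex.ofReal_neg] at this
      simp only [Complex.sub_im, Complex.one_im, Complex.exp_ofReal_mul_I_im, Real.sin_neg,
        Complex.zero_im] at this
      have := Real.sin_pos_of_pos_of_lt_pi h0 (by linarith [Real.pi_pos])
      linarith
    have hd : HasDerivAt (fun θ : ℝ => 1 - Complex.exp (-(θ * Complex.I)))
        (Complex.I * Complex.exp (-(θ * Complex.I))) θ := by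
      have := ((((hasDerivAt_id (θ : ℂ)).mul_const Complex.I).fun_neg).cexp.const_sub 1).comp_ofReal
      refine this.congr_deriv ?_
      simp only [id]; ring
    have hl := (hd.polylog_two hn hz).complex_re.sub ((hasDerivAt_pow 2 θ).div_const 4)
    refine hl.congr_deriv ?_
    rw [sub_sub_cancel, Complex.log_exp (by simp; linarith [Real.pi_pos])
      (by simp; linarith [Real.pi_pos])]
    have h3 : (- -((θ : ℂ) * Complex.I) * (Complex.I * Complex.exp (-(θ * Complex.I))
        / (1 - Complex.exp (-(θ * Complex.I))))) = ((-θ : ℝ) : ℂ) *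
        (Complex.exp (-(θ * Complex.I)) / (1 - Complex.exp (-(θ * Complex.I)))) := by
      push_cast
      linear_combination (θ : ℂ) * Complex.exp (-(θ * Complex.I))
        / (1 - Complex.exp (-(θ * Complex.I))) * Complex.I_mul_I
    rw [h3, Complex.re_ofReal_mul]
    have h4 : (Complex.exp (-(θ * Complex.I)) / (1 - Complex.exp (-(θ * Complex.I)))).re = -1 / 2 := by
      have hne := Complex.normSq_pos.mpr hz
      rw [Complex.normSq_apply] at hne
      rw [Complex.div_re, Complex.normSq_apply]
      rw [← neg_mul, ← Complex.ofReal_neg] at *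
      simp only [Complex.sub_re, Complex.one_re, Complex.exp_ofReal_mul_I_re, Complex.sub_im,
        Complex.one_im, Complex.exp_ofReal_mul_I_im, Real.cos_neg, Real.sin_neg] at *
      rw [← add_div, div_eq_iff hne.ne']
      nlinarith [Real.sin_sq_add_cos_sq θ]
    rw [h4]; push_cast; ring
  · have h : ContinuousAt (fun θ : ℝ => (polylog 2 (1 - Complex.exp (-(θ * Complex.I)))).re
        - θ ^ 2 / 4) 0 := by
      refine ContinuousAt.sub ?_ (by fun_prop)
      refine Complex.continuous_re.continuousAt.comp ?_
      refine ContinuousAt.comp (g := polylog 2) ?_ (by fun_prop)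
      exact continuousAt_polylog 1 (by simp)
    have := h.tendsto
    simp only [Complex.ofReal_zero, zero_mul, neg_zero, Complex.exp_zero, sub_self,
      polylog_zero] at this
    simpa using this.mono_left nhdsWithin_le_nhds

theorem tendsto_polylog_two_re_left {f : ℝ → ℂ} {a : ℝ} (hf : ContinuousAt f a)
    (h : ∀ᶠ x in 𝓝[<] a, ‖f x‖ ≤ 1) :
    Tendsto (fun x => (polylog 2 (f x)).re) (𝓝[<] a) (𝓝 (polylog 2 (f a)).re) := by
  have h1 : Tendsto f (𝓝[<] a) (𝓝 (f a)) := hf.tendsto.mono_left nhdsWithin_le_nhds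
  have h2 : ‖f a‖ ≤ 1 := le_of_tendsto h1.norm h
  refine (Complex.continuous_re.tendsto _).comp ?_
  refine ((continuousOn_polylog 0).continuousWithinAt (by simpa using h2)).tendsto.comp ?_
  refine tendsto_nhdsWithin_iff.mpr ⟨h1, ?_⟩
  filter_upwards [h] with x hx
  simpa using hx

theorem exp_pi_div_three : Complex.exp ((Real.pi / 3 : ℝ) * Complex.I) = (1 + Real.sqrt 3 * Complex.I) / 2 := by
  apply Complex.ext
  · rw [Complex.exp_ofReal_mul_I_re, Real.cos_pi_div_three]; simp
  · rw [Complex.exp_ofReal_mul_I_im, Real.sin_pi_div_three]; simp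

theorem sqrt_three_sq : ((Real.sqrt 3 : ℝ) : ℂ) ^ 2 = 3 := by
  rw [← Complex.ofReal_pow, Real.sq_sqrt (by norm_num)]; simp

theorem one_sub_exp_neg_pi_div_three :
    1 - Complex.exp (-((Real.pi / 3 : ℝ) * Complex.I)) = Complex.exp ((Real.pi / 3 : ℝ) * Complex.I) := by
  rw [Complex.exp_neg, exp_pi_div_three]
  have h : (1 + Real.sqrt 3 * Complex.I) / 2 ≠ 0 := by
    rw [← exp_pi_div_three]; exact Complex.exp_ne_zero _
  rw [sub_eq_iff_eq_add, eq_comm, ← eq_sub_iff_add_eq', inv_eq_iff_eq_inv]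
  refine eq_inv_of_mul_eq_one_left ?_
  linear_combination (-1 / 4 : ℂ) * (Real.sqrt 3 : ℂ) ^ 2 * Complex.I_sq + (1 / 4 : ℂ) * sqrt_three_sq

/-- This is the endpoint θ = π/3 of the circle formula, where 1 - e^{-iπ/3} = e^{iπ/3}. -/
theorem polylog_two_exp_pi_div_three_re :
    (polylog 2 (Complex.exp ((Real.pi / 3 : ℝ) * Complex.I))).re = Real.pi ^ 2 / 36 := by
  have h := tendsto_polylog_two_re_left (a := Real.pi / 3)
    (f := fun θ : ℝ => 1 - Complex.exp (-(θ * Complex.I))) (by fun_prop) (by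
      filter_upwards [Ioo_mem_nhdsLT (show 0 < Real.pi / 3 by positivity)] with θ hθ
      exact (norm_one_sub_exp_lt_one hθ.1 hθ.2).le)
  rw [one_sub_exp_neg_pi_div_three] at h
  have h2 : Tendsto (fun θ : ℝ => θ ^ 2 / 4) (𝓝[<] (Real.pi / 3)) (𝓝 ((Real.pi / 3) ^ 2 / 4)) :=
    (Continuous.tendsto (by fun_prop) _).mono_left nhdsWithin_le_nhds
  have := tendsto_nhds_unique h (h2.congr' (by
    filter_upwards [Ioo_mem_nhdsLT (show 0 < Real.pi / 3 by positivity)] with θ hθ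
    exact (polylog_two_one_sub_exp_re hθ.1 hθ.2).symm))
  rw [this]; ring

/-- Since -e^{iπ/3} is the conjugate of e^{2πi/3}, duplication becomes a linear equation for the
unknown real part. -/
theorem polylog_two_exp_two_pi_div_three_re :
    (polylog 2 (Complex.exp ((Real.pi / 3 : ℝ) * Complex.I) ^ 2)).re = -Real.pi ^ 2 / 18 := by
  have h := polylog_sq 0 (z := Complex.exp ((Real.pi / 3 : ℝ) * Complex.I))
    (Complex.norm_exp_ofReal_mul_I _).le
  have h2 : -Complex.exp ((Real.pi / 3 : ℝ) * Complex.I)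
      = starRingEnd ℂ (Complex.exp ((Real.pi / 3 : ℝ) * Complex.I) ^ 2) := by
    rw [exp_pi_div_three]
    simp only [map_pow, map_div₀, map_add, map_mul, map_one, Complex.conj_I, Complex.conj_ofReal,
      map_ofNat]
    linear_combination (-1 / 4 : ℂ) * (Real.sqrt 3 : ℂ) ^ 2 * Complex.I_sq + (1 / 4 : ℂ) * sqrt_three_sq
  rw [h2, polylog_conj] at h
  have h3 := congrArg Complex.re h
  simp only [zero_add, pow_one, Complex.mul_re, Complex.add_re, Complex.conj_re,
    polylog_two_exp_pi_div_three_re, Complex.re_ofNat, Complex.im_ofNat, zero_mul, sub_zero] at h3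
  linarith

/-! ### A triplication formula for the trilogarithm -/

/-- The curve `φ ↦ e^{i(mφ + δ)} / (2 cos φ)`. -/
def secCurve (m δ φ : ℝ) : ℂ := Complex.exp ((m * φ + δ : ℝ) * Complex.I) / (2 * Real.cos φ : ℝ)

theorem half_lt_cos {φ : ℝ} (h : φ ∈ Set.Ioo (-(Real.pi / 3)) (Real.pi / 3)) :
    1 / 2 < Real.cos φ := by
  rw [← Real.cos_pi_div_three, ← Real.cos_abs φ]
  exact Real.cos_lt_cos_of_nonneg_of_le_pi (abs_nonneg _) (by linarith [Real.pi_pos]) (abs_lt.mpr h)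

theorem norm_secCurve_lt_one (m δ : ℝ) {φ : ℝ} (h : φ ∈ Set.Ioo (-(Real.pi / 3)) (Real.pi / 3)) :
    ‖secCurve m δ φ‖ < 1 := by
  have := half_lt_cos h
  rw [secCurve, norm_div, Complex.norm_exp_ofReal_mul_I, Complex.norm_real,
    Real.norm_of_nonneg (by linarith), div_lt_one (by linarith)]
  linarith

theorem secCurve_ne_zero (m δ : ℝ) {φ : ℝ} (h : Real.cos φ ≠ 0) : secCurve m δ φ ≠ 0 :=
  div_ne_zero (Complex.exp_ne_zero _) (by exact_mod_cast mul_ne_zero two_ne_zero h)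

theorem hasDerivAt_secCurve (m δ : ℝ) {φ : ℝ} (h : Real.cos φ ≠ 0) :
    HasDerivAt (secCurve m δ) (secCurve m δ φ * (Real.tan φ + m * Complex.I)) φ := by
  have h1 : HasDerivAt (fun φ : ℝ => Complex.exp ((m * φ + δ : ℝ) * Complex.I))
      (Complex.exp ((m * φ + δ : ℝ) * Complex.I) * (m * Complex.I)) φ := by
    have := ((((hasDerivAt_id φ).const_mul m).add_const δ).ofReal_comp.mul_const Complex.I).cexp
    refine this.congr_deriv ?_
    simp [id]
  have h2 := ((Real.hasDerivAt_cos φ).const_mul 2).ofReal_comp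
  have h3 : ((2 * Real.cos φ : ℝ) : ℂ) ≠ 0 := by exact_mod_cast mul_ne_zero two_ne_zero h
  refine (h1.div h2 h3).congr_deriv ?_
  rw [secCurve, Real.tan_eq_sin_div_cos]
  have h4 : (Real.cos φ : ℂ) ≠ 0 := by exact_mod_cast h
  simp only [Complex.ofReal_mul, Complex.ofReal_neg, Complex.ofReal_div, Complex.ofReal_ofNat] at h3 ⊢
  field_simp
  ring

theorem hasDerivAt_polylog_secCurve (s : ℕ) (m δ : ℝ) {φ : ℝ}
    (h : φ ∈ Set.Ioo (-(Real.pi / 3)) (Real.pi / 3)) :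
    HasDerivAt (fun φ => polylog (s + 1) (secCurve m δ φ))
      (polylog s (secCurve m δ φ) * (Real.tan φ + m * Complex.I)) φ := by
  have hc : Real.cos φ ≠ 0 := by have := half_lt_cos h; linarith
  refine ((hasDerivAt_secCurve m δ hc).polylog_succ s (norm_secCurve_lt_one m δ h)
    (secCurve_ne_zero m δ hc)).congr_deriv ?_
  rw [mul_div_cancel_left₀ _ (secCurve_ne_zero m δ hc)]

theorem hasDerivAt_polylog_two_secCurve (m δ : ℝ) {φ A θ : ℝ}
    (h : φ ∈ Set.Ioo (-(Real.pi / 3)) (Real.pi / 3))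
    (hl : Complex.log (1 - secCurve m δ φ) = A + θ * Complex.I) :
    HasDerivAt (fun φ => polylog 2 (secCurve m δ φ))
      (((-(A * Real.tan φ - θ * m) : ℝ) : ℂ) + ((-(A * m + θ * Real.tan φ) : ℝ) : ℂ) * Complex.I) φ := by
  refine (hasDerivAt_polylog_secCurve 1 m δ h).congr_deriv ?_
  rw [polylog_one (norm_secCurve_lt_one m δ h), hl]
  push_cast
  linear_combination -(θ * m : ℂ) * Complex.I_sq

theorem cos_add_pi_div_six_pos {φ : ℝ} (h : φ ∈ Set.Ioo (-(Real.pi / 3)) (Real.pi / 3)) :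
    0 < 2 * Real.cos (φ + Real.pi / 6) := by
  have := Real.cos_pos_of_mem_Ioo (x := φ + Real.pi / 6)
    ⟨by linarith [h.1, Real.pi_pos], by linarith [h.2, Real.pi_pos]⟩
  linarith

theorem cos_sub_pi_div_six_pos {φ : ℝ} (h : φ ∈ Set.Ioo (-(Real.pi / 3)) (Real.pi / 3)) :
    0 < 2 * Real.cos (φ - Real.pi / 6) := by
  have := Real.cos_pos_of_mem_Ioo (x := φ - Real.pi / 6)
    ⟨by linarith [h.1, Real.pi_pos], by linarith [h.2, Real.pi_pos]⟩
  linarith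

/-- For u = e^{iφ}/(2 cos φ) one has 1 - u = ū: these are the points of the line Re u = 1/2. -/
theorem log_one_sub_secCurve_one_zero {φ : ℝ}
    (h : φ ∈ Set.Ioo (-(Real.pi / 3)) (Real.pi / 3)) :
    Complex.log (1 - secCurve 1 0 φ) = (-Real.log (2 * Real.cos φ) : ℝ) + (-φ : ℝ) * Complex.I := by
  have hc := half_lt_cos h
  rw [← Real.log_inv, ← log_real_mul_exp (by positivity) (by linarith [h.2, Real.pi_pos])
    (by linarith [h.1, Real.pi_pos])]
  congr 1
  have hc' : Real.cos φ ≠ 0 := by linarith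
  apply Complex.ext
  · rw [secCurve, Complex.re_ofReal_mul, Complex.sub_re, Complex.div_ofReal_re,
      Complex.exp_ofReal_mul_I_re, Complex.exp_ofReal_mul_I_re]
    simp; field_simp; ring
  · rw [secCurve, Complex.im_ofReal_mul, Complex.sub_im, Complex.div_ofReal_im,
      Complex.exp_ofReal_mul_I_im, Complex.exp_ofReal_mul_I_im]
    simp; field_simp

theorem log_one_sub_secCurve_one_pi_div_three {φ : ℝ}
    (h : φ ∈ Set.Ioo (-(Real.pi / 3)) (Real.pi / 3)) :
    Complex.log (1 - secCurve 1 (Real.pi / 3) φ) =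
      (Real.log (2 * Real.cos (φ - Real.pi / 6)) - Real.log (2 * Real.cos φ) : ℝ)
        + (-(Real.pi / 6) : ℝ) * Complex.I := by
  have hc := half_lt_cos h
  have hm := cos_sub_pi_div_six_pos h
  rw [← Real.log_div hm.ne' (by linarith), ← log_real_mul_exp (div_pos hm (by linarith))
    (by linarith [Real.pi_pos]) (by linarith [Real.pi_pos])]
  congr 1
  have hc' : Real.cos φ ≠ 0 := by linarith
  have h3 := Real.sq_sqrt (show (0 : ℝ) ≤ 3 by norm_num)
  apply Complex.ext
  · rw [secCurve, Complex.re_ofReal_mul, Complex.sub_re, Complex.div_ofReal_re,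
      Complex.exp_ofReal_mul_I_re, Complex.exp_ofReal_mul_I_re, one_mul, Real.cos_add, Real.cos_sub,
      Real.cos_neg, Real.cos_pi_div_three, Real.sin_pi_div_three, Real.cos_pi_div_six,
      Real.sin_pi_div_six, Complex.one_re]
    field_simp
    linear_combination (-Real.cos φ) * h3
  · rw [secCurve, Complex.im_ofReal_mul, Complex.sub_im, Complex.div_ofReal_im,
      Complex.exp_ofReal_mul_I_im, Complex.exp_ofReal_mul_I_im, one_mul, Real.sin_add, Real.cos_sub,
      Real.sin_neg, Real.cos_pi_div_three, Real.sin_pi_div_three, Real.cos_pi_div_six,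
      Real.sin_pi_div_six, Complex.one_im]
    field_simp
    ring

theorem log_one_sub_secCurve_one_neg_pi_div_three {φ : ℝ}
    (h : φ ∈ Set.Ioo (-(Real.pi / 3)) (Real.pi / 3)) :
    Complex.log (1 - secCurve 1 (-(Real.pi / 3)) φ) =
      (Real.log (2 * Real.cos (φ + Real.pi / 6)) - Real.log (2 * Real.cos φ) : ℝ)
        + (Real.pi / 6 : ℝ) * Complex.I := by
  have hc := half_lt_cos h
  have hm := cos_add_pi_div_six_pos h
  rw [← Real.log_div hm.ne' (by linarith), ← log_real_mul_exp (div_pos hm (by linarith))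
    (by linarith [Real.pi_pos]) (by linarith [Real.pi_pos])]
  congr 1
  have hc' : Real.cos φ ≠ 0 := by linarith
  have h3 := Real.sq_sqrt (show (0 : ℝ) ≤ 3 by norm_num)
  apply Complex.ext
  · rw [secCurve, Complex.re_ofReal_mul, Complex.sub_re, Complex.div_ofReal_re,
      Complex.exp_ofReal_mul_I_re, Complex.exp_ofReal_mul_I_re, one_mul, ← sub_eq_add_neg,
      Real.cos_add, Real.cos_sub, Real.cos_pi_div_three, Real.sin_pi_div_three, Real.cos_pi_div_six,
      Real.sin_pi_div_six, Complex.one_re]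
    field_simp
    linear_combination (-Real.cos φ) * h3
  · rw [secCurve, Complex.im_ofReal_mul, Complex.sub_im, Complex.div_ofReal_im,
      Complex.exp_ofReal_mul_I_im, Complex.exp_ofReal_mul_I_im, one_mul, ← sub_eq_add_neg,
      Real.sin_sub, Real.cos_add, Real.cos_pi_div_three, Real.sin_pi_div_three, Real.cos_pi_div_six,
      Real.sin_pi_div_six, Complex.one_im]
    field_simp
    ring

/-- The point is -u²/(1-u) with u = e^{iφ}/(2 cos φ), and 1 + u²/(1-u) = (1 - u e^{iπ/3})(1 - u
e^{-iπ/3})/(1-u). So this logarithm is a combination of the other three, which is the source of the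
relations below. -/
theorem log_one_sub_secCurve_three_pi {φ : ℝ}
    (h : φ ∈ Set.Ioo (-(Real.pi / 3)) (Real.pi / 3)) :
    Complex.log (1 - secCurve 3 Real.pi φ) =
      (Real.log (2 * Real.cos (φ + Real.pi / 6)) + Real.log (2 * Real.cos (φ - Real.pi / 6))
        - Real.log (2 * Real.cos φ) : ℝ) + (φ : ℝ) * Complex.I := by
  have hc := half_lt_cos h
  have hm := cos_sub_pi_div_six_pos h
  have hp := cos_add_pi_div_six_pos h
  rw [← Real.log_mul hp.ne' hm.ne', ← Real.log_div (mul_pos hp hm).ne' (by linarith),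
    ← log_real_mul_exp (div_pos (mul_pos hp hm) (by linarith)) (by linarith [h.1, Real.pi_pos])
    (by linarith [h.2, Real.pi_pos])]
  congr 1
  have hc' : Real.cos φ ≠ 0 := by linarith
  have h3 := Real.sq_sqrt (show (0 : ℝ) ≤ 3 by norm_num)
  have hs := Real.sin_sq_add_cos_sq φ
  have hpm : 2 * Real.cos (φ + Real.pi / 6) * (2 * Real.cos (φ - Real.pi / 6))
      = 4 * Real.cos φ ^ 2 - 1 := by
    rw [Real.cos_add, Real.cos_sub, Real.cos_pi_div_six, Real.sin_pi_div_six]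
    linear_combination Real.cos φ ^ 2 * h3 - hs
  rw [hpm]
  apply Complex.ext
  · rw [secCurve, Complex.re_ofReal_mul, Complex.sub_re, Complex.div_ofReal_re,
      Complex.exp_ofReal_mul_I_re, Complex.exp_ofReal_mul_I_re, Real.cos_add_pi, Real.cos_three_mul,
      Complex.one_re]
    field_simp
    ring
  · rw [secCurve, Complex.im_ofReal_mul, Complex.sub_im, Complex.div_ofReal_im,
      Complex.exp_ofReal_mul_I_im, Complex.exp_ofReal_mul_I_im, Real.sin_add_pi, Real.sin_three_mul,
      Complex.one_im]
    field_simp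
    linear_combination (-4 * Real.sin φ) * hs

theorem ContinuousAt.tendsto_of_eq {X Y : Type*} [TopologicalSpace X] [TopologicalSpace Y]
    {f : X → Y} {a : X} {c : Y} (h : ContinuousAt f a) (h0 : f a = c) : Tendsto f (𝓝 a) (𝓝 c) :=
  h0 ▸ h

theorem hasDerivAt_log_two_mul_cos {φ : ℝ} (h : φ ∈ Set.Ioo (-(Real.pi / 3)) (Real.pi / 3)) :
    HasDerivAt (fun φ => Real.log (2 * Real.cos φ)) (-Real.tan φ) φ := by
  have hc := half_lt_cos h
  refine (((Real.hasDerivAt_cos φ).const_mul 2).log (by linarith)).congr_deriv ?_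
  rw [Real.tan_eq_sin_div_cos]
  have : Real.cos φ ≠ 0 := by linarith
  field_simp

theorem zero_mem_Ioo_pi_div_three : (0 : ℝ) ∈ Set.Ioo (-(Real.pi / 3)) (Real.pi / 3) :=
  ⟨by linarith [Real.pi_pos], by positivity⟩

theorem secCurve_at_zero :
    secCurve 3 Real.pi 0 = (-1 / 2 : ℝ) ∧ secCurve 1 0 0 = (1 / 2 : ℝ) ∧
      secCurve 1 (-(Real.pi / 3)) 0 = starRingEnd ℂ (secCurve 1 (Real.pi / 3) 0) := by
  refine ⟨?_, ?_, ?_⟩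
  · simp [secCurve]
  · simp [secCurve]
  · rw [secCurve, secCurve, map_div₀, ← Complex.exp_conj, Complex.conj_ofReal, map_mul,
      Complex.conj_ofReal, Complex.conj_I]
    simp

theorem continuousAt_im_polylog_secCurve (s : ℕ) (m δ : ℝ) :
    ContinuousAt (fun φ => (polylog (s + 1) (secCurve m δ φ)).im) 0 :=
  Complex.continuous_im.continuousAt.comp
    (hasDerivAt_polylog_secCurve s m δ zero_mem_Ioo_pi_div_three).continuousAt

/-- The coefficients 1, -3, -3, 2 make the logarithms of 2 cos(φ ± π/6) cancel in the derivative. At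
φ = 0 two arguments are real and the other two are conjugate, so the constant is zero. -/
theorem im_polylog_two_secCurve {φ : ℝ} (h : φ ∈ Set.Ioo (-(Real.pi / 3)) (Real.pi / 3)) :
    (polylog 2 (secCurve 3 Real.pi φ)).im - 3 * (polylog 2 (secCurve 1 (-(Real.pi / 3)) φ)).im
      - 3 * (polylog 2 (secCurve 1 (Real.pi / 3) φ)).im + 2 * (polylog 2 (secCurve 1 0 φ)).im
      = -(φ * Real.log (2 * Real.cos φ)) := by
  rw [← sub_eq_zero]
  refine (convex_Ioo (-(Real.pi / 3)) (Real.pi / 3)).eq_of_hasDerivAt_zero_of_tendsto isOpen_Ioo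
    (f := fun φ => (polylog 2 (secCurve 3 Real.pi φ)).im
      - 3 * (polylog 2 (secCurve 1 (-(Real.pi / 3)) φ)).im
      - 3 * (polylog 2 (secCurve 1 (Real.pi / 3) φ)).im + 2 * (polylog 2 (secCurve 1 0 φ)).im
      - -(φ * Real.log (2 * Real.cos φ)))
    ?_ (l := 𝓝 0) (isOpen_Ioo.mem_nhds zero_mem_Ioo_pi_div_three) ?_ h
  · intro φ h
    have h1 := (hasDerivAt_polylog_two_secCurve 3 Real.pi h
      (log_one_sub_secCurve_three_pi h)).complex_im
    have h2 := (hasDerivAt_polylog_two_secCurve 1 (-(Real.pi / 3)) h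
      (log_one_sub_secCurve_one_neg_pi_div_three h)).complex_im
    have h3 := (hasDerivAt_polylog_two_secCurve 1 (Real.pi / 3) h
      (log_one_sub_secCurve_one_pi_div_three h)).complex_im
    have h4 := (hasDerivAt_polylog_two_secCurve 1 0 h (log_one_sub_secCurve_one_zero h)).complex_im
    simp only [Complex.add_im, Complex.ofReal_im, Complex.im_ofReal_mul, Complex.I_im, zero_add,
      mul_one] at h1 h2 h3 h4
    refine ((((h1.sub (h2.const_mul 3)).sub (h3.const_mul 3)).add (h4.const_mul 2)).sub
      ((hasDerivAt_id φ).mul (hasDerivAt_log_two_mul_cos h)).neg).congr_deriv ?_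
    simp only [id]
    ring
  · have hl := (hasDerivAt_log_two_mul_cos zero_mem_Ioo_pi_div_three).continuousAt
    have := ((((continuousAt_im_polylog_secCurve 1 3 Real.pi).sub
      ((continuousAt_im_polylog_secCurve 1 1 (-(Real.pi / 3))).const_mul 3)).sub
      ((continuousAt_im_polylog_secCurve 1 1 (Real.pi / 3)).const_mul 3)).add
      ((continuousAt_im_polylog_secCurve 1 1 0).const_mul 2)).sub (continuousAt_id.mul hl).neg
    refine ContinuousAt.tendsto_of_eq this ?_
    obtain ⟨e1, e2, e3⟩ := secCurve_at_zero
    rw [e1, e2, e3, polylog_conj, polylog_ofReal_im, polylog_ofReal_im]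
    simp

/-- The first coefficient is 3 because the first curve turns three times as fast: this is the
combination that appears on differentiating the trilogarithms. The constant is found at φ = π/3,
where the arguments become 1, 1, e^{2πi/3} and e^{iπ/3}. -/
theorem re_polylog_two_secCurve {φ : ℝ} (h : φ ∈ Set.Ioo (-(Real.pi / 3)) (Real.pi / 3)) :
    3 * (polylog 2 (secCurve 3 Real.pi φ)).re - 3 * (polylog 2 (secCurve 1 (-(Real.pi / 3)) φ)).re
      - 3 * (polylog 2 (secCurve 1 (Real.pi / 3) φ)).re + 2 * (polylog 2 (secCurve 1 0 φ)).re
      = Real.log (2 * Real.cos φ) ^ 2 / 2 + 7 * φ ^ 2 / 2 - Real.pi ^ 2 / 6 := by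
  have key := (convex_Ioo (-(Real.pi / 3)) (Real.pi / 3)).eq_of_hasDerivAt_zero_of_tendsto isOpen_Ioo
    (f := fun φ => 3 * (polylog 2 (secCurve 3 Real.pi φ)).re
      - 3 * (polylog 2 (secCurve 1 (-(Real.pi / 3)) φ)).re
      - 3 * (polylog 2 (secCurve 1 (Real.pi / 3) φ)).re + 2 * (polylog 2 (secCurve 1 0 φ)).re
      - (Real.log (2 * Real.cos φ) ^ 2 / 2 + 7 * φ ^ 2 / 2))
    (c := - (Real.pi ^ 2 / 6))
    ?_ (l := 𝓝[<] (Real.pi / 3)) (Ioo_mem_nhdsLT (by linarith [Real.pi_pos])) ?_ h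
  · linear_combination key
  · intro φ h
    have h1 := (hasDerivAt_polylog_two_secCurve 3 Real.pi h
      (log_one_sub_secCurve_three_pi h)).complex_re
    have h2 := (hasDerivAt_polylog_two_secCurve 1 (-(Real.pi / 3)) h
      (log_one_sub_secCurve_one_neg_pi_div_three h)).complex_re
    have h3 := (hasDerivAt_polylog_two_secCurve 1 (Real.pi / 3) h
      (log_one_sub_secCurve_one_pi_div_three h)).complex_re
    have h4 := (hasDerivAt_polylog_two_secCurve 1 0 h (log_one_sub_secCurve_one_zero h)).complex_re
    simp only [Complex.add_re, Complex.ofReal_re, Complex.re_ofReal_mul, Complex.I_re, mul_zero,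
      add_zero] at h1 h2 h3 h4
    refine (((((h1.const_mul 3).sub (h2.const_mul 3)).sub (h3.const_mul 3)).add
      (h4.const_mul 2)).sub ((((hasDerivAt_log_two_mul_cos h).pow 2).div_const 2).add
      (((hasDerivAt_pow 2 φ).const_mul 7).div_const 2))).congr_deriv ?_
    push_cast
    ring
  · have hcos : Real.cos (Real.pi / 3) ≠ 0 := by rw [Real.cos_pi_div_three]; norm_num
    have ht : ∀ m δ : ℝ, Tendsto (fun φ => (polylog 2 (secCurve m δ φ)).re) (𝓝[<] (Real.pi / 3))
        (𝓝 (polylog 2 (secCurve m δ (Real.pi / 3))).re) := fun m δ =>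
      tendsto_polylog_two_re_left (hasDerivAt_secCurve m δ hcos).continuousAt (by
        filter_upwards [Ioo_mem_nhdsLT (show -(Real.pi / 3) < Real.pi / 3 by linarith [Real.pi_pos])]
          with φ hφ
        exact (norm_secCurve_lt_one m δ hφ).le)
    have hl : ContinuousAt (fun φ => Real.log (2 * Real.cos φ) ^ 2 / 2 + 7 * φ ^ 2 / 2)
        (Real.pi / 3) := by
      have hlog : ContinuousAt (fun φ => Real.log (2 * Real.cos φ)) (Real.pi / 3) :=
        ContinuousAt.log (by fun_prop) (mul_ne_zero two_ne_zero hcos)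
      exact ContinuousAt.add ((hlog.pow 2).div_const 2) (by fun_prop)
    have h := (((((ht 3 Real.pi).const_mul 3).sub ((ht 1 (-(Real.pi / 3))).const_mul 3)).sub
      ((ht 1 (Real.pi / 3)).const_mul 3)).add ((ht 1 0).const_mul 2)).sub
      (hl.tendsto.mono_left nhdsWithin_le_nhds)
    convert h using 2
    have hd : ((2 * Real.cos (Real.pi / 3) : ℝ) : ℂ) = 1 := by
      rw [Real.cos_pi_div_three]; norm_num
    have e1 : secCurve 3 Real.pi (Real.pi / 3) = 1 := by
      rw [secCurve, hd, div_one, show 3 * (Real.pi / 3) + Real.pi = 2 * Real.pi by ring]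
      push_cast
      exact Complex.exp_two_pi_mul_I
    have e2 : secCurve 1 (-(Real.pi / 3)) (Real.pi / 3) = 1 := by
      rw [secCurve, hd, div_one, show 1 * (Real.pi / 3) + -(Real.pi / 3) = 0 by ring]
      simp
    have e3 : secCurve 1 (Real.pi / 3) (Real.pi / 3)
        = Complex.exp ((Real.pi / 3 : ℝ) * Complex.I) ^ 2 := by
      rw [secCurve, hd, div_one, ← Complex.exp_nat_mul]
      congr 1; push_cast; ring
    have e4 : secCurve 1 0 (Real.pi / 3) = Complex.exp ((Real.pi / 3 : ℝ) * Complex.I) := by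
      rw [secCurve, hd, div_one, one_mul, add_zero]
    rw [e1, e2, e3, e4, polylog_two_exp_pi_div_three_re, polylog_two_exp_two_pi_div_three_re,
      Real.cos_pi_div_three]
    norm_num
    ring

/-- Each curve has logarithmic derivative tan φ + im, so the derivative of the left side is tan φ
times the imaginary dilogarithm relation plus the real one. -/
theorem im_polylog_three_secCurve {φ : ℝ} (h : φ ∈ Set.Ioo (-(Real.pi / 3)) (Real.pi / 3)) :
    (polylog 3 (secCurve 3 Real.pi φ)).im - 3 * (polylog 3 (secCurve 1 (-(Real.pi / 3)) φ)).im
      - 3 * (polylog 3 (secCurve 1 (Real.pi / 3) φ)).im + 2 * (polylog 3 (secCurve 1 0 φ)).im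
      = φ * Real.log (2 * Real.cos φ) ^ 2 / 2 + 7 * φ ^ 3 / 6 - Real.pi ^ 2 * φ / 6 := by
  rw [← sub_eq_zero]
  refine (convex_Ioo (-(Real.pi / 3)) (Real.pi / 3)).eq_of_hasDerivAt_zero_of_tendsto isOpen_Ioo
    (f := fun φ => (polylog 3 (secCurve 3 Real.pi φ)).im
      - 3 * (polylog 3 (secCurve 1 (-(Real.pi / 3)) φ)).im
      - 3 * (polylog 3 (secCurve 1 (Real.pi / 3) φ)).im + 2 * (polylog 3 (secCurve 1 0 φ)).im
      - (φ * Real.log (2 * Real.cos φ) ^ 2 / 2 + 7 * φ ^ 3 / 6 - Real.pi ^ 2 * φ / 6))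
    ?_ (l := 𝓝 0) (isOpen_Ioo.mem_nhds zero_mem_Ioo_pi_div_three) ?_ h
  · intro φ h
    have h1 := (hasDerivAt_polylog_secCurve 2 3 Real.pi h).complex_im
    have h2 := (hasDerivAt_polylog_secCurve 2 1 (-(Real.pi / 3)) h).complex_im
    have h3 := (hasDerivAt_polylog_secCurve 2 1 (Real.pi / 3) h).complex_im
    have h4 := (hasDerivAt_polylog_secCurve 2 1 0 h).complex_im
    refine ((((h1.sub (h2.const_mul 3)).sub (h3.const_mul 3)).add (h4.const_mul 2)).sub
      (((((hasDerivAt_id φ).mul ((hasDerivAt_log_two_mul_cos h).pow 2)).div_const 2).add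
      (((hasDerivAt_pow 3 φ).const_mul 7).div_const 6)).sub
      (((hasDerivAt_id φ).const_mul (Real.pi ^ 2)).div_const 6))).congr_deriv ?_
    have hi := im_polylog_two_secCurve h
    have hr := re_polylog_two_secCurve h
    simp only [id, Complex.mul_im, Complex.add_re, Complex.add_im, Complex.ofReal_re,
      Complex.ofReal_im, Complex.mul_re, Complex.I_re, Complex.I_im, Pi.pow_apply]
    push_cast
    linear_combination Real.tan φ * hi + hr
  · have hl := (hasDerivAt_log_two_mul_cos zero_mem_Ioo_pi_div_three).continuousAt
    have := ((((continuousAt_im_polylog_secCurve 2 3 Real.pi).sub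
      ((continuousAt_im_polylog_secCurve 2 1 (-(Real.pi / 3))).const_mul 3)).sub
      ((continuousAt_im_polylog_secCurve 2 1 (Real.pi / 3)).const_mul 3)).add
      ((continuousAt_im_polylog_secCurve 2 1 0).const_mul 2)).sub
      ((((continuousAt_id.mul (hl.pow 2)).div_const 2).add
      (((continuousAt_id.pow 3).const_mul 7).div_const 6)).sub
      ((continuousAt_id.const_mul (Real.pi ^ 2)).div_const 6))
    refine ContinuousAt.tendsto_of_eq this ?_
    obtain ⟨e1, e2, e3⟩ := secCurve_at_zero
    rw [e1, e2, e3, polylog_conj, polylog_ofReal_im, polylog_ofReal_im]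
    simp

/-! ### The five-term relation for a conjugate pair `v, v̄ ∈ (1 ± i) ℝ` -/

theorem norm_ofReal_mul_le {k : ℝ} (h : k ∈ Set.Ioo (0 : ℝ) (2 / 5)) {e : ℂ}
    (he : Complex.normSq e = 2) : ‖(k : ℂ) * e‖ < 1 := by
  refine lt_of_pow_lt_pow_left₀ 2 (by norm_num) ?_
  rw [Complex.sq_norm, Complex.normSq_mul, he, Complex.normSq_ofReal]
  nlinarith [h.1, h.2]

theorem one_sub_two_mul_sq_pos {k : ℝ} (h : k ∈ Set.Ioo (0 : ℝ) (2 / 5)) : 0 < 1 - 2 * k ^ 2 := by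
  nlinarith [h.1, h.2]

/-- The condition amounts to 6k² - 4k³ < 1, which holds for 0 < k < 1/2. The bound 2/5 leaves room
and still exceeds (√3-1)/2, the value needed later. -/
theorem norm_fiveTerm_arg_lt {k : ℝ} (h : k ∈ Set.Ioo (0 : ℝ) (2 / 5)) {e : ℂ}
    (he : Complex.normSq e = 2) (her : e.re = 1) :
    ‖1 - (1 - (k : ℂ) * e) / (1 - 2 * (k : ℂ) ^ 2)‖ < 1 := by
  have h0 := one_sub_two_mul_sq_pos h
  have hne : ((1 - 2 * k ^ 2 : ℝ) : ℂ) ≠ 0 := by exact_mod_cast h0.ne'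
  have : 1 - (1 - (k : ℂ) * e) / (1 - 2 * (k : ℂ) ^ 2)
      = (k * (e - 2 * k)) / ((1 - 2 * k ^ 2 : ℝ) : ℂ) := by
    push_cast at hne ⊢
    rw [eq_div_iff hne, sub_mul, div_mul_cancel₀ _ hne]
    ring
  rw [this, norm_div, Complex.norm_real, Real.norm_of_nonneg h0.le, div_lt_one h0]
  refine lt_of_pow_lt_pow_left₀ 2 h0.le ?_
  rw [Complex.sq_norm, Complex.normSq_mul, Complex.normSq_ofReal, Complex.normSq_apply]
  rw [Complex.normSq_apply] at he
  simp only [her, Complex.sub_re, Complex.sub_im, Complex.mul_re, Complex.mul_im, Complex.re_ofNat,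
    Complex.im_ofNat, Complex.ofReal_re, Complex.ofReal_im] at he ⊢
  have h1 := h.1
  have h2 := h.2
  have h3 : k * k < 4 / 25 := by nlinarith
  have h4 : e.im * e.im = 1 := by linarith
  nlinarith

theorem hasDerivAt_log_one_sub_mul {k : ℝ} {e : ℂ} (h : ‖(k : ℂ) * e‖ < 1) :
    HasDerivAt (fun k : ℝ => Complex.log (1 - k * e)) (-e / (1 - k * e)) k := by
  have := (((hasDerivAt_id (k : ℂ)).mul_const e).const_sub 1).clog (one_sub_mem_slitPlane h)
  refine this.comp_ofReal.congr_deriv ?_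
  simp

/-- The five-term relation for the dilogarithm at `k e` and `k e'`, where `e = 1 ± i`, `e' = 1 ∓ i`. -/
theorem polylog_two_conj_pair {k : ℝ} (h : k ∈ Set.Ioo (0 : ℝ) (2 / 5)) {e e' : ℂ}
    (he : Complex.normSq e = 2) (her : e.re = 1) (he' : Complex.normSq e' = 2) (her' : e'.re = 1)
    (hee : e * e' = 2) :
    polylog 2 (k * e) + polylog 2 (k * e') - polylog 2 (2 * k ^ 2)
      - polylog 2 (1 - (1 - k * e) / (1 - 2 * k ^ 2)) - polylog 2 (1 - (1 - k * e') / (1 - 2 * k ^ 2))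
      = (Complex.log (1 - k * e) - Complex.log (1 - 2 * k ^ 2))
        * (Complex.log (1 - k * e') - Complex.log (1 - 2 * k ^ 2)) := by
  rw [← sub_eq_zero]
  refine (convex_Ioo (0 : ℝ) (2 / 5)).eq_of_hasDerivAt_zero_of_tendsto isOpen_Ioo
    (f := fun k : ℝ => polylog 2 (k * e) + polylog 2 (k * e') - polylog 2 (2 * k ^ 2)
      - polylog 2 (1 - (1 - k * e) / (1 - 2 * k ^ 2)) - polylog 2 (1 - (1 - k * e') / (1 - 2 * k ^ 2))
      - (Complex.log (1 - k * e) - Complex.log (1 - 2 * k ^ 2))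
        * (Complex.log (1 - k * e') - Complex.log (1 - 2 * k ^ 2)))
    ?_ (l := 𝓝[>] 0) (Ioo_mem_nhdsGT (by norm_num)) ?_ h
  · intro k h
    have hn := norm_ofReal_mul_le h he
    have hn' := norm_ofReal_mul_le h he'
    have hp := norm_fiveTerm_arg_lt h he her
    have hp' := norm_fiveTerm_arg_lt h he' her'
    have h0 := one_sub_two_mul_sq_pos h
    have hsq : ‖(2 * (k : ℂ) ^ 2)‖ < 1 := by
      rw [show 2 * (k : ℂ) ^ 2 = ((2 * k ^ 2 : ℝ) : ℂ) by push_cast; ring, Complex.norm_real,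
        Real.norm_of_nonneg (by positivity)]
      linarith
    have hk : (k : ℂ) ≠ 0 := by exact_mod_cast h.1.ne'
    have e0 : e ≠ 0 := by rintro rfl; simp at he
    have e0' : e' ≠ 0 := by rintro rfl; simp at he'
    have hA := one_sub_ne_zero hn
    have hA' := one_sub_ne_zero hn'
    have hB := one_sub_ne_zero hsq
    have hBpos := one_sub_re_pos hsq
    have hl := log_div_of_re_pos (one_sub_re_pos hn) hBpos
    have hl' := log_div_of_re_pos (one_sub_re_pos hn') hBpos
    -- With x = ke, y = ke' and xy = 2k², the last two arguments take the usual five-term form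
    -- x(1-y)/(1-xy) and y(1-x)/(1-xy).
    have factor : ∀ {e e' : ℂ}, e * e' = 2 →
        1 - (1 - (k : ℂ) * e) / (1 - 2 * (k : ℂ) ^ 2) = k * e * (1 - k * e') / (1 - 2 * k ^ 2) := by
      intro e e' hee
      rw [eq_div_iff hB, sub_mul, div_mul_cancel₀ _ hB]
      linear_combination (k : ℂ) ^ 2 * hee
    have hf := factor hee
    have hf' := factor (e := e') (e' := e) (by rw [mul_comm]; exact hee)
    have hd : ∀ e : ℂ, HasDerivAt (fun k : ℝ => (k : ℂ) * e) e k := fun e => by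
      simpa using ((hasDerivAt_id (k : ℂ)).mul_const e).comp_ofReal
    have hdsq : HasDerivAt (fun k : ℝ => (2 * (k : ℂ) ^ 2 : ℂ)) (4 * k : ℂ) k := by
      refine ((hasDerivAt_pow 2 (k : ℂ)).const_mul 2).comp_ofReal.congr_deriv ?_
      push_cast; ring
    have hdp : ∀ e : ℂ, HasDerivAt (fun k : ℝ => 1 - (1 - (k : ℂ) * e) / (1 - 2 * (k : ℂ) ^ 2))
        (-((-e * (1 - 2 * k ^ 2) - (1 - k * e) * -(4 * k)) / (1 - 2 * k ^ 2) ^ 2)) k := fun e =>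
      (((hd e).const_sub 1).div (hdsq.const_sub 1) hB).const_sub 1
    have hlsq : HasDerivAt (fun k : ℝ => Complex.log (1 - 2 * (k : ℂ) ^ 2))
        (-(4 * k) / (1 - 2 * k ^ 2)) k := by
      exact (hdsq.const_sub 1).clog_real (one_sub_mem_slitPlane hsq)
    have D1 := (hd e).polylog_two hn (mul_ne_zero hk e0)
    have D2 := (hd e').polylog_two hn' (mul_ne_zero hk e0')
    have D3 := hdsq.polylog_two hsq (mul_ne_zero two_ne_zero (pow_ne_zero 2 hk))
    have D4 := (hdp e).polylog_two hp (by
      rw [hf]; exact div_ne_zero (mul_ne_zero (mul_ne_zero hk e0) hA') hB)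
    have D5 := (hdp e').polylog_two hp' (by
      rw [hf']; exact div_ne_zero (mul_ne_zero (mul_ne_zero hk e0') hA) hB)
    rw [sub_sub_cancel, hl] at D4
    rw [sub_sub_cancel, hl'] at D5
    refine ((((D1.add D2).sub D3).sub D4).sub D5).sub
      (((hasDerivAt_log_one_sub_mul hn).sub hlsq).mul ((hasDerivAt_log_one_sub_mul hn').sub hlsq))
      |>.congr_deriv ?_
    -- The logarithmic derivative of x(1-y)/(1-xy), one fraction for each factor.
    have q : ∀ {e e' : ℂ}, e ≠ 0 → e * e' = 2 → (1 - (k : ℂ) * e') ≠ 0 →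
        1 - (1 - (k : ℂ) * e) / (1 - 2 * (k : ℂ) ^ 2) = k * e * (1 - k * e') / (1 - 2 * k ^ 2) →
        -((-e * (1 - 2 * (k : ℂ) ^ 2) - (1 - k * e) * -(4 * k)) / (1 - 2 * k ^ 2) ^ 2)
          / (1 - (1 - k * e) / (1 - 2 * k ^ 2))
        = 1 / k - e' / (1 - k * e') + 4 * k / (1 - 2 * k ^ 2) := by
      intro e e' e0 hee hA' hf
      rw [hf]
      generalize hBdef : 1 - 2 * (k : ℂ) ^ 2 = B at hB ⊢
      field_simp
      linear_combination (2 * k * B + 4 * (k : ℂ) ^ 3) * hee - 4 * k * hBdef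
    rw [q e0 hee hA' hf, q e0' (by rw [mul_comm]; exact hee) hA hf']
    have c1 : e / (k * e) = 1 / k := by field_simp
    have c2 : e' / (k * e') = 1 / k := by field_simp
    have c3 : 4 * (k : ℂ) / (2 * k ^ 2) = 2 / k := by field_simp; norm_num
    simp only [c1, c2, c3, Pi.sub_apply]
    ring
  · have hc : ∀ g : ℝ → ℂ, ContinuousAt g 0 → g 0 = 0 →
        ContinuousAt (fun k => polylog 2 (g k)) 0 := fun g hg h0 =>
      ContinuousAt.comp (g := polylog 2) (continuousAt_polylog 1 (by simp [h0])) hg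
    have hB : ContinuousAt (fun k : ℝ => 1 - (1 - (k : ℂ) * e) / (1 - 2 * (k : ℂ) ^ 2)) 0 :=
      continuousAt_const.sub (ContinuousAt.div (by fun_prop) (by fun_prop) (by simp))
    have hB' : ContinuousAt (fun k : ℝ => 1 - (1 - (k : ℂ) * e') / (1 - 2 * (k : ℂ) ^ 2)) 0 :=
      continuousAt_const.sub (ContinuousAt.div (by fun_prop) (by fun_prop) (by simp))
    have hL : ∀ g : ℝ → ℂ, ContinuousAt g 0 → g 0 = 0 →
        ContinuousAt (fun k => Complex.log (1 - g k)) 0 := fun g hg h0 =>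
      (continuousAt_const.sub hg).clog (by simp [h0])
    have := (((((hc (fun k : ℝ => (k : ℂ) * e) (by fun_prop) (by simp)).add
      (hc (fun k : ℝ => (k : ℂ) * e') (by fun_prop) (by simp))).sub
      (hc (fun k : ℝ => 2 * (k : ℂ) ^ 2) (by fun_prop) (by simp))).sub
      (hc _ hB (by simp))).sub (hc _ hB' (by simp))).sub
      (((hL (fun k : ℝ => (k : ℂ) * e) (by fun_prop) (by simp)).sub
        (hL (fun k : ℝ => 2 * (k : ℂ) ^ 2) (by fun_prop) (by simp))).mul
      ((hL (fun k : ℝ => (k : ℂ) * e') (by fun_prop) (by simp)).sub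
        (hL (fun k : ℝ => 2 * (k : ℂ) ^ 2) (by fun_prop) (by simp))))
    refine (ContinuousAt.tendsto_of_eq this ?_).mono_left nhdsWithin_le_nhds
    simp [polylog_zero]

theorem hasDerivAt_polylog_const_mul (s : ℕ) {e t : ℂ} (h : ‖e * t‖ < 1) (he : e ≠ 0) (ht : t ≠ 0) :
    HasDerivAt (fun t => polylog (s + 1) (e * t)) (polylog s (e * t) / t) t := by
  have := ((hasDerivAt_id t).const_mul e).polylog_succ s h (mul_ne_zero he ht)
  refine this.congr_deriv ?_
  simp only [id]
  field_simp

theorem hasDerivAt_nielsenS12_const_mul {e t : ℂ} (h : ‖e * t‖ < 1) (he : e ≠ 0) (ht : t ≠ 0) :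
    HasDerivAt (fun t => nielsenS12 (e * t)) (Complex.log (1 - e * t) ^ 2 / 2 / t) t := by
  have := ((hasDerivAt_id t).const_mul e).nielsenS12 h (mul_ne_zero he ht)
  refine this.congr_deriv ?_
  simp only [id]
  field_simp

/-! ### The Taylor series of arcsin x / √(1-x²) -/

/-- The Taylor coefficients of `arcsin x / √(1 - x²)`, shifted by one. -/
def arcsinCoeff (m : ℕ) : ℂ :=
  if Even m then 4 ^ (m / 2) / ((m + 1 : ℂ) * (Nat.choose m (m / 2) : ℂ)) else 0

theorem arcsinCoeff_two_mul (n : ℕ) :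
    arcsinCoeff (2 * n) = 4 ^ n / ((2 * n + 1 : ℂ) * (Nat.centralBinom n : ℂ)) := by
  simp [arcsinCoeff, Nat.centralBinom]

theorem arcsinCoeff_odd (n : ℕ) : arcsinCoeff (2 * n + 1) = 0 := by
  simp [arcsinCoeff]

theorem norm_arcsinCoeff_le (m : ℕ) : ‖arcsinCoeff m‖ ≤ 1 := by
  obtain ⟨n, rfl | rfl⟩ := m.even_or_odd'
  · rw [arcsinCoeff_two_mul]
    have h := Nat.four_pow_le_two_mul_add_one_mul_central_binom n
    have h1 : (2 * n + 1 : ℂ) * (Nat.centralBinom n : ℂ)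
        = (((2 * n + 1) * Nat.centralBinom n : ℕ) : ℂ) := by push_cast; ring
    have h2 : (4 : ℂ) ^ n = ((4 ^ n : ℕ) : ℂ) := by push_cast; ring
    rw [h1, h2, norm_div, Complex.norm_natCast, Complex.norm_natCast]
    exact div_le_one_of_le₀ (by exact_mod_cast h) (by positivity)
  · rw [arcsinCoeff_odd]; simp

/-- This is the ratio of consecutive central binomial coefficients, and it is equivalent to the
differential equation below up to initial terms. -/
theorem arcsinCoeff_rec (m : ℕ) :
    ((m : ℂ) + 3) * arcsinCoeff (m + 2) = (m + 2) * arcsinCoeff m := by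
  obtain ⟨n, rfl | rfl⟩ := m.even_or_odd'
  · rw [show 2 * n + 2 = 2 * (n + 1) by ring, arcsinCoeff_two_mul, arcsinCoeff_two_mul]
    have h := congrArg (Nat.cast (R := ℂ)) (Nat.succ_mul_centralBinom_succ n)
    push_cast at h ⊢
    have h1 : (Nat.centralBinom n : ℂ) ≠ 0 := by exact_mod_cast Nat.centralBinom_ne_zero n
    have h2 : (Nat.centralBinom (n + 1) : ℂ) ≠ 0 := by
      exact_mod_cast Nat.centralBinom_ne_zero (n + 1)
    have h3 : (2 * (n : ℂ) + 1) ≠ 0 := by exact_mod_cast (2 * n).succ_ne_zero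
    have h4 : (2 * ((n : ℂ) + 1) + 1) ≠ 0 := by exact_mod_cast (2 * (n + 1)).succ_ne_zero
    rw [mul_div_assoc', mul_div_assoc', div_eq_div_iff (mul_ne_zero h4 h2) (mul_ne_zero h3 h1)]
    rw [pow_succ]
    linear_combination (-2 * 4 ^ n * (2 * (n : ℂ) + 3)) * h
  · rw [show 2 * n + 1 + 2 = 2 * (n + 1) + 1 by ring, arcsinCoeff_odd, arcsinCoeff_odd]; simp

theorem norm_arcsinCoeff_le_succ (m : ℕ) : ‖arcsinCoeff m‖ ≤ m + 1 :=
  (norm_arcsinCoeff_le m).trans (by linarith [m.cast_nonneg (α := ℝ)])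

/-- The differential equation `(1 - x²) g' = 1 + x g` of `arcsin x / √(1 - x²)`. -/
theorem exists_hasDerivAt_arcsin_series {x : ℂ} (hx : ‖x‖ < 1) :
    ∃ g', HasDerivAt (polySeries 0 arcsinCoeff) g' x ∧
      (1 - x ^ 2) * g' = 1 + x * polySeries 0 arcsinCoeff x := by
  set a : ℕ → ℂ := fun m => (m + 1) * arcsinCoeff m with ha
  have hna : ∀ m, ‖a m‖ ≤ m + 1 := fun m => by
    rw [ha, norm_mul]
    have : ‖(m : ℂ) + 1‖ = m + 1 := by exact_mod_cast Complex.norm_natCast (m + 1)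
    rw [this]
    exact mul_le_of_le_one_right (by positivity) (norm_arcsinCoeff_le m)
  -- The derivative rule needs an exponent of at least one; the missing denominator is supplied by
  -- multiplying the coefficients by m + 1.
  have hp : polySeries 0 arcsinCoeff = polySeries 1 a := by
    funext z
    refine tsum_congr fun m => ?_
    have : ((m : ℂ) + 1) ≠ 0 := by exact_mod_cast m.succ_ne_zero
    rw [ha]; push_cast; field_simp
  have hd := hasDerivAt_polySeries 0 hna hx
  rw [← hp] at hd
  refine ⟨_, hd, ?_⟩
  simp only [pow_zero, div_one]
  have hs : Summable (fun m : ℕ => x ^ m * a m) := by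
    have h1 : Summable (fun n : ℕ => ‖x‖ ^ n * ((n : ℝ) + 1)) := by
      have h1 := summable_pow_mul_geometric_of_norm_lt_one 1 (r := ‖x‖) (by simpa using hx)
      have h0 := summable_pow_mul_geometric_of_norm_lt_one 0 (r := ‖x‖) (by simpa using hx)
      refine (h1.add h0).congr fun n => ?_
      simp; ring
    refine .of_norm_bounded h1 fun n => ?_
    simpa using norm_coeff_div_le 0 hna x n n
  have h2 := (hasSum_nat_add_iff' 2).mpr hs.hasSum
  have h3 := hs.hasSum.mul_left (x ^ 2)
  have h4 := (summable_polySeries 0 norm_arcsinCoeff_le_succ hx).hasSum.mul_left x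
  -- The recurrence matches all powers from x² on. The two omitted terms, a 0 = 1 and a 1 = 0,
  -- account for the inhomogeneous term 1.
  have h5 := (h3.add h4).unique (h2.congr_fun fun m => by
    have hr := arcsinCoeff_rec m
    simp only [ha]
    push_cast
    linear_combination -x ^ (m + 2) * hr)
  have a0 : a 0 = 1 := by simp [ha, arcsinCoeff]
  have a1 : a 1 = 0 := by simp [ha, arcsinCoeff]
  simp only [Finset.sum_range_succ, Finset.range_zero, Finset.sum_empty, a0, a1] at h5
  rw [polySeries]
  linear_combination -h5

/-- Only even indices contribute, and (1/2)^(2n+1) 4^n = 1/2, whence the point 1/2 and the factor 2.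
-/
theorem hasSum_inv_centralBinom :
    HasSum (fun n : ℕ => 1 / ((2 * (n : ℂ) + 1) ^ 3 * (Nat.choose (2 * n) n : ℂ)))
      (2 * polySeries 2 arcsinCoeff (1 / 2)) := by
  have h := (summable_polySeries 2 norm_arcsinCoeff_le_succ (z := 1 / 2) (by norm_num)).hasSum
  have hinj : Function.Injective (fun n : ℕ => 2 * n) := fun a b hab => by simpa using hab
  have h2 := (hinj.hasSum_iff (f := fun n : ℕ =>
    (1 / 2 : ℂ) ^ (n + 1) / ((n + 1 : ℕ) : ℂ) ^ 2 * arcsinCoeff n) (by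
      intro m hm
      obtain ⟨n, rfl | rfl⟩ := m.even_or_odd'
      · exact absurd ⟨n, rfl⟩ hm
      · rw [arcsinCoeff_odd, mul_zero])).mpr h
  refine (h2.mul_left 2).congr_fun fun n => ?_
  simp only [Function.comp, arcsinCoeff_two_mul, Nat.centralBinom]
  have h3 : (2 * (n : ℂ) + 1) ≠ 0 := by exact_mod_cast (2 * n).succ_ne_zero
  have h1 : ((2 * n).choose n : ℂ) ≠ 0 := by exact_mod_cast Nat.centralBinom_ne_zero n
  have h4 : (1 / 2 : ℂ) ^ (2 * n + 1) * 4 ^ n = 1 / 2 := by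
    rw [pow_succ, pow_mul, mul_right_comm, ← mul_pow]; norm_num
  push_cast
  field_simp
  linear_combination -2 * h4

/-! ### The series at `x = 2 t / (1 + t²)` -/

/-- The right half of the disc of radius `2/5`. -/
def smallHalfDisc : Set ℂ := Metric.ball 0 (2 / 5) ∩ {z | 0 < z.re}

theorem convex_smallHalfDisc : Convex ℝ smallHalfDisc :=
  (convex_ball _ _).inter (convex_halfSpace_re_gt 0)

theorem isOpen_smallHalfDisc : IsOpen smallHalfDisc :=
  Metric.isOpen_ball.inter (isOpen_lt continuous_const Complex.continuous_re)

instance : (𝓝[smallHalfDisc] (0 : ℂ)).NeBot := by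
  rw [← mem_closure_iff_nhdsWithin_neBot, Metric.mem_closure_iff]
  intro ε hε
  have h0 : 0 < min (ε / 2) (1 / 5) := by positivity
  have h1 := min_le_left (ε / 2) (1 / 5)
  have h2 := min_le_right (ε / 2) (1 / 5)
  refine ⟨((min (ε / 2) (1 / 5) : ℝ) : ℂ), ⟨?_, by simpa using h0⟩, ?_⟩
  · rw [mem_ball_zero_iff, Complex.norm_real, Real.norm_of_nonneg h0.le]; linarith
  · rw [dist_zero_left, Complex.norm_real, Real.norm_of_nonneg h0.le]; linarith

/-- The substitution `t ↦ 2 t / (1 + t²)`. -/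
def sinHalf (t : ℂ) : ℂ := 2 * t / (1 + t ^ 2)

section

variable {t : ℂ}

theorem one_add_sq_ne_zero (ht : ‖t‖ < 1) : 1 + t ^ 2 ≠ 0 :=
  one_add_ne_zero (by rw [norm_pow]; exact pow_lt_one₀ (norm_nonneg _) ht two_ne_zero)

/-- The bound 2|t|/(1-|t|²) stays below 1 for |t| < √2 - 1. The radius 2/5 is smaller than that and
larger than 2 - √3. -/
theorem norm_sinHalf_lt_one (ht : ‖t‖ < 2 / 5) : ‖sinHalf t‖ < 1 := by
  have h1 : 1 + t ^ 2 ≠ 0 := one_add_sq_ne_zero (by linarith)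
  rw [sinHalf, norm_div, div_lt_one (norm_pos_iff.mpr h1), norm_mul]
  have h2 : 1 - ‖t‖ ^ 2 ≤ ‖1 + t ^ 2‖ := by
    have := norm_sub_norm_le (1 : ℂ) (-t ^ 2)
    rw [norm_neg, norm_one, norm_pow, sub_neg_eq_add] at this
    exact this
  have h3 : ‖(2 : ℂ)‖ = 2 := by norm_num
  rw [h3]
  nlinarith [norm_nonneg t]

theorem hasDerivAt_sinHalf (ht : ‖t‖ < 1) :
    HasDerivAt sinHalf (2 * (1 - t ^ 2) / (1 + t ^ 2) ^ 2) t := by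
  have h := ((hasDerivAt_id t).const_mul 2).div ((hasDerivAt_pow 2 t).const_add 1)
    (one_add_sq_ne_zero ht)
  refine h.congr_deriv ?_
  simp only [id]
  push_cast
  ring

theorem norm_I_mul_lt (ht : ‖t‖ < 1) : ‖Complex.I * t‖ < 1 := by
  rwa [norm_mul, Complex.norm_I, one_mul]

theorem norm_neg_I_mul_lt (ht : ‖t‖ < 1) : ‖-Complex.I * t‖ < 1 := by
  rwa [norm_mul, norm_neg, Complex.norm_I, one_mul]

theorem hasDerivAt_log_one_sub_const_mul {e : ℂ} (h : ‖e * t‖ < 1) :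
    HasDerivAt (fun t => Complex.log (1 - e * t)) (-e / (1 - e * t)) t := by
  refine (((hasDerivAt_id t).const_mul e).const_sub 1).clog (one_sub_mem_slitPlane h)
    |>.congr_deriv ?_
  simp

theorem one_add_sq_factor : 1 + t ^ 2 = (1 - Complex.I * t) * (1 - -Complex.I * t) := by
  linear_combination t ^ 2 * Complex.I_sq

theorem mem_smallHalfDisc (h : t ∈ smallHalfDisc) : ‖t‖ < 2 / 5 ∧ ‖t‖ < 1 ∧ t ≠ 0 := by
  have h1 : ‖t‖ < 2 / 5 := by simpa using h.1
  exact ⟨h1, by linarith, ne_zero_of_re_pos h.2⟩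

/-- With x = 2t/(1+t²), the factor (1-t²)/(1+t²) is √(1-x²) and the right side is 2 arctan t. The
differential equation shows that the left side has derivative 2/(1+t²), so no branch of arcsin is
needed. -/
theorem polySeries_zero_arcsinCoeff (ht : t ∈ smallHalfDisc) :
    polySeries 0 arcsinCoeff (sinHalf t) * ((1 - t ^ 2) / (1 + t ^ 2))
      = Complex.I * (Complex.log (1 - Complex.I * t) - Complex.log (1 - -Complex.I * t)) := by
  rw [← sub_eq_zero]
  have hder : ∀ t : ℂ, ‖t‖ < 2 / 5 → HasDerivAt (fun t => polySeries 0 arcsinCoeff (sinHalf t)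
      * ((1 - t ^ 2) / (1 + t ^ 2)) - Complex.I * (Complex.log (1 - Complex.I * t)
        - Complex.log (1 - -Complex.I * t))) 0 t := by
    intro t ht
    have ht1 : ‖t‖ < 1 := by linarith
    obtain ⟨g', hg, hode⟩ := exists_hasDerivAt_arcsin_series (norm_sinHalf_lt_one ht)
    have hρ : HasDerivAt (fun t : ℂ => (1 - t ^ 2) / (1 + t ^ 2)) (-4 * t / (1 + t ^ 2) ^ 2) t := by
      refine ((hasDerivAt_pow 2 t).const_sub 1).div ((hasDerivAt_pow 2 t).const_add 1)
        (one_add_sq_ne_zero ht1) |>.congr_deriv ?_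
      push_cast
      ring
    refine ((hg.comp t (hasDerivAt_sinHalf ht1)).mul hρ).sub
      (((hasDerivAt_log_one_sub_const_mul (norm_I_mul_lt ht1)).sub
      (hasDerivAt_log_one_sub_const_mul (norm_neg_I_mul_lt ht1))).const_mul Complex.I)
      |>.congr_deriv ?_
    have hB := one_add_sq_ne_zero ht1
    have hA := one_sub_ne_zero (norm_I_mul_lt ht1)
    have hA' := one_sub_ne_zero (norm_neg_I_mul_lt ht1)
    have e1 : Complex.I * (-Complex.I / (1 - Complex.I * t) - - -Complex.I / (1 - -Complex.I * t))
        = 2 / (1 + t ^ 2) := by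
      rw [one_add_sq_factor, div_sub_div _ _ hA hA', mul_div_assoc']
      congr 1
      linear_combination (-2 : ℂ) * Complex.I_sq
    rw [e1]
    simp only [Function.comp]
    rw [sinHalf] at hode ⊢
    generalize polySeries 0 arcsinCoeff (2 * t / (1 + t ^ 2)) = G at *
    -- The differential equation with denominators cleared, using 1 - x² = (1-t²)²/(1+t²)².
    have hode2 : (1 - t ^ 2) ^ 2 * g' = (1 + t ^ 2) ^ 2 + 2 * t * (1 + t ^ 2) * G := by
      field_simp at hode
      linear_combination hode
    generalize hBd : 1 + t ^ 2 = B at *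
    field_simp
    linear_combination 2 * hode2
  refine convex_smallHalfDisc.eq_of_hasDerivAt_zero_of_tendsto isOpen_smallHalfDisc
    (f := fun t => polySeries 0 arcsinCoeff (sinHalf t)
      * ((1 - t ^ 2) / (1 + t ^ 2)) - Complex.I * (Complex.log (1 - Complex.I * t)
        - Complex.log (1 - -Complex.I * t))) (fun t ht => hder t (mem_smallHalfDisc ht).1)
    (l := 𝓝[smallHalfDisc] 0) self_mem_nhdsWithin ?_ ht
  refine (ContinuousAt.tendsto_of_eq (hder 0 (by simp)).continuousAt ?_).mono_left nhdsWithin_le_nhds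
  simp [sinHalf, polySeries_zero]

theorem sinHalf_ne_zero (ht : ‖t‖ < 1) (h0 : t ≠ 0) : sinHalf t ≠ 0 :=
  div_ne_zero (mul_ne_zero two_ne_zero h0) (one_add_sq_ne_zero ht)

theorem hasDerivAt_polySeries_sinHalf (s : ℕ) (ht : t ∈ smallHalfDisc) :
    HasDerivAt (fun t => polySeries (s + 1) arcsinCoeff (sinHalf t))
      (polySeries s arcsinCoeff (sinHalf t) * ((1 - t ^ 2) / (1 + t ^ 2)) / t) t := by
  obtain ⟨h1, h2, h0⟩ := mem_smallHalfDisc ht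
  refine ((hasDerivAt_sinHalf h2).polySeries_succ s norm_arcsinCoeff_le_succ
    (norm_sinHalf_lt_one h1) (sinHalf_ne_zero h2 h0)).congr_deriv ?_
  have hB := one_add_sq_ne_zero h2
  have e : 2 * (1 - t ^ 2) / (1 + t ^ 2) ^ 2 / sinHalf t = (1 - t ^ 2) / (1 + t ^ 2) / t := by
    rw [sinHalf]
    generalize 1 + t ^ 2 = B at *
    field_simp
  rw [e]
  ring

theorem continuousAt_polySeries_sinHalf (s : ℕ) :
    ContinuousAt (fun t => polySeries (s + 1) arcsinCoeff (sinHalf t)) 0 :=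
  ContinuousAt.comp (g := polySeries (s + 1) arcsinCoeff)
    (continuousAt_polySeries s norm_arcsinCoeff_le_succ (by simp [sinHalf]))
    (hasDerivAt_sinHalf (by simp)).continuousAt

theorem continuousAt_polylog_const_mul (s : ℕ) (e : ℂ) :
    ContinuousAt (fun t => polylog (s + 1) (e * t)) 0 :=
  ContinuousAt.comp (g := polylog (s + 1)) (continuousAt_polylog s (by simp)) (by fun_prop)

theorem polySeries_one_arcsinCoeff (ht : t ∈ smallHalfDisc) :
    polySeries 1 arcsinCoeff (sinHalf t)
      = -Complex.I * (polylog 2 (Complex.I * t) - polylog 2 (-Complex.I * t)) := by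
  rw [← sub_eq_zero]
  refine convex_smallHalfDisc.eq_of_hasDerivAt_zero_of_tendsto isOpen_smallHalfDisc
    (f := fun t => polySeries 1 arcsinCoeff (sinHalf t)
      - -Complex.I * (polylog 2 (Complex.I * t) - polylog 2 (-Complex.I * t))) ?_
    (l := 𝓝[smallHalfDisc] 0) self_mem_nhdsWithin ?_ ht
  · intro t ht
    obtain ⟨h1, h2, h0⟩ := mem_smallHalfDisc ht
    refine (hasDerivAt_polySeries_sinHalf 0 ht).sub
      (((hasDerivAt_polylog_const_mul 1 (norm_I_mul_lt h2) Complex.I_ne_zero h0).sub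
      (hasDerivAt_polylog_const_mul 1 (norm_neg_I_mul_lt h2) (neg_ne_zero.mpr Complex.I_ne_zero)
        h0)).const_mul (-Complex.I)) |>.congr_deriv ?_
    rw [polySeries_zero_arcsinCoeff ht, polylog_one (norm_I_mul_lt h2),
      polylog_one (norm_neg_I_mul_lt h2)]
    ring
  · refine (ContinuousAt.tendsto_of_eq ((continuousAt_polySeries_sinHalf 0).sub
      (((continuousAt_polylog_const_mul 1 Complex.I).sub
        (continuousAt_polylog_const_mul 1 (-Complex.I))).const_mul (-Complex.I))) ?_).mono_left
      nhdsWithin_le_nhds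
    simp [sinHalf, polySeries_zero]

/-- Integrate the weight-two function against dt/t - d log(1+t²). The first part gives Li_3. In the
second, log(1+t²) is the sum of the logarithms of 1 - it and 1 + it, so integration by parts leaves
a difference of squared logarithms over t, which integrates to S_{1,2}. -/
theorem polySeries_two_arcsinCoeff (ht : t ∈ smallHalfDisc) :
    polySeries 2 arcsinCoeff (sinHalf t)
      = -Complex.I * (polylog 3 (Complex.I * t) - polylog 3 (-Complex.I * t))
        + 2 * Complex.I * (nielsenS12 (Complex.I * t) - nielsenS12 (-Complex.I * t))
        + Complex.I * ((Complex.log (1 - Complex.I * t) + Complex.log (1 - -Complex.I * t))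
          * (polylog 2 (Complex.I * t) - polylog 2 (-Complex.I * t))) := by
  rw [← sub_eq_zero]
  refine convex_smallHalfDisc.eq_of_hasDerivAt_zero_of_tendsto isOpen_smallHalfDisc
    (f := fun t => polySeries 2 arcsinCoeff (sinHalf t)
      - (-Complex.I * (polylog 3 (Complex.I * t) - polylog 3 (-Complex.I * t))
        + 2 * Complex.I * (nielsenS12 (Complex.I * t) - nielsenS12 (-Complex.I * t))
        + Complex.I * ((Complex.log (1 - Complex.I * t) + Complex.log (1 - -Complex.I * t))
          * (polylog 2 (Complex.I * t) - polylog 2 (-Complex.I * t))))) ?_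
    (l := 𝓝[smallHalfDisc] 0) self_mem_nhdsWithin ?_ ht
  · intro t ht
    obtain ⟨h1, h2, h0⟩ := mem_smallHalfDisc ht
    have i0 := Complex.I_ne_zero
    have i0' := neg_ne_zero.mpr i0
    have hi := norm_I_mul_lt h2
    have hi' := norm_neg_I_mul_lt h2
    have l1 := hasDerivAt_log_one_sub_const_mul hi
    have l2 := hasDerivAt_log_one_sub_const_mul hi'
    have p1 := hasDerivAt_polylog_const_mul 1 hi i0 h0
    have p2 := hasDerivAt_polylog_const_mul 1 hi' i0' h0
    refine (hasDerivAt_polySeries_sinHalf 1 ht).sub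
      (((((hasDerivAt_polylog_const_mul 2 hi i0 h0).sub
      (hasDerivAt_polylog_const_mul 2 hi' i0' h0)).const_mul (-Complex.I)).add
      (((hasDerivAt_nielsenS12_const_mul hi i0 h0).sub
      (hasDerivAt_nielsenS12_const_mul hi' i0' h0)).const_mul (2 * Complex.I))).add
      (((l1.add l2).mul (p1.sub p2)).const_mul Complex.I)) |>.congr_deriv ?_
    rw [polySeries_one_arcsinCoeff ht, polylog_one hi, polylog_one hi']
    have hB := one_add_sq_ne_zero h2
    have hA := one_sub_ne_zero hi
    have hA' := one_sub_ne_zero hi'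
    have e1 : -Complex.I / (1 - Complex.I * t) + - -Complex.I / (1 - -Complex.I * t)
        = 2 * t / (1 + t ^ 2) := by
      rw [one_add_sq_factor, div_add_div _ _ hA hA']
      congr 1
      linear_combination (-2 * t) * Complex.I_sq
    have e2 : (1 - t ^ 2) / (1 + t ^ 2) / t = 1 / t - 2 * t / (1 + t ^ 2) := by
      generalize hBd : 1 + t ^ 2 = B at *
      field_simp
      linear_combination hBd
    simp only [Pi.add_apply, Pi.sub_apply]
    rw [e1, mul_div_assoc, e2]
    ring
  · have hl : ∀ e : ℂ, ContinuousAt (fun t => Complex.log (1 - e * t)) 0 := fun e =>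
      ContinuousAt.clog (by fun_prop) (by simp)
    have hn : ∀ e : ℂ, ContinuousAt (fun t => nielsenS12 (e * t)) 0 := fun e =>
      ContinuousAt.comp (g := nielsenS12) (continuousAt_nielsenS12 (by simp)) (by fun_prop)
    refine (ContinuousAt.tendsto_of_eq ((continuousAt_polySeries_sinHalf 1).sub
      (((((continuousAt_polylog_const_mul 2 Complex.I).sub
        (continuousAt_polylog_const_mul 2 (-Complex.I))).const_mul (-Complex.I)).add
      (((hn Complex.I).sub (hn (-Complex.I))).const_mul (2 * Complex.I))).add
      ((((hl Complex.I).add (hl (-Complex.I))).mul ((continuousAt_polylog_const_mul 1 Complex.I).sub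
        (continuousAt_polylog_const_mul 1 (-Complex.I)))).const_mul Complex.I))) ?_).mono_left
      nhdsWithin_le_nhds
    simp [sinHalf, polySeries_zero]

end

/-! ### The special point v with v² = i(2 - √3) -/

/-- The square root of `i (2 - √3)` in the right half plane. -/
def baseRoot : ℂ := ((Real.sqrt 3 - 1) / 2 : ℝ) * (1 + Complex.I)

theorem sqrt_three_bounds : 1.73 < Real.sqrt 3 ∧ Real.sqrt 3 < 1.74 :=
  ⟨Real.lt_sqrt_of_sq_lt (by norm_num), (Real.sqrt_lt' (by norm_num)).mpr (by norm_num)⟩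

theorem real_sqrt_three_sq : Real.sqrt 3 ^ 2 = 3 := Real.sq_sqrt (by norm_num)

theorem real_sqrt_two_sq : Real.sqrt 2 ^ 2 = 2 := Real.sq_sqrt (by norm_num)

theorem baseRoot_re : baseRoot.re = (Real.sqrt 3 - 1) / 2 := by simp [baseRoot]

theorem baseRoot_im : baseRoot.im = (Real.sqrt 3 - 1) / 2 := by simp [baseRoot]

theorem baseRoot_mem_quarterDisc : baseRoot ∈ quarterDisc := by
  have h := sqrt_three_bounds
  refine ⟨⟨?_, ?_⟩, ?_⟩
  · rw [← sq_lt_one_iff₀ (norm_nonneg _), ← Complex.normSq_eq_norm_sq, Complex.normSq_apply,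
      baseRoot_re, baseRoot_im]
    nlinarith
  · rw [baseRoot_re]; linarith
  · change baseRoot.re < 1 / 2
    rw [baseRoot_re]; linarith

theorem baseRoot_sq : baseRoot ^ 2 = Complex.I * ((2 - Real.sqrt 3 : ℝ) : ℂ) := by
  rw [baseRoot]
  push_cast
  linear_combination (Complex.I / 2) * sqrt_three_sq
    + ((Real.sqrt 3 - 1 : ℂ) ^ 2 / 4) * Complex.I_sq

theorem log_sqrt_two : Real.log (Real.sqrt 2) = Real.log 2 / 2 := Real.log_sqrt (by norm_num)

theorem log_of_sq_eq {x y : ℝ} (h : x ^ 2 = y) : Real.log x = Real.log y / 2 := by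
  rw [← h, Real.log_pow]; push_cast; ring

theorem sqrt_three_sub_one_sq : (Real.sqrt 3 - 1) ^ 2 = 2 * (2 - Real.sqrt 3) := by
  linear_combination real_sqrt_three_sq

theorem log_sqrt_three_sub_one :
    Real.log (Real.sqrt 3 - 1) = (Real.log 2 + Real.log (2 - Real.sqrt 3)) / 2 := by
  have h := sqrt_three_bounds
  rw [log_of_sq_eq sqrt_three_sub_one_sq, Real.log_mul (by norm_num) (by linarith)]

theorem log_two_add_sqrt_three : Real.log (2 + Real.sqrt 3) = -Real.log (2 - Real.sqrt 3) := by
  rw [← Real.log_inv]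
  congr 1
  have h := sqrt_three_bounds
  refine eq_inv_of_mul_eq_one_left ?_
  linear_combination -real_sqrt_three_sq

theorem log_baseRoot :
    Complex.log baseRoot
      = (Real.log (2 - Real.sqrt 3) / 2 : ℝ) + (Real.pi / 4 : ℝ) * Complex.I := by
  have h := sqrt_three_bounds
  have hs := real_sqrt_two_sq
  have hp := Real.pi_pos
  have e : baseRoot = ((Real.sqrt 2 * (Real.sqrt 3 - 1) / 2 : ℝ) : ℂ)
      * Complex.exp ((Real.pi / 4 : ℝ) * Complex.I) := by
    apply Complex.ext
    · rw [Complex.re_ofReal_mul, Complex.exp_ofReal_mul_I_re, Real.cos_pi_div_four, baseRoot_re]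
      linear_combination -(Real.sqrt 3 - 1) / 4 * hs
    · rw [Complex.im_ofReal_mul, Complex.exp_ofReal_mul_I_im, Real.sin_pi_div_four, baseRoot_im]
      linear_combination -(Real.sqrt 3 - 1) / 4 * hs
  have h2 : (0 : ℝ) < Real.sqrt 2 := by positivity
  rw [e, log_real_mul_exp (div_pos (mul_pos h2 (by linarith)) two_pos) (by linarith) (by linarith),
    log_of_sq_eq (y := 2 - Real.sqrt 3)]
  linear_combination (Real.sqrt 3 - 1) ^ 2 / 4 * hs + sqrt_three_sub_one_sq / 2

theorem one_add_baseRoot : 1 + baseRoot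
    = (Real.sqrt 2 : ℝ) * Complex.exp ((Real.pi / 12 : ℝ) * Complex.I) := by
  have hs := real_sqrt_two_sq
  have e : Real.pi / 12 = Real.pi / 3 - Real.pi / 4 := by ring
  rw [e]
  apply Complex.ext
  · rw [Complex.re_ofReal_mul, Complex.exp_ofReal_mul_I_re, Real.cos_sub, Real.cos_pi_div_four,
      Real.sin_pi_div_four, Real.cos_pi_div_three, Real.sin_pi_div_three, Complex.add_re,
      baseRoot_re, Complex.one_re]
    linear_combination -(Real.sqrt 3 + 1) / 4 * hs
  · rw [Complex.im_ofReal_mul, Complex.exp_ofReal_mul_I_im, Real.sin_sub, Real.cos_pi_div_four,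
      Real.sin_pi_div_four, Real.cos_pi_div_three, Real.sin_pi_div_three, Complex.add_im,
      baseRoot_im, Complex.one_im]
    linear_combination -(Real.sqrt 3 - 1) / 4 * hs

theorem one_sub_baseRoot : 1 - baseRoot
    = (Real.sqrt 3 - 1 : ℝ) * Complex.exp ((-(Real.pi / 6) : ℝ) * Complex.I) := by
  have hs := real_sqrt_three_sq
  apply Complex.ext
  · rw [Complex.re_ofReal_mul, Complex.exp_ofReal_mul_I_re, Real.cos_neg, Real.cos_pi_div_six,
      Complex.sub_re, baseRoot_re, Complex.one_re]
    linear_combination -hs / 2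
  · rw [Complex.im_ofReal_mul, Complex.exp_ofReal_mul_I_im, Real.sin_neg, Real.sin_pi_div_six,
      Complex.sub_im, baseRoot_im, Complex.one_im]
    ring

theorem log_one_add_baseRoot : Complex.log (1 + baseRoot)
    = (Real.log 2 / 2 : ℝ) + (Real.pi / 12 : ℝ) * Complex.I := by
  have hp := Real.pi_pos
  rw [one_add_baseRoot, log_real_mul_exp (by positivity) (by linarith) (by linarith), log_sqrt_two]

theorem log_one_sub_baseRoot : Complex.log (1 - baseRoot)
    = ((Real.log 2 + Real.log (2 - Real.sqrt 3)) / 2 : ℝ) + (-(Real.pi / 6) : ℝ) * Complex.I := by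
  have hp := Real.pi_pos
  have h := sqrt_three_bounds
  rw [one_sub_baseRoot, log_real_mul_exp (by linarith) (by linarith) (by linarith),
    log_sqrt_three_sub_one]

theorem one_add_baseRoot_ne_zero : 1 + baseRoot ≠ 0 :=
  one_add_ne_zero baseRoot_mem_quarterDisc.1.1

/-- The equation (1-v)/(1+v) = v̄ says |1+v|² = 2. It lets every polylogarithm at ±(1-v)/(1+v) be
replaced by a conjugate of its value at ±v. -/
theorem cayley_baseRoot : cayley baseRoot = starRingEnd ℂ baseRoot := by
  rw [cayley, div_eq_iff one_add_baseRoot_ne_zero]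
  have hs := real_sqrt_three_sq
  apply Complex.ext
  · rw [Complex.mul_re, Complex.conj_re, Complex.conj_im, Complex.add_re, Complex.add_im,
      Complex.sub_re, baseRoot_re, baseRoot_im, Complex.one_re, Complex.one_im]
    linear_combination -hs / 2
  · rw [Complex.mul_im, Complex.conj_re, Complex.conj_im, Complex.add_re, Complex.add_im,
      Complex.sub_im, baseRoot_re, baseRoot_im, Complex.one_re, Complex.one_im]
    ring

/-- In the five-term relation take x = v, y = v̄. Then xy = 2 - √3 and 1 - xy = √3 - 1 = |1-v|, so
the last two arguments are 1 - e^{-iπ/6} and its conjugate, on the circle treated above. The right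
side is the squared modulus of -iπ/6. -/
theorem polylog_two_baseRoot_re :
    2 * (polylog 2 baseRoot).re
      = (polylog 2 ((2 - Real.sqrt 3 : ℝ) : ℂ)).re + Real.pi ^ 2 / 24 := by
  have h := sqrt_three_bounds
  have hp := Real.pi_pos
  have hn : Complex.normSq (1 + Complex.I) = 2 := by simp [Complex.normSq_apply]; norm_num
  have hn' : Complex.normSq (1 - Complex.I) = 2 := by simp [Complex.normSq_apply]; norm_num
  have key := polylog_two_conj_pair (k := (Real.sqrt 3 - 1) / 2) ⟨by linarith, by linarith⟩ hn
    (by simp) hn' (by simp) (by linear_combination -Complex.I_sq)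
  have e1 : (((Real.sqrt 3 - 1) / 2 : ℝ) : ℂ) * (1 + Complex.I) = baseRoot := rfl
  have e2 : (((Real.sqrt 3 - 1) / 2 : ℝ) : ℂ) * (1 - Complex.I) = starRingEnd ℂ baseRoot := by
    rw [baseRoot, map_mul, Complex.conj_ofReal, map_add, map_one, Complex.conj_I, ← sub_eq_add_neg]
  have e3 : (2 : ℂ) * (((Real.sqrt 3 - 1) / 2 : ℝ) : ℂ) ^ 2 = ((2 - Real.sqrt 3 : ℝ) : ℂ) := by
    push_cast
    linear_combination sqrt_three_sq / 2
  have e4 : (1 : ℂ) - ((2 - Real.sqrt 3 : ℝ) : ℂ) = ((Real.sqrt 3 - 1 : ℝ) : ℂ) := by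
    push_cast; ring
  have e5 : (1 : ℂ) - (1 - baseRoot) / ((Real.sqrt 3 - 1 : ℝ) : ℂ)
      = 1 - Complex.exp (-((Real.pi / 6 : ℝ) * Complex.I)) := by
    have : ((Real.sqrt 3 - 1 : ℝ) : ℂ) ≠ 0 := by
      exact_mod_cast (by linarith : Real.sqrt 3 - 1 ≠ 0)
    rw [one_sub_baseRoot, mul_div_cancel_left₀ _ this, Complex.ofReal_neg, neg_mul]
  have e6 : (1 : ℂ) - (1 - starRingEnd ℂ baseRoot) / ((Real.sqrt 3 - 1 : ℝ) : ℂ)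
      = starRingEnd ℂ (1 - Complex.exp (-((Real.pi / 6 : ℝ) * Complex.I))) := by
    rw [← e5]; simp
  have e7 : Complex.log (1 - starRingEnd ℂ baseRoot)
      = starRingEnd ℂ (Complex.log (1 - baseRoot)) := by
    rw [← Complex.log_conj _
      (Complex.slitPlane_arg_ne_pi (one_sub_mem_slitPlane baseRoot_mem_quarterDisc.1.1))]
    simp
  have e8 : Complex.log ((Real.sqrt 3 - 1 : ℝ) : ℂ)
      = (((Real.log 2 + Real.log (2 - Real.sqrt 3)) / 2 : ℝ) : ℂ) := by
    rw [← Complex.ofReal_log (by linarith), log_sqrt_three_sub_one]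
  rw [e1, e2, e3, e4, e5, e6, e7, e8, polylog_conj, polylog_conj, log_one_sub_baseRoot] at key
  have key' := congrArg Complex.re key
  have h6 := polylog_two_one_sub_exp_re (θ := Real.pi / 6) (by linarith) (by linarith)
  simp only [Complex.sub_re (_ - _), Complex.sub_re (_ + _), Complex.add_re (polylog _ _),
    Complex.conj_re, h6, map_add, map_mul, Complex.conj_ofReal, Complex.conj_I] at key'
  rw [add_sub_cancel_left, add_sub_cancel_left] at key'
  have e9 : ((-(Real.pi / 6) : ℝ) : ℂ) * Complex.I * (((-(Real.pi / 6) : ℝ) : ℂ) * -Complex.I)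
      = (((Real.pi / 6) ^ 2 : ℝ) : ℂ) := by
    push_cast
    linear_combination (-(Real.pi / 6 : ℂ) ^ 2) * Complex.I_sq
  rw [e9, Complex.ofReal_re] at key'
  linear_combination key'

theorem log_cayley_baseRoot : Complex.log (1 - baseRoot) - Complex.log (1 + baseRoot)
    = (Real.log (2 - Real.sqrt 3) / 2 : ℝ) + (-(Real.pi / 4) : ℝ) * Complex.I := by
  rw [log_one_add_baseRoot, log_one_sub_baseRoot]
  push_cast
  ring

/-- The Cayley image is conjugate to v, so the real part of the reflection formula contains the
desired difference twice. -/
theorem polylog_two_odd_baseRoot_re :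
    (polylog 2 baseRoot).re - (polylog 2 (-baseRoot)).re
      = Real.pi ^ 2 / 8 - ((Real.log (2 - Real.sqrt 3) / 2) ^ 2 + (Real.pi / 4) ^ 2) / 2 := by
  have h := polylog_two_odd_add_cayley baseRoot_mem_quarterDisc.1
  rw [cayley_baseRoot, ← map_neg, polylog_conj, polylog_conj, log_cayley_baseRoot,
    log_baseRoot] at h
  have h' := congrArg Complex.re h
  have e : ((Real.pi : ℂ) ^ 2 / 4).re = Real.pi ^ 2 / 4 := by
    rw [show (Real.pi : ℂ) ^ 2 / 4 = ((Real.pi ^ 2 / 4 : ℝ) : ℂ) by push_cast; ring,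
      Complex.ofReal_re]
  rw [e] at h'
  simp only [Complex.add_re, Complex.sub_re, Complex.conj_re, Complex.mul_re, Complex.add_im,
    Complex.mul_im, Complex.ofReal_re, Complex.ofReal_im, Complex.I_re, Complex.I_im] at h'
  linear_combination h' / 2

theorem nielsenS12_conj (z : ℂ) :
    nielsenS12 (starRingEnd ℂ z) = starRingEnd ℂ (nielsenS12 z) := by
  rw [nielsenS12, polySeries, polySeries, Complex.conj_tsum]
  simp [mplTrunc]

/-! ### The trilogarithm relation at φ = π/4 -/

theorem secCurve_pi_div_four (m δ : ℝ) : secCurve m δ (Real.pi / 4)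
    = (Real.sqrt 2 / 2 : ℝ) * Complex.exp ((m * (Real.pi / 4) + δ : ℝ) * Complex.I) := by
  have h2 : ((Real.sqrt 2 : ℝ) : ℂ) ≠ 0 := by simp
  have hs : ((Real.sqrt 2 : ℝ) : ℂ) ^ 2 = 2 := by exact_mod_cast real_sqrt_two_sq
  rw [secCurve, Real.cos_pi_div_four, mul_div_cancel₀ _ (two_ne_zero' ℝ), div_eq_iff h2]
  push_cast
  linear_combination -Complex.exp ((m * (Real.pi / 4) + δ) * Complex.I) / 2 * hs

theorem secCurve_pi_div_four_re (m δ : ℝ) : (secCurve m δ (Real.pi / 4)).re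
    = Real.sqrt 2 / 2 * Real.cos (m * (Real.pi / 4) + δ) := by
  rw [secCurve_pi_div_four, Complex.re_ofReal_mul, Complex.exp_ofReal_mul_I_re]

theorem secCurve_pi_div_four_im (m δ : ℝ) : (secCurve m δ (Real.pi / 4)).im
    = Real.sqrt 2 / 2 * Real.sin (m * (Real.pi / 4) + δ) := by
  rw [secCurve_pi_div_four, Complex.im_ofReal_mul, Complex.exp_ofReal_mul_I_im]

theorem secCurve_one_zero : secCurve 1 0 (Real.pi / 4) = (Complex.I + 1) / 2 := by
  have hs := real_sqrt_two_sq
  apply Complex.ext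
  · rw [secCurve_pi_div_four_re, one_mul, add_zero, Real.cos_pi_div_four]
    simp
    linear_combination hs / 4
  · rw [secCurve_pi_div_four_im, one_mul, add_zero, Real.sin_pi_div_four]
    simp
    linear_combination hs / 4

theorem secCurve_three_pi :
    secCurve 3 Real.pi (Real.pi / 4) = starRingEnd ℂ ((Complex.I + 1) / 2) := by
  have hs := real_sqrt_two_sq
  have e : 3 * (Real.pi / 4) + Real.pi = -(Real.pi / 4) + 2 * Real.pi := by ring
  apply Complex.ext
  · rw [secCurve_pi_div_four_re, e, Real.cos_add_two_pi, Real.cos_neg, Real.cos_pi_div_four,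
      Complex.conj_re]
    simp
    linear_combination hs / 4
  · rw [secCurve_pi_div_four_im, e, Real.sin_add_two_pi, Real.sin_neg, Real.sin_pi_div_four,
      Complex.conj_im]
    simp
    linear_combination hs / 4

theorem secCurve_one_neg_pi_div_three :
    secCurve 1 (-(Real.pi / 3)) (Real.pi / 4) = (1 + baseRoot)⁻¹ := by
  have e : 1 * (Real.pi / 4) + -(Real.pi / 3) = -(Real.pi / 12) := by ring
  have hs : ((Real.sqrt 2 : ℝ) : ℂ) ^ 2 = 2 := by exact_mod_cast real_sqrt_two_sq
  refine eq_inv_of_mul_eq_one_left ?_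
  rw [secCurve_pi_div_four, one_add_baseRoot, mul_mul_mul_comm, ← Complex.exp_add, e]
  push_cast
  rw [show -((Real.pi : ℂ) / 12) * Complex.I + Real.pi / 12 * Complex.I = 0 by ring,
    Complex.exp_zero]
  linear_combination hs / 2

theorem secCurve_one_pi_div_three : secCurve 1 (Real.pi / 3) (Real.pi / 4)
    = starRingEnd ℂ (baseRoot / (baseRoot - 1)) := by
  have hv : 1 - baseRoot ≠ 0 := one_sub_ne_zero baseRoot_mem_quarterDisc.1.1
  have hs := real_sqrt_two_sq
  have ht := real_sqrt_three_sq
  have h1 : starRingEnd ℂ (baseRoot - 1) ≠ 0 := by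
    exact (map_ne_zero _).mpr (sub_ne_zero.mpr (sub_ne_zero.mp hv).symm)
  rw [map_div₀, eq_div_iff h1]
  apply Complex.ext
  · rw [Complex.mul_re, secCurve_pi_div_four_re, secCurve_pi_div_four_im, one_mul, Real.cos_add,
      Real.sin_add, Real.cos_pi_div_four, Real.sin_pi_div_four, Real.cos_pi_div_three,
      Real.sin_pi_div_three, Complex.conj_re, Complex.conj_re, Complex.conj_im, Complex.sub_re,
      Complex.sub_im, baseRoot_re, baseRoot_im, Complex.one_re, Complex.one_im]
    generalize Real.sqrt 3 = r at *
    generalize Real.sqrt 2 = q at *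
    linear_combination
      ((1 - r) / 8 * ((r - 3) / 2) + (1 + r) / 8 * ((r - 1) / 2)) * hs
  · rw [Complex.mul_im, secCurve_pi_div_four_re, secCurve_pi_div_four_im, one_mul, Real.cos_add,
      Real.sin_add, Real.cos_pi_div_four, Real.sin_pi_div_four, Real.cos_pi_div_three,
      Real.sin_pi_div_three, Complex.conj_re, Complex.conj_im, Complex.conj_im, Complex.sub_re,
      Complex.sub_im, baseRoot_re, baseRoot_im, Complex.one_re, Complex.one_im]
    generalize Real.sqrt 3 = r at *
    generalize Real.sqrt 2 = q at *
    linear_combination ((1 + r) / 8 * ((r - 3) / 2) - (1 - r) / 8 * ((r - 1) / 2)) * hs + ht / 4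

/-- At φ = π/4 two of the four arguments are (1+i)/2 and its conjugate, contributing 2𝒢 and -𝒢; the
other two are 1/(1+v) and the conjugate of v/(v-1), whence the opposite signs. -/
theorem polylog_three_baseRoot_im :
    3 * ((polylog 3 (baseRoot / (baseRoot - 1))).im - (polylog 3 (1 + baseRoot)⁻¹).im)
      = -catalanLike + Real.pi * Real.log 2 ^ 2 / 32 - 3 * Real.pi ^ 3 / 128 := by
  have hp := Real.pi_pos
  have h := im_polylog_three_secCurve (φ := Real.pi / 4) ⟨by linarith, by linarith⟩
  rw [secCurve_one_zero, secCurve_three_pi, secCurve_one_neg_pi_div_three,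
    secCurve_one_pi_div_three, polylog_conj, polylog_conj, Complex.conj_im, Complex.conj_im,
    ← catalanLike, Real.cos_pi_div_four, mul_div_cancel₀ _ (two_ne_zero' ℝ), log_sqrt_two] at h
  linear_combination h

/-! ### Assembly of the closed form -/

theorem log_one_sub_add_log_one_add :
    Complex.log (1 - Complex.I * ((2 - Real.sqrt 3 : ℝ) : ℂ))
      + Complex.log (1 - -Complex.I * ((2 - Real.sqrt 3 : ℝ) : ℂ))
      = ((2 * Real.log 2 + Real.log (2 - Real.sqrt 3) : ℝ) : ℂ) := by
  have h := sqrt_three_bounds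
  have hn : ‖Complex.I * ((2 - Real.sqrt 3 : ℝ) : ℂ)‖ < 1 := by
    rw [norm_mul, Complex.norm_I, one_mul, Complex.norm_real, Real.norm_eq_abs,
      abs_of_pos (by linarith)]
    linarith
  rw [neg_mul, sub_neg_eq_add, ← log_one_sub_sq hn]
  -- With T = 2 - √3 one has 1 + T² = 4T.
  have e : 1 - (Complex.I * ((2 - Real.sqrt 3 : ℝ) : ℂ)) ^ 2
      = ((2 ^ 2 * (2 - Real.sqrt 3) : ℝ) : ℂ) := by
    push_cast
    linear_combination (-(2 - Real.sqrt 3 : ℂ) ^ 2) * Complex.I_sq + sqrt_three_sq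
  rw [e, ← Complex.ofReal_log (by nlinarith), Real.log_mul (by norm_num) (by linarith),
    Real.log_pow]
  push_cast
  ring

theorem polySeries_two_arcsinCoeff_half :
    polySeries 2 arcsinCoeff (1 / 2)
      = Complex.I * (((2 * Real.log 2 + Real.log (2 - Real.sqrt 3) : ℝ) : ℂ)
          * (polylog 2 (Complex.I * ((2 - Real.sqrt 3 : ℝ) : ℂ))
            - polylog 2 (-Complex.I * ((2 - Real.sqrt 3 : ℝ) : ℂ)))
        - (polylog 3 (Complex.I * ((2 - Real.sqrt 3 : ℝ) : ℂ))
          - polylog 3 (-Complex.I * ((2 - Real.sqrt 3 : ℝ) : ℂ)))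
        + 2 * (nielsenS12 (Complex.I * ((2 - Real.sqrt 3 : ℝ) : ℂ))
          - nielsenS12 (-Complex.I * ((2 - Real.sqrt 3 : ℝ) : ℂ)))) := by
  have h := sqrt_three_bounds
  have hT : ((2 - Real.sqrt 3 : ℝ) : ℂ) ∈ smallHalfDisc := by
    refine ⟨?_, ?_⟩
    · rw [Metric.mem_ball, dist_zero_right, Complex.norm_real, Real.norm_eq_abs,
        abs_of_pos (by linarith)]
      linarith
    · change 0 < Complex.re _
      rw [Complex.ofReal_re]
      linarith
  have hs : sinHalf ((2 - Real.sqrt 3 : ℝ) : ℂ) = 1 / 2 := by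
    have e : (1 : ℂ) + ((2 - Real.sqrt 3 : ℝ) : ℂ) ^ 2 = 4 * ((2 - Real.sqrt 3 : ℝ) : ℂ) := by
      push_cast
      linear_combination sqrt_three_sq
    have h0 : ((2 - Real.sqrt 3 : ℝ) : ℂ) ≠ 0 := by
      exact_mod_cast (by linarith : 2 - Real.sqrt 3 ≠ 0)
    rw [sinHalf, e]
    field_simp
    norm_num
  have key := polySeries_two_arcsinCoeff hT
  rw [log_one_sub_add_log_one_add, hs] at key
  rw [key]
  ring

/-- The points ±i(2 - √3) are v² and its conjugate, so every difference is 2i times an imaginary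
part. -/
theorem two_mul_polySeries_arcsinCoeff_half :
    2 * polySeries 2 arcsinCoeff (1 / 2)
      = ((4 * (polylog 3 (baseRoot ^ 2)).im - 8 * (nielsenS12 (baseRoot ^ 2)).im
        - 4 * (2 * Real.log 2 + Real.log (2 - Real.sqrt 3)) * (polylog 2 (baseRoot ^ 2)).im : ℝ)
          : ℂ) := by
  have key := polySeries_two_arcsinCoeff_half
  have hc : -Complex.I * ((2 - Real.sqrt 3 : ℝ) : ℂ) = starRingEnd ℂ (baseRoot ^ 2) := by
    rw [baseRoot_sq, map_mul, Complex.conj_I, Complex.conj_ofReal]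
  rw [hc, ← baseRoot_sq, polylog_conj, polylog_conj,
    nielsenS12_conj, Complex.sub_conj, Complex.sub_conj, Complex.sub_conj] at key
  rw [key]
  push_cast
  linear_combination (-4 * (polylog 3 (baseRoot ^ 2)).im + 8 * (nielsenS12 (baseRoot ^ 2)).im
    + 4 * (2 * Real.log 2 + Real.log (2 - Real.sqrt 3 : ℝ)) * (polylog 2 (baseRoot ^ 2)).im : ℂ)
      * Complex.I_sq

/-- The imaginary part of the polarisation formula, with S_{1,2}(±v) rewritten by the Landen-type
formulas and all logarithms evaluated at v. -/
theorem nielsenS12_baseRoot_sq_im :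
    (nielsenS12 (baseRoot ^ 2)).im
      = 4 * ((polylog 3 (baseRoot / (baseRoot - 1))).im - (polylog 3 (1 + baseRoot)⁻¹).im)
        + 2 * (polylog 3 baseRoot).im + 2 * (polylog 3 (-baseRoot)).im
        - (2 * Real.log 2 + Real.log (2 - Real.sqrt 3))
          * ((polylog 2 baseRoot).im + (polylog 2 (-baseRoot)).im)
        + Real.pi / 6 * (7 * (polylog 2 baseRoot).re - 5 * (polylog 2 (-baseRoot)).re)
        + Real.pi * Real.log 2 * Real.log (2 - Real.sqrt 3) / 12
        + 7 * Real.pi * Real.log (2 - Real.sqrt 3) ^ 2 / 48 - 23 * Real.pi ^ 3 / 576 := by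
  have hv := baseRoot_mem_quarterDisc
  have h := nielsenS12_sq hv.1
  rw [nielsenS12_eq_polylog_div_sub_one hv, nielsenS12_neg hv.1, polylog_two_inv_one_add hv.1,
    cayley_baseRoot, ← map_neg, polylog_conj, polylog_conj, polylog_conj, polylog_conj,
    log_cayley_baseRoot, log_one_sub_baseRoot, log_one_add_baseRoot, log_baseRoot] at h
  have h1 : (polylog 3 1).im = 0 := by simpa using polylog_ofReal_im 3 1
  have h2 : (polylog 3 (-1)).im = 0 := by simpa using polylog_ofReal_im 3 (-1)
  generalize nielsenS12 (baseRoot ^ 2) = N at h ⊢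
  have h' := congrArg Complex.im h
  simp only [pow_succ, pow_zero, one_mul, Complex.add_re, Complex.sub_re, Complex.conj_re,
    Complex.mul_re, Complex.add_im, Complex.sub_im, Complex.conj_im, Complex.div_ofNat_re,
    Complex.div_ofNat_im, Complex.re_ofNat, Complex.im_ofNat,
    Complex.mul_im, Complex.ofReal_re, Complex.ofReal_im, Complex.I_re, Complex.I_im, h1, h2] at h'
  linear_combination h'

theorem hasSum_closed_form :
    HasSum (fun n : ℕ => 1 / ((2 * (n : ℂ) + 1) ^ 3 * (Nat.choose (2 * n) n : ℂ)))
      (32 * (catalanLike : ℂ) / 3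
        - 4 * (Real.pi : ℂ) * polylog 2 ((2 - Real.sqrt 3 : ℝ) : ℂ) / 3
        - (Real.pi : ℂ) ^ 3 / 9
        - (Real.pi : ℂ) * ((Real.log 2 - Real.log (2 + Real.sqrt 3) : ℝ) : ℂ) ^ 2 / 3) := by
  have hn : ‖baseRoot‖ ≤ 1 := baseRoot_mem_quarterDisc.1.1.le
  have h3 : (polylog 3 (baseRoot ^ 2)).im
      = 4 * ((polylog 3 baseRoot).im + (polylog 3 (-baseRoot)).im) := by
    have := congrArg Complex.im (polylog_sq 1 hn)
    rw [this]
    norm_num [Complex.mul_im]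
  have h2 : (polylog 2 (baseRoot ^ 2)).im
      = 2 * ((polylog 2 baseRoot).im + (polylog 2 (-baseRoot)).im) := by
    have := congrArg Complex.im (polylog_sq 0 hn)
    rw [this]
    norm_num [Complex.mul_im]
  have hr : polylog 2 ((2 - Real.sqrt 3 : ℝ) : ℂ)
      = ((polylog 2 ((2 - Real.sqrt 3 : ℝ) : ℂ)).re : ℂ) :=
    Complex.ext rfl (polylog_ofReal_im 2 _)
  have key := hasSum_inv_centralBinom
  rw [two_mul_polySeries_arcsinCoeff_half] at key
  convert key using 1
  rw [hr, log_two_add_sqrt_three, h3, h2, nielsenS12_baseRoot_sq_im]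
  norm_cast
  push_cast
  have e1 := polylog_three_baseRoot_im
  have e2 := polylog_two_baseRoot_re
  have e3 := polylog_two_odd_baseRoot_re
  push_cast at e2
  -- The terms Im Li_3(±v) and Im Li_2(±v) have cancelled. Writing 7a - 5b = 2a + 5(a - b) for the
  -- real parts a, b of Li_2(v), Li_2(-v) explains the coefficients 4/3 and 20/3.
  linear_combination (32 / 3) * e1 + (20 / 3) * Real.pi * e3 + (4 / 3) * Real.pi * e2

/-! ### The stuffle product with a depth-one factor -/

/-- The sums occurring in the product of a truncated polylogarithm and a truncated multiple
polylogarithm. -/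
def stuffle (p : ℕ × ℂ) : List (ℕ × ℂ) → List (List (ℕ × ℂ))
  | [] => [[p]]
  | r :: l => (p :: r :: l) :: ((p.1 + r.1, p.2 * r.2) :: l) :: (stuffle p l).map (List.cons r)

theorem mplTrunc_zero (p : ℕ × ℂ) (l : List (ℕ × ℂ)) : mplTrunc (p :: l) 0 = 0 := by
  simp [mplTrunc]

theorem mplTrunc_succ (p : ℕ × ℂ) (l : List (ℕ × ℂ)) (M : ℕ) :
    mplTrunc (p :: l) (M + 1)
      = mplTrunc (p :: l) M + p.2 ^ (M + 1) / ((M + 1 : ℕ) : ℂ) ^ p.1 * mplTrunc l M := by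
  rw [mplTrunc, Finset.sum_range_succ, ← mplTrunc]

/-- The identity is exact at each truncation M. Its increment in M is the rule Δ(ab) = a Δb + b Δa +
Δa Δb, whose three terms are the three kinds of lists in `stuffle`. -/
theorem mplTrunc_singleton_mul (p : ℕ × ℂ) (l : List (ℕ × ℂ)) (M : ℕ) :
    mplTrunc [p] M * mplTrunc l M = ((stuffle p l).map fun t => mplTrunc t M).sum := by
  induction l generalizing M with
  | nil => simp [stuffle, mplTrunc]
  | cons r l ih =>
    induction M with
    | zero => simp [stuffle, mplTrunc_zero, Function.comp_def]
    | succ M ihM =>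
      have h := ih M
      simp only [stuffle, List.map_cons, List.sum_cons, List.map_map, Function.comp_def] at ihM ⊢
      simp only [mplTrunc_succ, List.sum_map_add, List.sum_map_mul_left]
      rw [← h, pow_add _ p.1 r.1, mul_pow p.2 r.2, ← div_mul_div_comm]
      rw [show mplTrunc [] M = 1 from rfl]
      linear_combination ihM

theorem forall_mem_stuffle {Q : ℕ × ℂ → Prop}
    (hQ : ∀ p r, Q p → Q r → Q (p.1 + r.1, p.2 * r.2)) {p : ℕ × ℂ} (hp : Q p)
    {l : List (ℕ × ℂ)} (hl : ∀ r ∈ l, Q r) : ∀ t ∈ stuffle p l, ∀ r ∈ t, Q r := by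
  induction l with
  | nil =>
    intro t ht r hr
    rw [stuffle, List.mem_singleton] at ht
    rw [ht, List.mem_singleton] at hr
    rwa [hr]
  | cons r l ih =>
    have hr : Q r := hl r (by simp)
    have hl' : ∀ x ∈ l, Q x := fun x hx => hl x (by simp [hx])
    intro t ht
    simp only [stuffle, List.mem_cons, List.mem_map] at ht
    rcases ht with rfl | rfl | ⟨u, hu, rfl⟩
    · simpa [hp, hr] using fun a b h => hl' (a, b) h
    · simpa [hQ p r hp hr] using fun a b h => hl' (a, b) h
    · simpa [hr] using fun a b h => ih hl' u hu (a, b) h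

theorem weight_of_mem_stuffle {p : ℕ × ℂ} {l : List (ℕ × ℂ)} :
    ∀ t ∈ stuffle p l, (t.map Prod.fst).sum = p.1 + (l.map Prod.fst).sum := by
  induction l with
  | nil => simp [stuffle]
  | cons r l ih =>
    intro t ht
    simp only [stuffle, List.mem_cons, List.mem_map] at ht
    rcases ht with rfl | rfl | ⟨u, hu, rfl⟩
    · simp
    · simp; ring
    · simp [ih u hu]; ring

/-- Admissibility survives because the new leading entry is one of the two old ones, or their
merger, whose exponent is at least two. -/
theorem IsCMZVIndex.stuffle {k N : ℕ} {p : ℕ × ℂ} (h0 : 0 < p.1) (hN : p.2 ^ N = 1)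
    (h1 : p ≠ (1, 1)) {l : List (ℕ × ℂ)} (hl : IsCMZVIndex k N l) :
    ∀ t ∈ stuffle p l, IsCMZVIndex (k + p.1) N t := by
  intro t ht
  refine ⟨forall_mem_stuffle (Q := fun p => 0 < p.1 ∧ p.2 ^ N = 1)
    (fun p r hp hr => ⟨by simpa using Or.inl hp.1, by simp [mul_pow, hp.2, hr.2]⟩) ⟨h0, hN⟩ hl.1 t ht,
    ?_, by rw [weight_of_mem_stuffle t ht, hl.2.2, add_comm]⟩
  cases l with
  | nil =>
    simp only [_root_.stuffle, List.mem_singleton] at ht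
    subst ht
    simpa using h1
  | cons r l =>
    have hr := (hl.1 r (by simp)).1
    have hr1 : r ≠ (1, 1) := by simpa using hl.2.1
    simp only [_root_.stuffle, List.mem_cons, List.mem_map] at ht
    rcases ht with rfl | rfl | ⟨u, hu, rfl⟩
    · simpa using h1
    · simp only [List.head?_cons, ne_eq, Option.some.injEq, Prod.mk.injEq, not_and]
      omega
    · simpa using hr1

/-! ### Convergence of admissible multiple polylogarithms -/

/-- The harmonic numbers, as real numbers. -/
def realHarmonic (n : ℕ) : ℝ := ∑ k ∈ Finset.range n, 1 / ((k : ℝ) + 1)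

theorem realHarmonic_nonneg (n : ℕ) : 0 ≤ realHarmonic n :=
  Finset.sum_nonneg fun _ _ => by positivity

theorem realHarmonic_mono : Monotone realHarmonic := fun _ _ h =>
  Finset.sum_le_sum_of_subset_of_nonneg (Finset.range_mono h) fun _ _ _ => by positivity

theorem norm_pow_div_natCast_pow_le {s : ℕ} (hs : 0 < s) {q : ℂ} (hq : ‖q‖ ≤ 1) (n : ℕ) :
    ‖q ^ (n + 1) / ((n + 1 : ℕ) : ℂ) ^ s‖ ≤ 1 / ((n : ℝ) + 1) := by
  rw [norm_div, norm_pow, norm_pow, Complex.norm_natCast]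
  push_cast
  have h1 : (1 : ℝ) ≤ (n : ℝ) + 1 := by linarith [n.cast_nonneg (α := ℝ)]
  gcongr
  · exact pow_le_one₀ (norm_nonneg _) hq
  · exact le_self_pow₀ h1 hs.ne'

/-- Each level of the nested sum costs at most one factor of the harmonic number. -/
theorem norm_mplTrunc_le {l : List (ℕ × ℂ)} (hl : ∀ p ∈ l, 0 < p.1 ∧ ‖p.2‖ ≤ 1) (n : ℕ) :
    ‖mplTrunc l n‖ ≤ (1 + realHarmonic n) ^ l.length := by
  induction l generalizing n with
  | nil => simp [mplTrunc]
  | cons p l ih =>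
    have ih' := ih fun x hx => hl x (by simp [hx])
    have hp := hl p (by simp)
    rw [mplTrunc]
    calc _ ≤ ∑ k ∈ Finset.range n, 1 / ((k : ℝ) + 1) * (1 + realHarmonic n) ^ l.length := by
          refine (norm_sum_le _ _).trans (Finset.sum_le_sum fun k hk => ?_)
          rw [norm_mul]
          refine mul_le_mul (norm_pow_div_natCast_pow_le hp.1 hp.2 k) ((ih' k).trans ?_)
            (norm_nonneg _) (by positivity)
          have := realHarmonic_nonneg k
          have := realHarmonic_mono (Finset.mem_range.mp hk).le
          gcongr
      _ = realHarmonic n * (1 + realHarmonic n) ^ l.length := by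
          rw [← Finset.sum_mul, realHarmonic]
      _ ≤ (1 + realHarmonic n) ^ (l.length + 1) := by
          have := realHarmonic_nonneg n
          rw [pow_succ']
          gcongr
          linarith

theorem realHarmonic_le_log (n : ℕ) : realHarmonic n ≤ 1 + Real.log ((n : ℝ) + 1) := by
  have h := harmonic_le_one_add_log n
  have e : ((harmonic n : ℚ) : ℝ) = realHarmonic n := by
    rw [harmonic, realHarmonic]
    push_cast
    simp
  rw [e] at h
  rcases n.eq_zero_or_pos with rfl | hn
  · simp [realHarmonic]
  · have : (0 : ℝ) < n := by exact_mod_cast hn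
    refine h.trans ?_
    gcongr
    linarith

theorem exists_one_add_realHarmonic_pow_le (d : ℕ) :
    ∃ C : ℝ, ∀ n : ℕ, (1 + realHarmonic n) ^ d ≤ C * ((n : ℝ) + 1) ^ (1 / 2 : ℝ) := by
  have hd : (0 : ℝ) < 2 * (d + 1) := by positivity
  -- Bound 1 + H_n by a multiple of (n+1)^ε with ε = 1/(2(d+1)), so that dε ≤ 1/2; using d + 1
  -- avoids dividing by zero when d = 0.
  refine ⟨(2 + 2 * (d + 1)) ^ d, fun n => ?_⟩
  have hn : (1 : ℝ) ≤ (n : ℝ) + 1 := by linarith [n.cast_nonneg (α := ℝ)]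
  have h0 : (0 : ℝ) ≤ (n : ℝ) + 1 := by linarith
  have hε : (0 : ℝ) < 1 / (2 * (d + 1)) := by positivity
  have h1 := Real.log_le_rpow_div h0 hε
  have h2 := Real.one_le_rpow hn hε.le
  have h3 : 1 + realHarmonic n ≤ (2 + 2 * (d + 1)) * ((n : ℝ) + 1) ^ (1 / (2 * (d + 1) : ℝ)) := by
    have := realHarmonic_le_log n
    rw [div_div_eq_mul_div, div_one] at h1
    linarith
  have hr := realHarmonic_nonneg n
  calc (1 + realHarmonic n) ^ d
      ≤ ((2 + 2 * (d + 1)) * ((n : ℝ) + 1) ^ (1 / (2 * (d + 1) : ℝ))) ^ d := by gcongr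
    _ = (2 + 2 * (d + 1)) ^ d * ((n : ℝ) + 1) ^ (1 / (2 * (d + 1) : ℝ) * d) := by
        rw [mul_pow, ← Real.rpow_mul_natCast h0]
    _ ≤ (2 + 2 * (d + 1)) ^ d * ((n : ℝ) + 1) ^ (1 / 2 : ℝ) := by
        gcongr
        rw [div_mul_eq_mul_div, div_le_div_iff₀ hd two_pos]
        linarith

theorem summable_one_add_realHarmonic_pow_div (d : ℕ) :
    Summable fun n : ℕ => (1 + realHarmonic n) ^ d / ((n : ℝ) + 1) ^ 2 := by
  obtain ⟨C, hC⟩ := exists_one_add_realHarmonic_pow_le d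
  have hs : Summable fun n : ℕ => C * ((n : ℝ) + 1) ^ (-(3 / 2) : ℝ) := by
    refine Summable.mul_left C ?_
    have := (summable_nat_add_iff 1).mpr (Real.summable_nat_rpow.mpr
      (by norm_num : (-(3 / 2) : ℝ) < -1))
    simpa using this
  refine hs.of_nonneg_of_le (fun n => ?_) fun n => ?_
  · have := realHarmonic_nonneg n
    positivity
  · have h0 : (0 : ℝ) < (n : ℝ) + 1 := by positivity
    rw [div_le_iff₀ (by positivity), mul_assoc, ← Real.rpow_natCast ((n : ℝ) + 1),
      ← Real.rpow_add h0, show (-(3 / 2) : ℝ) + ((2 : ℕ) : ℝ) = 1 / 2 by norm_num]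
    exact hC n

theorem tendsto_one_add_realHarmonic_pow_div (d : ℕ) :
    Tendsto (fun n : ℕ => (1 + realHarmonic n) ^ d / ((n : ℝ) + 1)) atTop (𝓝 0) := by
  obtain ⟨C, hC⟩ := exists_one_add_realHarmonic_pow_le d
  have ht : Tendsto (fun n : ℕ => C * ((n : ℝ) + 1) ^ (-(1 / 2) : ℝ)) atTop (𝓝 0) := by
    have := ((tendsto_rpow_neg_atTop (by norm_num : (0 : ℝ) < 1 / 2)).comp
      (tendsto_atTop_add_const_right _ (1 : ℝ) tendsto_natCast_atTop_atTop)).const_mul C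
    simpa [Function.comp_def] using this
  refine squeeze_zero (fun n => ?_) (fun n => ?_) ht
  · have := realHarmonic_nonneg n
    positivity
  · have h0 : (0 : ℝ) < (n : ℝ) + 1 := by positivity
    rw [div_le_iff₀ h0, mul_assoc, ← Real.rpow_add_one h0.ne',
      show (-(1 / 2) : ℝ) + 1 = 1 / 2 by norm_num]
    exact hC n

theorem sum_range_pow_mul_eq {z : ℂ} (hz : z ≠ 1) (f : ℕ → ℂ) (M : ℕ) :
    ∑ n ∈ Finset.range M, z ^ n * f n
      = (f 0 - z ^ M * f M + ∑ n ∈ Finset.range M, z ^ (n + 1) * (f (n + 1) - f n)) / (1 - z) := by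
  rw [eq_div_iff (sub_ne_zero.mpr hz.symm)]
  induction M with
  | zero => simp
  | succ M ih =>
    rw [Finset.sum_range_succ, Finset.sum_range_succ, add_mul, ih]
    ring

/-- Dirichlet's test by Abel summation: for z ≠ 1 the sum is a vanishing boundary term plus an
absolutely convergent series of differences, over 1 - z. -/
theorem exists_tendsto_sum_pow_mul {z : ℂ} (hz : z ≠ 1) (hz1 : ‖z‖ ≤ 1) {f : ℕ → ℂ}
    (h0 : Tendsto f atTop (𝓝 0)) (hs : Summable fun n => ‖f (n + 1) - f n‖) :
    ∃ v, Tendsto (fun M => ∑ n ∈ Finset.range M, z ^ n * f n) atTop (𝓝 v) := by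
  have h1 : Tendsto (fun M => z ^ M * f M) atTop (𝓝 0) := by
    refine squeeze_zero_norm (fun n => ?_) (tendsto_zero_iff_norm_tendsto_zero.mp h0)
    rw [norm_mul, norm_pow]
    exact mul_le_of_le_one_left (norm_nonneg _) (pow_le_one₀ (norm_nonneg _) hz1)
  have h2 : Summable fun n => z ^ (n + 1) * (f (n + 1) - f n) := by
    refine Summable.of_norm_bounded hs fun n => ?_
    rw [norm_mul, norm_pow]
    exact mul_le_of_le_one_left (norm_nonneg _) (pow_le_one₀ (norm_nonneg _) hz1)
  refine ⟨_, (((tendsto_const_nhds (x := f 0)).sub h1).add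
    h2.hasSum.tendsto_sum_nat).div_const (1 - z) |>.congr fun M => ?_⟩
  rw [sum_range_pow_mul_eq hz]

theorem norm_mplTrunc_succ_sub_le {l : List (ℕ × ℂ)} (hl : ∀ p ∈ l, 0 < p.1 ∧ ‖p.2‖ ≤ 1) (n : ℕ) :
    ‖mplTrunc l (n + 1) - mplTrunc l n‖ ≤ (1 + realHarmonic n) ^ l.length / ((n : ℝ) + 1) := by
  have hr := realHarmonic_nonneg n
  cases l with
  | nil =>
    simp [mplTrunc]
    positivity
  | cons p l =>
    rw [mplTrunc_succ, add_sub_cancel_left, norm_mul, div_eq_mul_one_div ((1 + _) ^ _),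
      mul_comm]
    have hp := hl p (by simp)
    refine mul_le_mul ((norm_mplTrunc_le (fun x hx => hl x (by simp [hx])) n).trans ?_)
      (norm_pow_div_natCast_pow_le hp.1 hp.2 n) (norm_nonneg _) (by positivity)
    exact pow_le_pow_right₀ (by linarith) (by simp)

/-- Leading exponent 1 forces q ≠ 1, and Dirichlet's test applies to the inner sum divided by n + 1.
Otherwise the logarithmic growth of the inner sum is absorbed by 1/n². -/
theorem exists_isMPLValue_cons {s : ℕ} {q : ℂ} {l : List (ℕ × ℂ)} (hs : 0 < s) (hq : ‖q‖ ≤ 1)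
    (hl : ∀ p ∈ l, 0 < p.1 ∧ ‖p.2‖ ≤ 1) (h1 : (s, q) ≠ (1, 1)) :
    ∃ v, IsMPLValue ((s, q) :: l) v := by
  rcases (Nat.succ_le_of_lt hs).eq_or_lt with rfl | h2
  · have hq1 : q ≠ 1 := by simpa using h1
    have h0 : Tendsto (fun n : ℕ => mplTrunc l n / ((n + 1 : ℕ) : ℂ)) atTop (𝓝 0) := by
      refine squeeze_zero_norm (fun n => ?_) (tendsto_one_add_realHarmonic_pow_div l.length)
      rw [norm_div, Complex.norm_natCast]
      push_cast
      gcongr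
      exact norm_mplTrunc_le hl n
    have hd : Summable fun n : ℕ => ‖mplTrunc l (n + 1) / ((n + 1 + 1 : ℕ) : ℂ)
        - mplTrunc l n / ((n + 1 : ℕ) : ℂ)‖ := by
      refine Summable.of_nonneg_of_le (fun n => norm_nonneg _) (fun n => ?_)
        ((summable_one_add_realHarmonic_pow_div l.length).mul_left 2)
      have e : mplTrunc l (n + 1) / ((n + 1 + 1 : ℕ) : ℂ) - mplTrunc l n / ((n + 1 : ℕ) : ℂ)
          = (mplTrunc l (n + 1) - mplTrunc l n) / ((n + 1 + 1 : ℕ) : ℂ)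
            - mplTrunc l n / (((n + 1 : ℕ) : ℂ) * ((n + 1 + 1 : ℕ) : ℂ)) := by
        have a1 : ((n + 1 : ℕ) : ℂ) ≠ 0 := Nat.cast_ne_zero.mpr (by omega)
        have a2 : ((n + 1 + 1 : ℕ) : ℂ) ≠ 0 := Nat.cast_ne_zero.mpr (by omega)
        have a3 : ((n + 1 + 1 : ℕ) : ℂ) = ((n + 1 : ℕ) : ℂ) + 1 := by push_cast; ring
        rw [a3] at a2 ⊢
        generalize ((n + 1 : ℕ) : ℂ) = x at *
        field_simp
        ring
      have hr := realHarmonic_nonneg n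
      have hn : (0 : ℝ) < (n : ℝ) + 1 := by positivity
      rw [e]
      refine (norm_sub_le _ _).trans ?_
      rw [norm_div, norm_div, norm_mul, Complex.norm_natCast, Complex.norm_natCast, two_mul]
      push_cast
      refine add_le_add ?_ ?_
      · calc _ ≤ (1 + realHarmonic n) ^ l.length / ((n : ℝ) + 1) / ((n : ℝ) + 1) := by
              gcongr
              · exact norm_mplTrunc_succ_sub_le hl n
              · linarith
          _ = _ := by rw [div_div, sq]
      · rw [sq]
        gcongr
        · exact norm_mplTrunc_le hl n
        · linarith
    obtain ⟨v, hv⟩ := exists_tendsto_sum_pow_mul hq1 hq h0 hd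
    refine ⟨q * v, (hv.const_mul q).congr fun M => ?_⟩
    rw [mplTrunc, Finset.mul_sum]
    refine Finset.sum_congr rfl fun n _ => ?_
    simp only [Nat.succ_eq_add_one, zero_add, pow_one]
    ring
  · refine ⟨_, (Summable.hasSum (Summable.of_norm_bounded
      (summable_one_add_realHarmonic_pow_div l.length) fun n => ?_)).tendsto_sum_nat⟩
    have hn : (1 : ℝ) ≤ (n : ℝ) + 1 := by linarith [n.cast_nonneg (α := ℝ)]
    have hr := realHarmonic_nonneg n
    rw [norm_mul, norm_div, norm_pow, norm_pow, Complex.norm_natCast, mul_comm, ← mul_div_assoc]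
    push_cast
    refine div_le_div₀ (by positivity) ?_ (by positivity) (pow_le_pow_right₀ hn h2)
    exact (mul_le_of_le_one_right (norm_nonneg _) (pow_le_one₀ (norm_nonneg _) hq)).trans
      (norm_mplTrunc_le hl n)

theorem IsCMZVIndex.exists_isMPLValue {k N : ℕ} (hN : N ≠ 0) {l : List (ℕ × ℂ)}
    (hl : IsCMZVIndex k N l) : ∃ v, IsMPLValue l v := by
  have hl' : ∀ p ∈ l, 0 < p.1 ∧ ‖p.2‖ ≤ 1 := fun p hp =>
    ⟨(hl.1 p hp).1, (Complex.norm_eq_one_of_pow_eq_one (hl.1 p hp).2 hN).le⟩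
  cases l with
  | nil => exact ⟨1, tendsto_const_nhds⟩
  | cons p l =>
    exact exists_isMPLValue_cons (hl' p (by simp)).1 (hl' p (by simp)).2
      (fun x hx => hl' x (by simp [hx])) (by simpa using hl.2.1)

/-! ### Products and radial limits in the span of values -/

theorem IsMPLValue.mem_cmzvSpan {k N : ℕ} {l : List (ℕ × ℂ)} {v : ℂ} (h : IsMPLValue l v)
    (hl : IsCMZVIndex k N l) : v ∈ cmzvSpan k N :=
  Submodule.subset_span ⟨l, hl, h⟩

/-- Pass to the limit in the truncated stuffle identity: all its terms converge, being admissible.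
-/
theorem IsMPLValue.mul_mem_cmzvSpan {k N : ℕ} (hN : N ≠ 0) {s : ℕ} {q u : ℂ}
    (hu : IsMPLValue [(s, q)] u) (hs : 0 < s) (hq : q ^ N = 1) (h1 : (s, q) ≠ (1, 1)) {x : ℂ}
    (hx : x ∈ cmzvSpan k N) : u * x ∈ cmzvSpan (k + s) N := by
  induction hx using Submodule.span_induction with
  | mem x hx =>
    obtain ⟨l, hl, hv⟩ := hx
    have hst := IsCMZVIndex.stuffle hs hq h1 hl
    choose! a ha using fun t ht => (hst t ht).exists_isMPLValue hN
    have hlim := (tendsto_list_sum (stuffle (s, q) l) ha).congr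
      fun M => (mplTrunc_singleton_mul (s, q) l M).symm
    rw [tendsto_nhds_unique (hu.mul hv) hlim]
    refine list_sum_mem fun y hy => ?_
    obtain ⟨t, ht, rfl⟩ := List.mem_map.mp hy
    exact (ha t ht).mem_cmzvSpan (hst t ht)
  | zero => simp
  | add x y _ _ hx hy => rw [mul_add]; exact add_mem hx hy
  | smul c x _ hx => rw [mul_smul_comm]; exact Submodule.smul_mem _ c hx

/-- Abel's limit theorem. The power series here begins with x rather than 1, hence the extra factor
x → 1. -/
theorem IsMPLValue.tendsto_polySeries {s : ℕ} {q v : ℂ} {l : List (ℕ × ℂ)}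
    (h : IsMPLValue ((s, q) :: l) v) :
    Tendsto (fun x : ℝ => polySeries s (mplTrunc l) (x * q)) (𝓝[<] 1) (𝓝 v) := by
  have h1 := tendsto_map'_iff.mp (Complex.tendsto_tsum_powerSeries_nhdsWithin_lt
    (f := fun n => q ^ (n + 1) / ((n + 1 : ℕ) : ℂ) ^ s * mplTrunc l n) h)
  have h2 : Tendsto (fun x : ℝ => (x : ℂ)) (𝓝[<] 1) (𝓝 1) :=
    (ContinuousAt.tendsto_of_eq (by fun_prop) (by simp)).mono_left nhdsWithin_le_nhds
  have h3 := h2.mul h1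
  rw [one_mul] at h3
  refine h3.congr fun x => ?_
  rw [Function.comp, ← tsum_mul_left, polySeries]
  refine tsum_congr fun n => ?_
  ring

theorem IsCMZVIndex.exists_tendsto_polySeries {k N s : ℕ} {q : ℂ} {l : List (ℕ × ℂ)} (hN : N ≠ 0)
    (h : IsCMZVIndex k N ((s, q) :: l)) : ∃ v ∈ cmzvSpan k N,
      Tendsto (fun x : ℝ => polySeries s (mplTrunc l) (x * q)) (𝓝[<] 1) (𝓝 v) := by
  obtain ⟨v, hv⟩ := h.exists_isMPLValue hN
  exact ⟨v, hv.mem_cmzvSpan h, hv.tendsto_polySeries⟩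

/-! ### Odd combinations and multiplication by πi -/

/-- The function `Li_s(-w) - Li_s(w)`. -/
def oddPolylog (s : ℕ) (w : ℂ) : ℂ := polylog s (-w) - polylog s w

/-- The combination of `Li_{s,1}(±w, ±1)` that is odd in `w`. -/
def oddDoublePolylog (s : ℕ) (w : ℂ) : ℂ :=
  polySeries s (mplTrunc [(1, 1)]) w + polySeries s (mplTrunc [(1, -1)]) w
    - (polySeries s (mplTrunc [(1, 1)]) (-w) + polySeries s (mplTrunc [(1, -1)]) (-w))

/-- Both q and -q occur, so N must be even, and in weight one both q = 1 and q = -1 have to be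
excluded. -/
theorem exists_tendsto_oddPolylog {N s : ℕ} {q : ℂ} (hN : N ≠ 0) (hN2 : Even N) (hs : 0 < s)
    (hq : q ^ N = 1) (h : 2 ≤ s ∨ q ^ 2 ≠ 1) :
    ∃ v ∈ cmzvSpan s N, Tendsto (fun x : ℝ => oddPolylog s (x * q)) (𝓝[<] 1) (𝓝 v) := by
  have hi : ∀ q : ℂ, q ^ N = 1 → (2 ≤ s ∨ q ^ 2 ≠ 1) → IsCMZVIndex s N [(s, q)] := by
    intro q hq h
    refine ⟨by simpa using ⟨hs, hq⟩, ?_, by simp⟩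
    simp only [List.head?_cons, ne_eq, Option.some.injEq, Prod.mk.injEq, not_and]
    rintro rfl rfl
    simp at h
  obtain ⟨a, ha, hat⟩ := (hi q hq h).exists_tendsto_polySeries hN
  obtain ⟨b, hb, hbt⟩ := (hi (-q) (by rwa [hN2.neg_pow]) (by simpa using h)).exists_tendsto_polySeries hN
  refine ⟨b - a, sub_mem hb ha, (hbt.sub hat).congr fun x => ?_⟩
  rw [oddPolylog, polylog_eq_polySeries, mul_neg]
  rfl

theorem exists_tendsto_oddDoublePolylog {N s : ℕ} {q : ℂ} (hN : N ≠ 0) (hN2 : Even N) (hs : 0 < s)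
    (hq : q ^ N = 1) (h : 2 ≤ s ∨ q ^ 2 ≠ 1) :
    ∃ v ∈ cmzvSpan (s + 1) N,
      Tendsto (fun x : ℝ => oddDoublePolylog s (x * q)) (𝓝[<] 1) (𝓝 v) := by
  have hi : ∀ q e : ℂ, q ^ N = 1 → e ^ N = 1 → (2 ≤ s ∨ q ^ 2 ≠ 1) →
      IsCMZVIndex (s + 1) N [(s, q), (1, e)] := by
    intro q e hq he h
    refine ⟨by simpa using ⟨⟨hs, hq⟩, he⟩, ?_, by simp⟩
    simp only [List.head?_cons, ne_eq, Option.some.injEq, Prod.mk.injEq, not_and]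
    rintro rfl rfl
    simp at h
  have hq' : (-q) ^ N = 1 := by rwa [hN2.neg_pow]
  have h' : 2 ≤ s ∨ (-q) ^ 2 ≠ 1 := by simpa using h
  have he : (-1 : ℂ) ^ N = 1 := hN2.neg_one_pow
  obtain ⟨a, ha, hat⟩ := (hi q 1 hq (one_pow N) h).exists_tendsto_polySeries hN
  obtain ⟨b, hb, hbt⟩ := (hi q (-1) hq he h).exists_tendsto_polySeries hN
  obtain ⟨c, hc, hct⟩ := (hi (-q) 1 hq' (one_pow N) h').exists_tendsto_polySeries hN
  obtain ⟨d, hd, hdt⟩ := (hi (-q) (-1) hq' he h').exists_tendsto_polySeries hN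
  refine ⟨a + b - (c + d), sub_mem (add_mem ha hb) (add_mem hc hd),
    ((hat.add hbt).sub (hct.add hdt)).congr fun x => ?_⟩
  rw [oddDoublePolylog, mul_neg]

/-- Since log(1 ± i) = (log 2)/2 ± πi/4, πi = 2 Li_1(i) - 2 Li_1(-i), and ±i are twelfth roots of
unity. The two depth-one values act by the stuffle product. -/
theorem pi_mul_I_mul_mem_cmzvSpan {k : ℕ} {x : ℂ} (hx : x ∈ cmzvSpan k 12) :
    Real.pi * Complex.I * x ∈ cmzvSpan (k + 1) 12 := by
  have hI : ∀ q : ℂ, q ^ 2 = -1 → ∃ v, IsMPLValue [(1, q)] v ∧ v * x ∈ cmzvSpan (k + 1) 12 := by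
    intro q hq
    have h12 : q ^ 12 = 1 := by
      rw [show (12 : ℕ) = 2 * 6 by norm_num, pow_mul, hq]
      norm_num
    have h1 : ((1 : ℕ), q) ≠ (1, 1) := by
      rintro ⟨⟩
      norm_num at hq
    obtain ⟨v, hv⟩ := exists_isMPLValue_cons one_pos
      (Complex.norm_eq_one_of_pow_eq_one h12 (by norm_num)).le (l := []) (by simp) h1
    exact ⟨v, hv, hv.mul_mem_cmzvSpan (by norm_num) one_pos h12 h1 hx⟩
  obtain ⟨a, ha, hax⟩ := hI Complex.I Complex.I_sq
  obtain ⟨b, hb, hbx⟩ := hI (-Complex.I) (by simp)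
  have hlog : ∀ q v : ℂ, ‖q‖ = 1 → q.re = 0 → IsMPLValue [(1, q)] v → v = -Complex.log (1 - q) := by
    intro q v hq hre hv
    refine tendsto_nhds_unique hv.tendsto_polySeries ?_
    have hc : ContinuousAt (fun x : ℝ => -Complex.log (1 - x * q)) 1 := by
      refine ContinuousAt.neg (ContinuousAt.clog (by fun_prop) (Or.inl ?_))
      simp [hre]
    have := (hc.tendsto_of_eq (c := -Complex.log (1 - q)) (by simp)).mono_left
      (nhdsWithin_le_nhds (s := Set.Iio 1))
    refine this.congr' ?_
    filter_upwards [Ioo_mem_nhdsLT (zero_lt_one' ℝ)] with x hx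
    rw [← polylog_one]
    · rw [polylog_eq_polySeries]; rfl
    · rw [norm_mul, hq, mul_one, Complex.norm_real, Real.norm_eq_abs, abs_of_pos hx.1]
      exact hx.2
  have hp := Real.pi_pos
  have e : (Real.pi : ℂ) * Complex.I = 2 * a - 2 * b := by
    have e1 : (1 : ℂ) - Complex.I
        = (Real.sqrt 2 : ℝ) * Complex.exp ((-(Real.pi / 4) : ℝ) * Complex.I) := by
      apply Complex.ext
      · rw [Complex.re_ofReal_mul, Complex.exp_ofReal_mul_I_re, Real.cos_neg,
          Real.cos_pi_div_four]
        simp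
        linear_combination -real_sqrt_two_sq / 2
      · rw [Complex.im_ofReal_mul, Complex.exp_ofReal_mul_I_im, Real.sin_neg,
          Real.sin_pi_div_four]
        simp
        linear_combination -real_sqrt_two_sq / 2
    have e2 : (1 : ℂ) - -Complex.I
        = (Real.sqrt 2 : ℝ) * Complex.exp ((Real.pi / 4 : ℝ) * Complex.I) := by
      apply Complex.ext
      · rw [Complex.re_ofReal_mul, Complex.exp_ofReal_mul_I_re, Real.cos_pi_div_four]
        simp
        linear_combination -real_sqrt_two_sq / 2
      · rw [Complex.im_ofReal_mul, Complex.exp_ofReal_mul_I_im, Real.sin_pi_div_four]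
        simp
        linear_combination -real_sqrt_two_sq / 2
    rw [hlog _ _ (by simp) (by simp) ha, hlog _ _ (by simp) (by simp) hb, e1, e2,
      log_real_mul_exp (by positivity) (by linarith) (by linarith),
      log_real_mul_exp (by positivity) (by linarith) (by linarith)]
    push_cast
    ring
  have e' : Real.pi * Complex.I * x = (2 : ℚ) • (a * x) - (2 : ℚ) • (b * x) := by
    rw [e, Rat.smul_def, Rat.smul_def]
    push_cast
    ring
  rw [e']
  exact sub_mem (Submodule.smul_mem _ _ hax) (Submodule.smul_mem _ _ hbx)

/-! ### Two primitives related by the Cayley transform -/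

/-- The function of `M` whose value at `-i (2 - √3)` is, up to the factor `2 i`, the sum of the
series. -/
def arcsinPrimitive (M : ℂ) : ℂ :=
  (2 * Real.log 2 + Real.pi * Complex.I / 2 + Complex.log M) * oddPolylog 2 M - oddPolylog 3 M
    + 2 * (nielsenS12 (-M) - nielsenS12 M)

/-- The function `arcsinPrimitive ∘ cayley` in terms of multiple polylogarithms, up to a constant. -/
def mplPrimitive (w : ℂ) : ℂ :=
  Complex.log w * oddDoublePolylog 1 w - oddDoublePolylog 2 w
    - Complex.log w ^ 2 * oddPolylog 1 w + 2 * (Complex.log w * oddPolylog 2 w)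
    - 2 * oddPolylog 3 w
    + Real.pi * Complex.I / 2 * (Complex.log w * oddPolylog 1 w - oddPolylog 2 w)

theorem hasDerivAt_oddPolylog (s : ℕ) {w : ℂ} (hw : ‖w‖ < 1) (h0 : w ≠ 0) :
    HasDerivAt (oddPolylog (s + 1)) (oddPolylog s w / w) w := by
  refine ((hasDerivAt_polylog_neg s hw h0).sub (hasDerivAt_polylog s hw h0)).congr_deriv ?_
  rw [oddPolylog, sub_div]

theorem oddPolylog_one {w : ℂ} (hw : ‖w‖ < 1) :
    oddPolylog 1 w = Complex.log (1 - w) - Complex.log (1 + w) := by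
  rw [oddPolylog, polylog_one hw, polylog_one_neg hw]
  ring

/-- Summing over both signs in the inner argument produces log(1-w²), and taking the odd part in w
produces 1/(1-w) + 1/(1+w). -/
theorem hasDerivAt_oddDoublePolylog_one {w : ℂ} (hw : ‖w‖ < 1) :
    HasDerivAt (oddDoublePolylog 1)
      (-2 * (Complex.log (1 - w) + Complex.log (1 + w)) / ((1 - w) * (1 + w))) w := by
  have hw' : ‖-w‖ < 1 := by rwa [norm_neg]
  have h : ∀ q : ℂ, ‖q‖ ≤ 1 → HasDerivAt (fun w => polySeries 1 (mplTrunc [(1, q)]) (-w))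
      (polylog 1 (q * -w) / (1 - -w) * -1) w := fun q hq =>
    HasDerivAt.comp w (hasDerivAt_polySeries_mplTrunc 1 hq hw') (hasDerivAt_neg w)
  refine (((hasDerivAt_polySeries_mplTrunc 1 (q := 1) (by simp) hw).add
    (hasDerivAt_polySeries_mplTrunc 1 (q := -1) (by simp) hw)).sub
    ((h 1 (by simp)).add (h (-1) (by simp)))).congr_deriv ?_
  rw [one_mul, one_mul, neg_one_mul, neg_one_mul, neg_neg, polylog_one hw, polylog_one_neg hw,
    sub_neg_eq_add]
  have h1 := one_sub_ne_zero hw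
  have h2 := one_add_ne_zero hw
  field_simp
  ring

theorem hasDerivAt_oddDoublePolylog (s : ℕ) {w : ℂ} (hw : ‖w‖ < 1) (h0 : w ≠ 0) :
    HasDerivAt (oddDoublePolylog (s + 1)) (oddDoublePolylog s w / w) w := by
  have hc : ∀ q : ℂ, ‖q‖ ≤ 1 → ∀ n, ‖mplTrunc [(1, q)] n‖ ≤ n + 1 := fun q hq =>
    norm_mplTrunc_singleton_le 1 hq
  have h : ∀ q : ℂ, ‖q‖ ≤ 1 → HasDerivAt (fun w => polySeries (s + 1) (mplTrunc [(1, q)]) (-w))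
      (polySeries s (mplTrunc [(1, q)]) (-w) * (-1 / -w)) w := fun q hq =>
    (hasDerivAt_neg w).polySeries_succ s (hc q hq) (by rwa [norm_neg]) (neg_ne_zero.mpr h0)
  refine (((hasDerivAt_polySeries_succ s (hc 1 (by simp)) hw h0).add
    (hasDerivAt_polySeries_succ s (hc (-1) (by simp)) hw h0)).sub
    ((h 1 (by simp)).add (h (-1) (by simp)))).congr_deriv ?_
  rw [oddDoublePolylog]
  field_simp

theorem hasDerivAt_arcsinPrimitive {M : ℂ} (hM : M ∈ halfDisc) :
    HasDerivAt arcsinPrimitive ((Complex.log (1 - M) - Complex.log (1 + M))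
      * (2 * Real.log 2 + Real.pi * Complex.I / 2 + Complex.log M
        - (Complex.log (1 - M) + Complex.log (1 + M))) / M) M := by
  have h0 := ne_zero_of_re_pos hM.2
  refine (((((hasDerivAt_log hM.2).const_add (2 * Real.log 2 + Real.pi * Complex.I / 2 : ℂ)).mul
    (hasDerivAt_oddPolylog 1 hM.1 h0)).sub (hasDerivAt_oddPolylog 2 hM.1 h0)).add
    (((hasDerivAt_nielsenS12_neg hM.1 h0).sub (hasDerivAt_nielsenS12 hM.1 h0)).const_mul 2))
    |>.congr_deriv ?_
  rw [oddPolylog_one hM.1]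
  field_simp
  ring

/-- The transform turns log((1-M)/(1+M)) into log w, and the constant 2 log 2 in `arcsinPrimitive`
cancels the one from log(1-M²). -/
theorem hasDerivAt_arcsinPrimitive_cayley {w : ℂ} (hw : w ∈ halfDisc) :
    HasDerivAt (fun w => arcsinPrimitive (cayley w))
      (-2 * Complex.log w * (Real.pi * Complex.I / 2 + Complex.log (1 - w) + Complex.log (1 + w)
        - Complex.log w) / ((1 - w) * (1 + w))) w := by
  refine (HasDerivAt.comp w (hasDerivAt_arcsinPrimitive (cayley_mem_halfDisc hw))
    (hasDerivAt_cayley hw.1)).congr_deriv ?_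
  rw [log_one_sub_cayley hw, log_one_add_cayley hw, log_cayley hw.1, cayley]
  have h1 := one_sub_ne_zero hw.1
  have h2 := one_add_ne_zero hw.1
  field_simp
  ring

/-- Repeated integration by parts: the odd double polylogarithm of index 1 is a primitive of -2
log(1-w²)/(1-w²), `oddPolylog 1` one of -2/(1-w²), and each further index integrates against dw/w.
-/
theorem hasDerivAt_mplPrimitive {w : ℂ} (hw : w ∈ halfDisc) :
    HasDerivAt mplPrimitive
      (-2 * Complex.log w * (Real.pi * Complex.I / 2 + Complex.log (1 - w) + Complex.log (1 + w)
        - Complex.log w) / ((1 - w) * (1 + w))) w := by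
  have h0 := ne_zero_of_re_pos hw.2
  have hL := hasDerivAt_log hw.2
  have hE : HasDerivAt (oddPolylog 1) (-2 / ((1 - w) * (1 + w))) w := by
    refine (hasDerivAt_log_ratio hw.1).congr_of_eventuallyEq ?_
    filter_upwards [isOpen_halfDisc.mem_nhds hw] with z hz
    exact oddPolylog_one hz.1
  have hE2 := hasDerivAt_oddPolylog 1 hw.1 h0
  refine (((((hL.mul (hasDerivAt_oddDoublePolylog_one hw.1)).sub
    (hasDerivAt_oddDoublePolylog 1 hw.1 h0)).sub ((hL.pow 2).mul hE)).add
    ((hL.mul hE2).const_mul 2)).sub ((hasDerivAt_oddPolylog 2 hw.1 h0).const_mul 2)).add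
    (((hL.mul hE).sub hE2).const_mul (Real.pi * Complex.I / 2 : ℂ)) |>.congr_deriv ?_
  have h1 := one_sub_ne_zero hw.1
  have h2 := one_add_ne_zero hw.1
  simp only [Pi.pow_apply]
  field_simp
  ring

theorem mplTrunc_one_one (n : ℕ) : mplTrunc [(1, 1)] n = ((realHarmonic n : ℝ) : ℂ) := by
  simp [mplTrunc, realHarmonic]

theorem norm_mplTrunc_singleton_le_realHarmonic {q : ℂ} (hq : ‖q‖ ≤ 1) (n : ℕ) :
    ‖mplTrunc [(1, q)] n‖ ≤ realHarmonic n := by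
  rw [mplTrunc, realHarmonic]
  refine (norm_sum_le _ _).trans (Finset.sum_le_sum fun k _ => ?_)
  simpa [mplTrunc] using norm_pow_div_natCast_pow_le one_pos hq k

/-- The inner sums are majorised by harmonic numbers, whose generating series is known in closed
form. This controls the divergence of the weight-two term at w = 1. -/
theorem norm_polySeries_one_le {q z : ℂ} (hq : ‖q‖ ≤ 1) (hz : ‖z‖ < 1) :
    ‖polySeries 1 (mplTrunc [(1, q)]) z‖ ≤ Real.log (1 - ‖z‖) ^ 2 / 2 := by
  have hr : ‖((‖z‖ : ℝ) : ℂ)‖ < 1 := by simpa using hz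
  have h := (summable_polySeries 1 (norm_mplTrunc_singleton_le 1 (q := 1) (by simp)) hr).hasSum
  have e := polySeries_one_harmonic hr
  rw [polySeries] at e
  rw [e] at h
  have h' : HasSum (fun n : ℕ => ‖z‖ ^ (n + 1) / ((n + 1 : ℕ) : ℝ) ^ 1 * realHarmonic n)
      (Real.log (1 - ‖z‖) ^ 2 / 2) := by
    rw [← Complex.hasSum_ofReal]
    convert h using 1
    · ext n
      rw [mplTrunc_one_one]
      push_cast
      rfl
    · rw [Complex.ofReal_div, Complex.ofReal_pow, Complex.ofReal_log (by linarith)]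
      push_cast
      rfl
  refine tsum_of_norm_bounded h' fun n => ?_
  rw [norm_mul, norm_div, norm_pow, norm_pow, Complex.norm_natCast]
  gcongr
  exact norm_mplTrunc_singleton_le_realHarmonic hq n

theorem norm_oddDoublePolylog_one_le {z : ℂ} (hz : ‖z‖ < 1) :
    ‖oddDoublePolylog 1 z‖ ≤ 2 * Real.log (1 - ‖z‖) ^ 2 := by
  have hz' : ‖-z‖ < 1 := by rwa [norm_neg]
  have h1 : ‖(1 : ℂ)‖ ≤ 1 := by simp
  have h2 : ‖(-1 : ℂ)‖ ≤ 1 := by simp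
  have a := norm_polySeries_one_le h1 hz
  have b := norm_polySeries_one_le h2 hz
  have c := norm_polySeries_one_le h1 hz'
  have d := norm_polySeries_one_le h2 hz'
  rw [norm_neg] at c d
  rw [oddDoublePolylog]
  refine (norm_sub_le _ _).trans ((add_le_add (norm_add_le _ _) (norm_add_le _ _)).trans ?_)
  linarith

theorem tendsto_ofReal_log_one : Tendsto (fun x : ℝ => Complex.log x) (𝓝[<] 1) (𝓝 0) :=
  (ContinuousAt.tendsto_of_eq (ContinuousAt.clog (by fun_prop) (by simp)) (by simp)).mono_left
    nhdsWithin_le_nhds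

theorem ofReal_mem_halfDisc {x : ℝ} (hx : x ∈ Set.Ioo (0 : ℝ) 1) : (x : ℂ) ∈ halfDisc := by
  refine ⟨?_, by simpa using hx.1⟩
  rw [Complex.norm_real, Real.norm_eq_abs, abs_of_pos hx.1]
  exact hx.2

theorem tendsto_cayley_ofReal : Tendsto (fun x : ℝ => cayley x) (𝓝[<] 1) (𝓝[halfDisc] 0) := by
  refine tendsto_nhdsWithin_iff.mpr ⟨?_, ?_⟩
  · have hc : ContinuousAt (fun x : ℝ => cayley x) 1 := by
      unfold cayley
      refine ContinuousAt.div (by fun_prop) (by fun_prop) ?_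
      norm_num
    exact (hc.tendsto_of_eq (by simp [cayley])).mono_left nhdsWithin_le_nhds
  · filter_upwards [Ioo_mem_nhdsLT (zero_lt_one' ℝ)] with x hx
    exact cayley_mem_halfDisc (ofReal_mem_halfDisc hx)

/-- The Cayley involution interchanges the two factors, so this is the limit of log v ·
log((1-v)/(1+v)) at 0. -/
theorem tendsto_log_mul_oddPolylog_one :
    Tendsto (fun x : ℝ => Complex.log x * oddPolylog 1 x) (𝓝[<] 1) (𝓝 0) := by
  refine (tendsto_log_mul_log_ratio.comp tendsto_cayley_ofReal).congr' ?_
  filter_upwards [Ioo_mem_nhdsLT (zero_lt_one' ℝ)] with x hx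
  have h := ofReal_mem_halfDisc hx
  rw [Function.comp, ← log_cayley (cayley_mem_halfDisc h).1, cayley_cayley (one_add_ne_zero h.1),
    log_cayley h.1, oddPolylog_one h.1, mul_comm]

theorem tendsto_one_sub_mul_log_sq :
    Tendsto (fun x : ℝ => (1 - x) * Real.log (1 - x) ^ 2) (𝓝[<] 1) (𝓝 0) := by
  have h := (tendsto_log_mul_rpow_nhdsGT_zero (by norm_num : (0 : ℝ) < 1 / 2)).pow 2
  have hs : Tendsto (fun x : ℝ => 1 - x) (𝓝[<] 1) (𝓝[>] 0) := by
    refine tendsto_nhdsWithin_iff.mpr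
      ⟨(ContinuousAt.tendsto_of_eq (by fun_prop) (by simp)).mono_left nhdsWithin_le_nhds, ?_⟩
    filter_upwards [self_mem_nhdsWithin] with x hx
    simpa using hx
  have h2 := h.comp hs
  rw [zero_pow two_ne_zero] at h2
  refine h2.congr' ?_
  filter_upwards [self_mem_nhdsWithin] with x hx
  have hx' : 0 ≤ 1 - x := by linarith [Set.mem_Iio.mp hx]
  rw [Function.comp, mul_pow, ← Real.rpow_natCast ((1 - x) ^ (1 / 2 : ℝ)), ← Real.rpow_mul hx']
  norm_num
  ring

/-- Near 1, |log x| ≤ 2(1-x), while the other factor grows at most like 2 log²(1-x). -/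
theorem tendsto_log_mul_oddDoublePolylog_one :
    Tendsto (fun x : ℝ => Complex.log x * oddDoublePolylog 1 x) (𝓝[<] 1) (𝓝 0) := by
  have h := tendsto_one_sub_mul_log_sq.const_mul 4
  rw [mul_zero] at h
  refine squeeze_zero_norm' ?_ h
  filter_upwards [Ioo_mem_nhdsLT (by norm_num : (1 / 2 : ℝ) < 1)] with x hx
  have hx0 : 0 < x := by linarith [hx.1]
  have hm := ofReal_mem_halfDisc ⟨hx0, hx.2⟩
  have hb := norm_oddDoublePolylog_one_le hm.1
  rw [Complex.norm_real, Real.norm_eq_abs, abs_of_pos hx0] at hb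
  have hl : ‖Complex.log x‖ ≤ 2 * (1 - x) := by
    rw [← Complex.ofReal_log hx0.le, Complex.norm_real, Real.norm_eq_abs,
      abs_of_nonpos (Real.log_nonpos hx0.le hx.2.le)]
    have h1 := Real.one_sub_inv_le_log_of_pos hx0
    have h2 : x⁻¹ ≤ 1 + 2 * (1 - x) := by
      rw [inv_le_iff_one_le_mul₀ hx0]
      nlinarith [hx.1, hx.2]
    linarith
  rw [norm_mul]
  calc _ ≤ 2 * (1 - x) * (2 * Real.log (1 - x) ^ 2) :=
        mul_le_mul hl hb (norm_nonneg _) (by linarith [hx.2])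
    _ = _ := by ring

theorem tendsto_arcsinPrimitive_zero : Tendsto arcsinPrimitive (𝓝[halfDisc] 0) (𝓝 0) := by
  obtain ⟨d, hd⟩ : ∃ d, HasDerivAt (polylog 2) d 0 := by
    rw [polylog_eq_polySeries]
    exact ⟨_, hasDerivAt_polySeries 1 norm_one_le_succ (by simp)⟩
  have hd' : HasDerivAt (oddPolylog 2) (d * -1 - d) 0 :=
    (HasDerivAt.comp (h₂ := polylog 2) (0 : ℂ) (by rwa [neg_zero]) (hasDerivAt_neg 0)).sub hd
  have h0 : oddPolylog 2 0 = 0 := by simp [oddPolylog]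
  have h1 := (hd'.continuousAt.tendsto_of_eq h0).mono_left
    (nhdsWithin_le_nhds (s := halfDisc))
  have h2 := (tendsto_log_mul hd' h0).mono_left (nhdsWithin_le_nhds (s := halfDisc))
  have h3 := (tendsto_polylog_neg_zero 2).sub (tendsto_polylog_zero 2)
  have h4 := (tendsto_nielsenS12_comp continuous_neg neg_zero).sub
    (tendsto_nielsenS12_comp continuous_id rfl)
  have h := (((h1.const_mul (2 * Real.log 2 + Real.pi * Complex.I / 2 : ℂ)).add h2).sub h3).add
    (h4.const_mul 2)
  convert h using 2
  · rw [arcsinPrimitive, oddPolylog, oddPolylog]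
    simp only [id]
    ring
  · simp

theorem exists_tendsto_mplPrimitive_ofReal :
    ∃ v ∈ cmzvSpan 3 12, Tendsto (fun x : ℝ => mplPrimitive x) (𝓝[<] 1) (𝓝 v) := by
  have h12 : (12 : ℕ) ≠ 0 := by norm_num
  have hev : Even 12 := ⟨6, rfl⟩
  have h1 : (1 : ℂ) ^ 12 = 1 := one_pow 12
  obtain ⟨g, hg, hgt⟩ := exists_tendsto_oddDoublePolylog h12 hev two_pos h1 (Or.inl le_rfl)
  obtain ⟨e₂, he₂, he₂t⟩ := exists_tendsto_oddPolylog h12 hev two_pos h1 (Or.inl le_rfl)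
  obtain ⟨e₃, he₃, he₃t⟩ := exists_tendsto_oddPolylog h12 hev three_pos h1 (Or.inl (by norm_num))
  simp only [mul_one] at hgt he₂t he₃t
  -- Every product containing log x tends to 0, even where the other factor may diverge; these are
  -- the terms that survive.
  refine ⟨-g - (2 : ℚ) • e₃ - (1 / 2 : ℚ) • (Real.pi * Complex.I * e₂), ?_, ?_⟩
  · exact sub_mem (sub_mem (neg_mem hg) (Submodule.smul_mem _ _ he₃))
      (Submodule.smul_mem _ _ (pi_mul_I_mul_mem_cmzvSpan he₂))
  · have hL := tendsto_ofReal_log_one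
    have hE := tendsto_log_mul_oddPolylog_one
    have h := ((((tendsto_log_mul_oddDoublePolylog_one.sub hgt).sub (hL.mul hE)).add
      ((hL.mul he₂t).const_mul 2)).sub (he₃t.const_mul 2)).add
      ((hE.sub he₂t).const_mul (Real.pi * Complex.I / 2 : ℂ))
    convert h using 2
    · rw [mplPrimitive]; ring
    · rw [Rat.smul_def, Rat.smul_def]; push_cast; ring

/-! ### Evaluation at ζ = e^{πi/6} and membership -/

/-- A primitive twelfth root of unity. -/
def zetaTwelve : ℂ := Complex.exp ((Real.pi / 6 : ℝ) * Complex.I)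

theorem zetaTwelve_re : zetaTwelve.re = Real.sqrt 3 / 2 := by
  rw [zetaTwelve, Complex.exp_ofReal_mul_I_re, Real.cos_pi_div_six]

theorem zetaTwelve_im : zetaTwelve.im = 1 / 2 := by
  rw [zetaTwelve, Complex.exp_ofReal_mul_I_im, Real.sin_pi_div_six]

theorem norm_zetaTwelve : ‖zetaTwelve‖ = 1 := Complex.norm_exp_ofReal_mul_I _

theorem zetaTwelve_pow : zetaTwelve ^ 12 = 1 := by
  rw [zetaTwelve, ← Complex.exp_nat_mul, ← Complex.exp_two_pi_mul_I]
  congr 1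
  push_cast
  ring

theorem zetaTwelve_sq_ne_one : zetaTwelve ^ 2 ≠ 1 := by
  intro h
  have h1 := congrArg Complex.im h
  rw [sq, Complex.mul_im, zetaTwelve_re, zetaTwelve_im, Complex.one_im] at h1
  linarith [sqrt_three_bounds.1]

theorem log_zetaTwelve : Complex.log zetaTwelve = Real.pi * Complex.I / 6 := by
  have hp := Real.pi_pos
  have h := log_real_mul_exp (r := 1) (θ := Real.pi / 6) one_pos (by linarith) (by linarith)
  rw [Complex.ofReal_one, one_mul, Real.log_one] at h
  rw [zetaTwelve, h]
  push_cast
  ring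

theorem exists_tendsto_mplPrimitive_zetaTwelve :
    ∃ v ∈ cmzvSpan 3 12, Tendsto (fun x : ℝ => mplPrimitive (x * zetaTwelve)) (𝓝[<] 1) (𝓝 v) := by
  have h12 : (12 : ℕ) ≠ 0 := by norm_num
  have hev : Even 12 := ⟨6, rfl⟩
  have hz := zetaTwelve_pow
  have hz2 := zetaTwelve_sq_ne_one
  obtain ⟨f, hf, hft⟩ := exists_tendsto_oddDoublePolylog h12 hev one_pos hz (Or.inr hz2)
  obtain ⟨g, hg, hgt⟩ := exists_tendsto_oddDoublePolylog h12 hev two_pos hz (Or.inr hz2)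
  obtain ⟨e₁, he₁, he₁t⟩ := exists_tendsto_oddPolylog h12 hev one_pos hz (Or.inr hz2)
  obtain ⟨e₂, he₂, he₂t⟩ := exists_tendsto_oddPolylog h12 hev two_pos hz (Or.inr hz2)
  obtain ⟨e₃, he₃, he₃t⟩ := exists_tendsto_oddPolylog h12 hev three_pos hz (Or.inr hz2)
  have hL : Tendsto (fun x : ℝ => Complex.log (x * zetaTwelve)) (𝓝[<] 1)
      (𝓝 (Real.pi * Complex.I / 6)) := by
    refine (ContinuousAt.tendsto_of_eq (ContinuousAt.clog (by fun_prop) (Or.inl ?_))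
      (by rw [Complex.ofReal_one, one_mul, log_zetaTwelve])).mono_left nhdsWithin_le_nhds
    rw [Complex.ofReal_one, one_mul, zetaTwelve_re]
    linarith [sqrt_three_bounds.1]
  have hp2 := pi_mul_I_mul_mem_cmzvSpan he₂
  have hp1 := pi_mul_I_mul_mem_cmzvSpan (pi_mul_I_mul_mem_cmzvSpan he₁)
  -- Substitute log ζ = πi/6: the `e₁` coefficient is (πi)²(-1/36 + 1/12) and the `e₂` coefficient
  -- is πi(1/3 - 1/2).
  refine ⟨(1 / 6 : ℚ) • (Real.pi * Complex.I * f) - g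
    + (1 / 18 : ℚ) • (Real.pi * Complex.I * (Real.pi * Complex.I * e₁)) - (2 : ℚ) • e₃
    - (1 / 6 : ℚ) • (Real.pi * Complex.I * e₂), ?_, ?_⟩
  · exact sub_mem (sub_mem (add_mem (sub_mem
      (Submodule.smul_mem _ _ (pi_mul_I_mul_mem_cmzvSpan hf)) hg) (Submodule.smul_mem _ _ hp1))
      (Submodule.smul_mem _ _ he₃)) (Submodule.smul_mem _ _ hp2)
  · have h := (((((hL.mul hft).sub hgt).sub ((hL.pow 2).mul he₁t)).add
      ((hL.mul he₂t).const_mul 2)).sub (he₃t.const_mul 2)).add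
      (((hL.mul he₁t).sub he₂t).const_mul (Real.pi * Complex.I / 2 : ℂ))
    convert h using 2
    · rw [mplPrimitive]
    · simp only [Rat.smul_def]; push_cast; ring

theorem ofReal_mul_zetaTwelve_mem_halfDisc {x : ℝ} (hx : x ∈ Set.Ioo (0 : ℝ) 1) :
    x * zetaTwelve ∈ halfDisc := by
  refine ⟨?_, ?_⟩
  · rw [norm_mul, norm_zetaTwelve, mul_one]
    exact (ofReal_mem_halfDisc hx).1
  · rw [Complex.re_ofReal_mul, zetaTwelve_re]
    have := sqrt_three_bounds.1
    exact mul_pos hx.1 (by linarith)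

theorem one_add_zetaTwelve_ne_zero : 1 + zetaTwelve ≠ 0 :=
  ne_zero_of_re_pos (by
    rw [Complex.add_re, zetaTwelve_re, Complex.one_re]
    linarith [sqrt_three_bounds.1])

/-- The Cayley image of e^{iθ} is -i tan(θ/2), and tan(π/12) = 2 - √3. -/
theorem cayley_zetaTwelve : cayley zetaTwelve = -Complex.I * ((2 - Real.sqrt 3 : ℝ) : ℂ) := by
  rw [cayley, div_eq_iff one_add_zetaTwelve_ne_zero]
  have e : zetaTwelve = ((Real.sqrt 3 : ℝ) : ℂ) / 2 + 1 / 2 * Complex.I := by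
    apply Complex.ext
    · rw [zetaTwelve_re]; simp
    · rw [zetaTwelve_im]; simp
  rw [e]
  push_cast
  linear_combination (-Complex.I / 2) * sqrt_three_sq
    + ((2 - Real.sqrt 3 : ℂ) / 2) * Complex.I_sq

/-- At M = -i(2 - √3) the term πi/2 cancels the imaginary part of log M, leaving 2 log 2 + log(2 -
√3), the factor multiplying the dilogarithms in the series formula. -/
theorem arcsinPrimitive_cayley_zetaTwelve :
    2 * polySeries 2 arcsinCoeff (1 / 2)
      = Complex.I * (2 * arcsinPrimitive (cayley zetaTwelve)) := by
  have h := sqrt_three_bounds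
  have hp := Real.pi_pos
  have hl : Complex.log (-Complex.I * ((2 - Real.sqrt 3 : ℝ) : ℂ))
      = Real.log (2 - Real.sqrt 3) - Real.pi * Complex.I / 2 := by
    have hl := log_real_mul_exp (r := 2 - Real.sqrt 3) (θ := -(Real.pi / 2)) (by linarith)
      (by linarith) (by linarith)
    have e : Complex.exp ((-(Real.pi / 2) : ℝ) * Complex.I) = -Complex.I := by
      push_cast
      rw [neg_mul, Complex.exp_neg, Complex.exp_pi_div_two_mul_I, Complex.inv_I]
    rw [e, mul_comm] at hl
    rw [hl]
    push_cast
    ring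
  rw [polySeries_two_arcsinCoeff_half, arcsinPrimitive, cayley_zetaTwelve, oddPolylog, oddPolylog,
    hl]
  simp only [neg_mul, neg_neg]
  push_cast
  ring

/-- Although ζ lies on the unit circle, its Cayley image is an interior point of the disc away from
the cut of the logarithm. It is outside `halfDisc`, being purely imaginary, so the value there is
reached as a radial limit. -/
theorem continuousAt_arcsinPrimitive_cayley_zetaTwelve :
    ContinuousAt (fun x : ℝ => arcsinPrimitive (cayley (x * zetaTwelve))) 1 := by
  have h := sqrt_three_bounds
  have hM : ‖cayley zetaTwelve‖ < 1 := by
    refine norm_cayley_lt_one ?_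
    rw [zetaTwelve_re]
    linarith
  have hc : ContinuousAt (fun x : ℝ => cayley (x * zetaTwelve)) 1 := by
    unfold cayley
    refine ContinuousAt.div (by fun_prop) (by fun_prop) ?_
    rw [Complex.ofReal_one, one_mul]
    exact one_add_zetaTwelve_ne_zero
  have ho : ∀ s : ℕ, ContinuousAt (oddPolylog (s + 1)) (cayley zetaTwelve) := fun s =>
    (ContinuousAt.comp (g := polylog (s + 1)) (continuousAt_polylog s (by rwa [norm_neg]))
      continuousAt_neg).sub (continuousAt_polylog s hM)
  have hn : ContinuousAt (fun M => nielsenS12 (-M)) (cayley zetaTwelve) :=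
    ContinuousAt.comp (g := nielsenS12) (continuousAt_nielsenS12 (by rwa [norm_neg]))
      continuousAt_neg
  have hl : ContinuousAt Complex.log (cayley zetaTwelve) := by
    refine continuousAt_clog (Or.inr ?_)
    rw [cayley_zetaTwelve]
    simp
    linarith
  have hA : ContinuousAt arcsinPrimitive (cayley zetaTwelve) :=
    (((hl.const_add _).mul (ho 1)).sub (ho 2)).add
      ((hn.sub (continuousAt_nielsenS12 hM)).const_mul 2)
  refine ContinuousAt.comp (g := arcsinPrimitive) ?_ hc
  rwa [Complex.ofReal_one, one_mul]

theorem two_mul_polySeries_arcsinCoeff_half_mem :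
    2 * polySeries 2 arcsinCoeff (1 / 2) ∈ Complex.I • cmzvSpan 3 12 := by
  obtain ⟨a, ha, hat⟩ := exists_tendsto_mplPrimitive_ofReal
  obtain ⟨b, hb, hbt⟩ := exists_tendsto_mplPrimitive_zetaTwelve
  have hne : (Filter.map (fun x : ℝ => (x : ℂ)) (𝓝[<] 1)).NeBot := inferInstance
  -- The constant comes from w → 1 along the reals: there the Cayley image tends to 0, where
  -- `arcsinPrimitive` tends to 0.
  have key : ∀ w ∈ halfDisc, arcsinPrimitive (cayley w) - mplPrimitive w = -a := by
    intro w hw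
    refine convex_halfDisc.eq_of_hasDerivAt_zero_of_tendsto isOpen_halfDisc
      (f := fun w => arcsinPrimitive (cayley w) - mplPrimitive w)
      (l := Filter.map (fun x : ℝ => (x : ℂ)) (𝓝[<] 1)) ?_ ?_ ?_ hw
    · intro z hz
      refine ((hasDerivAt_arcsinPrimitive_cayley hz).sub
        (hasDerivAt_mplPrimitive hz)).congr_deriv (sub_self _)
    · rw [Filter.eventually_map]
      filter_upwards [Ioo_mem_nhdsLT (zero_lt_one' ℝ)] with x hx
      exact ofReal_mem_halfDisc hx
    · rw [tendsto_map'_iff]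
      simpa [Function.comp_def] using
        (tendsto_arcsinPrimitive_zero.comp tendsto_cayley_ofReal).sub hat
  have hz : arcsinPrimitive (cayley zetaTwelve) = b - a := by
    have h1 := (continuousAt_arcsinPrimitive_cayley_zetaTwelve.tendsto_of_eq
      (c := arcsinPrimitive (cayley zetaTwelve))
      (by rw [Complex.ofReal_one, one_mul])).mono_left (nhdsWithin_le_nhds (s := Set.Iio 1))
    refine tendsto_nhds_unique h1 ((hbt.sub_const a).congr' ?_)
    filter_upwards [Ioo_mem_nhdsLT (zero_lt_one' ℝ)] with x hx
    linear_combination -key _ (ofReal_mul_zetaTwelve_mem_halfDisc hx)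
  rw [Submodule.mem_smul_pointwise_iff_exists]
  refine ⟨(2 : ℚ) • (b - a), Submodule.smul_mem _ _ (sub_mem hb ha), ?_⟩
  rw [arcsinPrimitive_cayley_zetaTwelve, hz, Rat.smul_def, smul_eq_mul]
  push_cast
  ring

end

theorem theorem1 :
    HasSum (fun n : ℕ => 1 / ((2 * (n : ℂ) + 1) ^ 3 * (Nat.choose (2 * n) n : ℂ)))
      (32 * (catalanLike : ℂ) / 3
        - 4 * (Real.pi : ℂ) * polylog 2 ((2 - Real.sqrt 3 : ℝ) : ℂ) / 3
        - (Real.pi : ℂ) ^ 3 / 9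
        - (Real.pi : ℂ) * ((Real.log 2 - Real.log (2 + Real.sqrt 3) : ℝ) : ℂ) ^ 2 / 3) ∧
    (∑' n : ℕ, 1 / ((2 * (n : ℂ) + 1) ^ 3 * (Nat.choose (2 * n) n : ℂ))) ∈
      Complex.I • cmzvSpan 3 12 := by
  refine ⟨hasSum_closed_form, ?_⟩
  rw [hasSum_inv_centralBinom.tsum_eq]
  exact two_mul_polySeries_arcsinCoeff_half_mem
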